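/- **Model.** A register is classical or quantum and has a finite basis. A gate is a unitary on quantum registers, a permutation of the values of classical registers, or a measurement into a fresh classical register; it may be classically controlled, and it may sleep until an activation register has been set. A circuit is a finite set of gates with a partial ordering that depends on the initial values of the classical registers (where a register that stores the outcome of a measurement has this outcome as initial value), such that any two gates that can both be active and access a same register are ordered. A *protocol* is a finite set of role-circuits; each has its own registers, its own ordering, and shares only channel registers with other circuits. A channel register is insecure, authenticated (others can read it if it is classical, and cannot access it if it is quantum), or hidden. A corruptible role-circuit $r$ has a corruption register $C_r$, and its gates are active only if $C_r=0$. Some channel registers are designated as input/output channels. A *valid environment* $E$ for a protocol $P$ is a circuit with its own registers and an output bit $Z$, together with a choice of the relative order of its gates and those of $P$, and of the communication gates of distinct circuits of $P$ that share a channel register, such that $E+P$ is a circuit. Its gates may access its own registers, the input/output channels, the corruption registers, the other channels in accordance with their types, and, if active only when $C_r=1$, the registers of $r$ and the channels of $r$ in the name of $r$. An *ideal protocol* $I$ for $P$ is a protocol that shares with $P$ only the input/output channels and corruption registers; every circuit of $P$ that uses an input/output channel has a counterpart in $I$ with the same identity and corruption register. A *valid simulator* $S$ (which may depend on $E$) is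 a circuit that owns private registers and simulated copies of the registers of $P$ not shared with $I$, can read but never modify the corruption registers of $I$, and otherwise interacts with $I$ only by gates that are active only when some circuit $r$ of $I$ is corrupted, which access the registers of $r$, the channels of $r$ in the name of $r$, and the internal channels of $I$ in accordance with their types; $E+I+S$ must be a circuit. $P$ *$\epsilon$-securely realizes* $I$ if for every valid $E$ there is a valid $S$ with $$|\Pr(Z_{E+P}=0)-\Pr(Z_{E+I+S}=0)|\le\epsilon .$$ The size of a circuit is the sum over its gates of the dimension of the space on which the gate acts, and $n$ is the security parameter. A function $\epsilon(n,m)$ is *negligible* if for all $f$ bounded by a polynomial and all polynomials $q$, $\epsilon(n,f(n))\,q(n)\le 1$ for large $n$; in a stronger variant, for all such $f$ there is $\alpha>0$ with $\epsilon(n,f(n))\le 2^{-\alpha n}$ for large $n$. A protocol definition $P$ (a family of copies, for every $n$) *computationally realizes* $I$ if $P$ and $I$ have size polynomial in $n$ and there are a negligible $\epsilon$ and a polynomial $p$, the same for all copies, such that for all $n$, all copies and all valid $E$ there is a valid $S$ of size at most $p(n)$ with $|\Pr(Z_{E+P}=0)-\Pr(Z_{E+I+S}=0)|\le\epsilon(n,|E|)$.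 **Theorem.** For every $n$ let $P=P_n$ be a protocol organized as a finite rooted tree of sub-protocols $Q=M(Q)+\sum_{R\in\mathcal C(Q)}R$, where $M(Q)$ is the main module of $Q$ and $\mathcal C(Q)$ is the set of its children, with an ideal protocol $I(Q)$ for every $Q$; let $\widetilde Q=M(Q)+\sum_{R\in\mathcal C(Q)}I(R)$. Distinct circuits use distinct gates and registers, except that a sub-protocol shares its input/output channels with the outside, and an ideal protocol shares input/output channels and corruption registers with what it replaces. 1. *Unconditional scenario.* For every $n$: if for every sub-protocol $Q$ of $P$ (including $P$), $\widetilde Q$ $\epsilon_{\widetilde Q}$-securely realizes $I(Q)$, where $\epsilon_{\widetilde Q}$ does not depend on the environment, then $P$ $\epsilon_P$-securely realizes $I(P)$ with $\epsilon_P=\sum_Q\epsilon_{\widetilde Q}$. 2. *Computational scenario.* Suppose that the number of sub-protocols of $P_n$ is bounded by a polynomial in $n$, and that they are copies of finitely many protocol definitions. If for each of these definitions $\widetilde Q$ computationally realizes $I(Q)$, then $P$ computationally realizes $I(P)$. This holds for each of the two notions of negligible function. -/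

import Mathlib

open scoped BigOperators

noncomputable section

/-! ## Registers -/

/-- The security types of a channel register. -/
inductive ChannelType
  | insecure
  | authenticated
  | hidden
  deriving DecidableEq

/-- What a register is used for.  A channel register, and an activation register (the register by
which a communication gate is woken up), carries its channel-type, its sender-ID and its
recipient-ID. -/
inductive RegKind
  | storage
  | channel (type : ChannelType) (sender recipient : ℕ)
  | activation (type : ChannelType) (sender recipient : ℕ)
  | corruption
  deriving DecidableEq

/-- A register, with its unique name.  Its basis states are `0, …, top`. -/
structure Reg where
  name : ℕ
  classical : Bool
  top : ℕ
  kind : RegKind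
  deriving DecidableEq

/-- The basis states (for a classical register, the values) of a register. -/
abbrev Val (ρ : Reg) : Type := Fin (ρ.top + 1)

/-- An assignment of a basis state to every register. -/
abbrev Conf : Type := (ρ : Reg) → Val ρ

/-- Degrees of access to a register. -/
inductive Access
  | none
  | read
  | full
  deriving DecidableEq

/-- Channel registers, including the activation registers of communication gates. -/
def Reg.IsLink (ρ : Reg) : Prop :=
  (∃ t s d, ρ.kind = .channel t s d) ∨ (∃ t s d, ρ.kind = .activation t s d)

/-- The access that a channel-type gives to somebody who is neither the sender nor the recipient:
an authenticated register can be read if it is classical, and cannot be accessed if it is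
quantum. -/
def ChannelType.outsider (classical : Bool) : ChannelType → Access
  | .insecure => .full
  | .authenticated => if classical then .read else .none
  | .hidden => .none

/-- The access of an outsider to a register. -/
def Reg.outsider (ρ : Reg) : Access :=
  match ρ.kind with
  | .channel t _ _ => t.outsider ρ.classical
  | .activation t _ _ => t.outsider ρ.classical
  | _ => .none

/-- The access to a channel register of a circuit whose identity is `i`. -/
def Reg.accessAs (ρ : Reg) (i : ℕ) : Access :=
  match ρ.kind with
  | .channel t s d => if i = s ∨ i = d then .full else t.outsider ρ.classical
  | .activation t s d => if i = s ∨ i = d then .full else t.outsider ρ.classical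
  | _ => .none

/-! ## Gates -/

/-- The operations: a unitary transformation, a permutation of classical values, and a measurement
of `q` whose outcome is stored in `c`. -/
inductive Op
  | unitary (tgt : Finset Reg) (U : Matrix.unitaryGroup ((ρ : tgt) → Val ρ.1) ℂ)
  | perm (tgt : Finset Reg) (σ : Equiv.Perm ((ρ : tgt) → Val ρ.1))
  | measure (q c : Reg)

/-- The registers on which an operation acts. -/
def Op.tgt : Op → Finset Reg
  | .unitary A _ => A
  | .perm A _ => A
  | .measure q c => {q, c}

/-- The fresh classical register in which a measurement stores its outcome. -/
def Op.outcome : Op → Finset Reg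
  | .measure _ c => {c}
  | _ => ∅

/-- Unitaries act on quantum registers, permutations on classical registers, a measurement takes a
quantum register to a classical register of the same dimension. -/
def Op.WellTyped : Op → Prop
  | .unitary A _ => ∀ ρ ∈ A, ρ.classical = false
  | .perm A _ => ∀ ρ ∈ A, ρ.classical = true
  | .measure q c => q.classical = false ∧ c.classical = true ∧ q.top = c.top

/-- A classically controlled gate.  The controlled part `op` is active when every control register
has the required value.  If `wake = some a`, the gate sleeps until its activation register `a` is
set to `1` (WAKE-UP). The number `id` distinguishes gates that do the same thing. -/
structure Gate where
  id : ℕ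
  ctrl : Finset (Reg × ℕ)
  op : Op
  wake : Option Reg
  ctrl_classical : ∀ p ∈ ctrl, p.1.classical = true
  op_wellTyped : op.WellTyped
  ctrl_tgt : ∀ p ∈ ctrl, p.1 ∉ op.tgt
  wake_ctrl : ∀ a, wake = some a → (a, 1) ∈ ctrl

instance : DecidableEq Gate := Classical.decEq _

/-- The control registers of a gate. -/
def Gate.ctrlRegs (g : Gate) : Finset Reg := g.ctrl.image Prod.fst

/-- The target registers of a gate. -/
def Gate.tgt (g : Gate) : Finset Reg := g.op.tgt

/-- All registers of a gate. -/
def Gate.regs (g : Gate) : Finset Reg := g.ctrlRegs ∪ g.tgt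

/-- The size of a gate is the dimension of the space on which it acts, so that a gate on many
registers is not counted as elementary. -/
def Gate.size (g : Gate) : ℕ := ∏ ρ ∈ g.regs, (ρ.top + 1)

/-- The controlled part of the gate is active in the configuration `c`. -/
def Gate.Active (g : Gate) (c : Conf) : Prop := ∀ p ∈ g.ctrl, (c p.1 : ℕ) = p.2

/-- There are values of the control registers for which both gates are active. -/
def Gate.Compatible (g h : Gate) : Prop :=
  ∀ p ∈ g.ctrl, ∀ q ∈ h.ctrl, p.1 = q.1 → p.2 = q.2

/-- Overwrite the values of the registers in `A`. -/
def Conf.overwrite (c : Conf) (A : Finset Reg) (a : (ρ : A) → Val ρ.1) : Conf :=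
  fun ρ => if h : ρ ∈ A then a ⟨ρ, h⟩ else c ρ

/-- The restriction of a configuration to the registers in `A`. -/
def Conf.on (c : Conf) (A : Finset Reg) : (ρ : A) → Val ρ.1 := fun ρ => c ρ.1

open Classical in
/-- The action on a basis vector.  A register that stores the outcome of a measurement has this
outcome as initial value, and the measurement changes no classical value: a measurement whose
outcome is the value of `o` projects on the corresponding basis state of `q`; if it is not active,
the register `o` stays at zero. -/
def Gate.onBasis (g : Gate) (c : Conf) : Conf →₀ ℂ :=
  if g.Active c then
    match g.op with
    | .unitary A U =>
        ∑ a : ((ρ : A) → Val ρ.1),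
          Finsupp.single (c.overwrite A a)
            ((U : Matrix ((ρ : A) → Val ρ.1) ((ρ : A) → Val ρ.1) ℂ) a (c.on A))
    | .perm A σ => Finsupp.single (c.overwrite A (σ (c.on A))) 1
    | .measure q o => if (c q : ℕ) = (c o : ℕ) then Finsupp.single c 1 else 0
  else
    match g.op with
    | .measure _ o => if (c o : ℕ) = 0 then Finsupp.single c 1 else 0
    | _ => Finsupp.single c 1

/-- The linear action of a gate on (unnormalized) state vectors. -/
def Gate.apply (ψ : Conf →₀ ℂ) (g : Gate) : Conf →₀ ℂ :=
  ψ.sum fun c a => a • g.onBasis c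

/-! ## Circuits and their execution -/

/-- A set of gates with a value-dependent precedence relation and an output bit: `rel x g h` says
that `g` is put before `h` when `x` gives the initial values of the classical registers.  The
ordering is the transitive closure `lt`. -/
structure Setting where
  gates : Finset Gate
  rel : Conf → Gate → Gate → Prop
  out : Reg

namespace Setting

/-- The strict ordering of the gates, for the initial values `x`. -/
def lt (A : Setting) (x : Conf) : Gate → Gate → Prop := Relation.TransGen (A.rel x)

/-- The registers that receive the outcome of a measurement. -/
def outcomes (A : Setting) : Finset Reg := A.gates.biUnion fun g => g.op.outcome

/-- The initial values given by the outcomes of the measurements; every other register, and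
in particular every corruption and every activation register, is initially zero. -/
def init (A : Setting) (v : (ρ : A.outcomes) → Val ρ.1) : Conf :=
  Conf.overwrite (fun _ => 0) A.outcomes v

/-- The sequence `l` executes every gate once, in accordance with the ordering at `x`. -/
def IsSequence (A : Setting) (x : Conf) (l : List Gate) : Prop :=
  l.Nodup ∧ (∀ g, g ∈ l ↔ g ∈ A.gates) ∧ l.Pairwise fun g h => ¬ A.lt x h g

/-- The setting is a circuit. -/
structure IsCircuit (A : Setting) : Prop where
  /-- For all initial values, the gates are partially ordered. -/
  acyclic : ∀ v g, ¬ A.lt (A.init v) g g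
  /-- Two gates that access a same register, at least one of them acting on it, are ordered; a
  control register is always accessed, a common target register only matters if there are values
  of the control registers for which both gates are active. -/
  ordered : ∀ v, ∀ g ∈ A.gates, ∀ h ∈ A.gates, g ≠ h →
    ∀ ρ ∈ g.tgt, ρ ∈ h.ctrlRegs ∨ (ρ ∈ h.tgt ∧ g.Compatible h) →
      A.rel (A.init v) g h ∨ A.rel (A.init v) h g
  /-- A gate with an activation register is not executed until after the gates that set it. -/
  awake : ∀ v, ∀ g ∈ A.gates, ∀ h ∈ A.gates, ∀ a, g.wake = some a → a ∈ h.tgt →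
    A.rel (A.init v) h g
  /-- No gate can access an outcome register before the measurement. -/
  fresh : ∀ v, ∀ m ∈ A.gates, ∀ h ∈ A.gates, m ≠ h → ∀ ρ ∈ m.op.outcome, ρ ∈ h.regs →
    A.rel (A.init v) m h
  /-- The order can only depend on outcomes of measurements that have already been done. -/
  causal : ∀ v w, ∀ g ∈ A.gates,
    (∀ m ∈ A.gates, A.rel (A.init v) m g → ∀ ρ ∈ m.op.outcome, A.init v ρ = A.init w ρ) →
      ∀ h, A.rel (A.init v) h g ↔ A.rel (A.init w) h g

/-- A choice, for all initial values, of a sequence that executes the circuit.  (All choices give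
the same probabilities, because unordered gates of a circuit commute.) -/
structure Schedule (A : Setting) where
  seq : Conf → List Gate
  isSequence : ∀ v, A.IsSequence (A.init v) (seq (A.init v))

/-- The final (unnormalized) state vector, given the initial values `x`. -/
def final (x : Conf) (l : List Gate) : Conf →₀ ℂ := l.foldl Gate.apply (Finsupp.single x 1)

/-- The probability `Pr(Z = 0)` that the output bit is zero. -/
def zeroProb (A : Setting) (s : A.Schedule) : ℝ :=
  ∑ v : ((ρ : A.outcomes) → Val ρ.1),
    (final (A.init v) (s.seq (A.init v))).sum
      fun c a => if (c A.out : ℕ) = 0 then ‖a‖ ^ 2 else 0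

end Setting

/-- The relation depends on the initial values of the registers in `R` only. -/
def DependsOnlyOn (ord : Conf → Gate → Gate → Prop) (R : Finset Reg) : Prop :=
  ∀ x y : Conf, (∀ ρ ∈ R, x ρ = y ρ) → ∀ g h, ord x g h ↔ ord y g h

/-- The two gates have a register in common. -/
def ShareReg (g h : Gate) : Prop := ∃ ρ, ρ ∈ g.regs ∧ ρ ∈ h.regs

/-- The two gates have a channel register in common. -/
def ShareLink (g h : Gate) : Prop := ∃ ρ, ρ.IsLink ∧ ρ ∈ g.regs ∧ ρ ∈ h.regs

/-- The total size of a set of gates. -/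
def gatesSize (G : Finset Gate) : ℕ := ∑ g ∈ G, g.size

/-! ## Protocols -/

/-- A module-role-circuit: its identity, its own registers, its channel registers, its corruption
register (if it is corruptible), its gates and their value-dependent ordering. -/
structure Role where
  id : ℕ
  priv : Finset Reg
  links : Finset Reg
  cor : Option Reg
  gates : Finset Gate
  ord : Conf → Gate → Gate → Prop

instance : DecidableEq Role := Classical.decEq _

/-- All registers of a module-role-circuit. -/
def Role.regs (r : Role) : Finset Reg := r.priv ∪ r.links ∪ r.cor.toFinset

/-- The rules for a module-role-circuit. -/
structure Role.WellFormed (r : Role) : Prop where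
  priv_kind : ∀ ρ ∈ r.priv, ρ.kind = .storage
  links_kind : ∀ ρ ∈ r.links, ρ.IsLink ∧ ρ.accessAs r.id ≠ .none
  cor_kind : ∀ C, r.cor = some C → C.kind = .corruption ∧ C.classical = true ∧ C.top = 1
  write : ∀ g ∈ r.gates, ∀ ρ ∈ g.tgt,
    ρ ∈ r.priv ∨ (ρ ∈ r.links ∧ ρ.accessAs r.id = .full)
  read : ∀ g ∈ r.gates, ∀ ρ ∈ g.ctrlRegs, ρ ∈ r.priv ∨ ρ ∈ r.links ∨ r.cor = some ρ
  /-- The gates of a corruptible circuit do nothing when the circuit is corrupted. -/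
  honest : ∀ C, r.cor = some C → ∀ g ∈ r.gates, (C, 0) ∈ g.ctrl
  wake_kind : ∀ g ∈ r.gates, ∀ a, g.wake = some a →
    a ∈ r.links ∧ a.top = 1 ∧ ∃ t s d, a.kind = .activation t s d
  ord_gates : ∀ x g h, r.ord x g h → g ∈ r.gates ∧ h ∈ r.gates
  ord_irrefl : ∀ x g, ¬ r.ord x g g
  ord_trans : ∀ x g h k, r.ord x g h → r.ord x h k → r.ord x g k
  ord_local : DependsOnlyOn r.ord r.priv

/-- A protocol is a set of module-role-circuits; `io` is the set of its input and output channel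
registers, by which it communicates with the application that calls it. -/
structure Protocol where
  roles : Finset Role
  io : Finset Reg

namespace Protocol

def gates (P : Protocol) : Finset Gate := P.roles.biUnion Role.gates

def links (P : Protocol) : Finset Reg := P.roles.biUnion Role.links

/-- The corruption registers of the protocol. -/
def cors (P : Protocol) : Finset Reg := P.roles.biUnion fun r => r.cor.toFinset

def regs (P : Protocol) : Finset Reg := P.roles.biUnion Role.regs ∪ P.io

def size (P : Protocol) : ℕ := gatesSize P.gates

/-- The gate `g` belongs to the adversary circuit of the corruptible circuit `r` of `P`: it is
active only when `r` is corrupted. -/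
def ActsFor (P : Protocol) (g : Gate) (r : Role) : Prop :=
  r ∈ P.roles ∧ ∃ C, r.cor = some C ∧ (C, 1) ∈ g.ctrl

/-- The module-role-circuits obey the rules, and have only channel registers in common. -/
structure WellFormed (P : Protocol) : Prop where
  roles_wf : ∀ r ∈ P.roles, r.WellFormed
  roles_regs : ∀ r ∈ P.roles, ∀ s ∈ P.roles, r ≠ s → ∀ ρ, ρ ∈ r.regs → ρ ∈ s.regs → ρ.IsLink
  roles_gates : ∀ r ∈ P.roles, ∀ s ∈ P.roles, r ≠ s → Disjoint r.gates s.gates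
  io_link : ∀ ρ ∈ P.io, ρ.IsLink

/-- The channel registers by which the circuit `r` communicates with the application are also at the
disposal of a circuit of the ideal protocol `I` that has the same identity and is corrupted by
the same corruption register. -/
def IOCorrespondence (P I : Protocol) : Prop :=
  ∀ r ∈ P.roles, ∀ ρ ∈ r.links, ρ ∈ I.io →
    ∃ r' ∈ I.roles, r'.id = r.id ∧ r'.cor = r.cor ∧ ρ ∈ r'.links

end Protocol

/-! ## Environments and simulators -/

/-- A circuit that interacts with others: its own registers, its gates, the ordering `ord` of its
gates, which depends on the initial values of its own registers, and a choice `cross` of order for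
pairs of gates that are not both its own.  This choice does not depend on register values, so that
nobody learns the values of hidden registers from the order of the gates. -/
structure OpenCircuit where
  regs : Finset Reg
  gates : Finset Gate
  ord : Conf → Gate → Gate → Prop
  cross : Gate → Gate → Prop

def OpenCircuit.size (S : OpenCircuit) : ℕ := gatesSize S.gates

/-- The environment has an output bit `out`, called `Z`. -/
structure Environment extends OpenCircuit where
  out : Reg

namespace Environment

/-- `E + P`. -/
def withProtocol (E : Environment) (P : Protocol) : Setting where
  gates := E.gates ∪ P.gates
  rel x g h := E.ord x g h ∨ E.cross g h ∨ ∃ r ∈ P.roles, r.ord x g h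
  out := E.out

/-- `E + I + S`.  The environment keeps its gates and their ordering; the order of the gates of
the environment and of the ideal protocol relative to the others is chosen with the simulator. -/
def withIdeal (E : Environment) (I : Protocol) (S : OpenCircuit) : Setting where
  gates := E.gates ∪ I.gates ∪ S.gates
  rel x g h := E.ord x g h ∨ S.ord x g h ∨ S.cross g h ∨ ∃ r ∈ I.roles, r.ord x g h
  out := E.out

/-- The registers that a gate of the environment can modify: the registers of the environment, the
input/output channels, the corruption registers, the channel registers that everybody can
modify, and, for a gate of the adversary circuit of `r`, the registers of the corrupted circuit `r`
and the channel registers in the name of `r`. -/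
def MayWrite (E : Environment) (P : Protocol) (g : Gate) (ρ : Reg) : Prop :=
  ρ ∈ E.regs ∨ ρ ∈ P.io ∨ ρ ∈ P.cors ∨ (ρ ∈ P.links ∧ ρ.outsider = .full) ∨
    ∃ r, P.ActsFor g r ∧ (ρ ∈ r.priv ∨ (ρ ∈ r.links ∧ ρ.accessAs r.id = .full))

/-- The registers that a gate of the environment can read. -/
def MayRead (E : Environment) (P : Protocol) (g : Gate) (ρ : Reg) : Prop :=
  ρ ∈ E.regs ∨ ρ ∈ P.io ∨ ρ ∈ P.cors ∨ (ρ ∈ P.links ∧ ρ.outsider ≠ .none) ∨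
    ∃ r, P.ActsFor g r ∧ (ρ ∈ r.priv ∨ (ρ ∈ r.links ∧ ρ.accessAs r.id ≠ .none))

/-- Valid environments for `P`. -/
structure Valid (E : Environment) (P : Protocol) : Prop where
  regs_disjoint : Disjoint E.regs P.regs
  gates_disjoint : Disjoint E.gates P.gates
  out_mem : E.out ∈ E.regs
  out_bit : E.out.classical = true ∧ E.out.top = 1
  write : ∀ g ∈ E.gates, ∀ ρ ∈ g.tgt, E.MayWrite P g ρ
  read : ∀ g ∈ E.gates, ∀ ρ ∈ g.ctrlRegs, E.MayRead P g ρ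
  ord_gates : ∀ x g h, E.ord x g h → g ∈ E.gates ∧ h ∈ E.gates
  ord_local : DependsOnlyOn E.ord E.regs
  /-- The environment orders its gates relative to those of `P`, and the communication gates of
  distinct circuits of `P` that share a channel register. -/
  cross_pairs : ∀ g h, E.cross g h →
    (g ∈ E.gates ∧ h ∈ P.gates ∧ ShareReg g h) ∨
    (g ∈ P.gates ∧ h ∈ E.gates ∧ ShareReg g h) ∨
    (g ∈ P.gates ∧ h ∈ P.gates ∧ ShareLink g h ∧ ∀ r ∈ P.roles, ¬ (g ∈ r.gates ∧ h ∈ r.gates))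
  isCircuit : (E.withProtocol P).IsCircuit

/-- The environment does not use, for something else, names that are used in `I`. -/
def Avoids (E : Environment) (I : Protocol) : Prop :=
  Disjoint E.regs I.regs ∧ Disjoint E.gates I.gates

end Environment

namespace OpenCircuit

/-- The registers of a simulator: private ones, and the simulated registers, which are the
registers of `P` that are not shared with the ideal protocol `I`. -/
def simRegs (S : OpenCircuit) (P I : Protocol) : Finset Reg := S.regs ∪ (P.regs \ I.regs)

/-- The registers that a gate of the simulator can modify.  The simulator interacts with the ideal
protocol by adversary circuits of corrupted circuits of `I` only, and with the input/output channels
only in the name of a corrupted circuit.  It never modifies a corruption register of `I`. -/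
def SimMayWrite (S : OpenCircuit) (P I : Protocol) (g : Gate) (ρ : Reg) : Prop :=
  ρ ∈ S.simRegs P I ∨
    ∃ r, I.ActsFor g r ∧
      (ρ ∈ r.priv ∨ (ρ ∈ r.links ∧ ρ.accessAs r.id = .full) ∨
        (ρ ∈ I.links ∧ ρ ∉ I.io ∧ ρ.outsider = .full))

/-- The registers that a gate of the simulator can read. -/
def SimMayRead (S : OpenCircuit) (P I : Protocol) (g : Gate) (ρ : Reg) : Prop :=
  ρ ∈ S.simRegs P I ∨ ρ ∈ I.cors ∨
    ∃ r, I.ActsFor g r ∧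
      (ρ ∈ r.priv ∨ (ρ ∈ r.links ∧ ρ.accessAs r.id ≠ .none) ∨
        (ρ ∈ I.links ∧ ρ ∉ I.io ∧ ρ.outsider ≠ .none))

/-- Valid simulators for `P` and `I`, against the environment `E`. -/
structure ValidSimulator (S : OpenCircuit) (E : Environment) (P I : Protocol) : Prop where
  regs_disjoint : Disjoint S.regs E.regs ∧ Disjoint S.regs P.regs ∧ Disjoint S.regs I.regs
  gates_disjoint : Disjoint S.gates E.gates ∧ Disjoint S.gates I.gates
  write : ∀ g ∈ S.gates, ∀ ρ ∈ g.tgt, S.SimMayWrite P I g ρ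
  read : ∀ g ∈ S.gates, ∀ ρ ∈ g.ctrlRegs, S.SimMayRead P I g ρ
  ord_gates : ∀ x g h, S.ord x g h → g ∈ S.gates ∧ h ∈ S.gates
  ord_local : DependsOnlyOn S.ord (S.simRegs P I)
  cross_pairs : ∀ g h, S.cross g h →
    (g ∈ S.gates ∧ h ∈ E.gates ∪ I.gates ∧ ShareReg g h) ∨
    (g ∈ E.gates ∪ I.gates ∧ h ∈ S.gates ∧ ShareReg g h) ∨
    (g ∈ E.gates ∧ h ∈ I.gates ∧ ShareReg g h) ∨
    (g ∈ I.gates ∧ h ∈ E.gates ∧ ShareReg g h) ∨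
    (g ∈ I.gates ∧ h ∈ I.gates ∧ ShareLink g h ∧ ∀ r ∈ I.roles, ¬ (g ∈ r.gates ∧ h ∈ r.gates))
  isCircuit : (E.withIdeal I S).IsCircuit

end OpenCircuit

/-! ## Security definitions -/

/-- `|Pr(Z = 0) - Pr(Z' = 0)| ≤ ε` for the output bits of the two settings. -/
def Close (A B : Setting) (ε : ℝ) : Prop :=
  ∀ (s : A.Schedule) (t : B.Schedule), |A.zeroProb s - B.zeroProb t| ≤ ε

/-- `P` `ε`-securely realizes `I`, where `ε` may depend on the environment. -/
def SecurelyRealizes (P I : Protocol) (ε : Environment → ℝ) : Prop :=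
  ∀ E : Environment, E.Valid P → E.Avoids I →
    ∃ S : OpenCircuit, S.ValidSimulator E P I ∧
      Close (E.withProtocol P) (E.withIdeal I S) (ε E)

/-- `ε n m`, where `m` stands for the size of the environment, is smaller than the inverse of every
polynomial in `n` whenever `m` is bounded by a polynomial in `n`. -/
def Negligible (ε : ℕ → ℕ → ℝ) : Prop :=
  ∀ (p : Polynomial ℕ) (f : ℕ → ℕ), (∀ n, f n ≤ p.eval n) →
    ∀ q : Polynomial ℕ, ∀ᶠ n in Filter.atTop, ε n (f n) * ((q.eval n : ℕ) : ℝ) ≤ 1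

/-- The stronger variant, with an exponentially small bound. -/
def ExpNegligible (ε : ℕ → ℕ → ℝ) : Prop :=
  ∀ (p : Polynomial ℕ) (f : ℕ → ℕ), (∀ n, f n ≤ p.eval n) →
    ∃ α : ℝ, 0 < α ∧ ∀ᶠ n : ℕ in Filter.atTop, ε n (f n) ≤ (2 : ℝ) ^ (-(α * (n : ℝ)))

/-- The protocol definition `P` computationally realizes `I`.  Here `P n k` is the `k`-th copy of the
protocol for the security parameter `n`; the polynomial bounds and the negligible function (in the
sense of `Neg`) depend on the definition, not on the copy. -/
def ComputationallyRealizes (Neg : (ℕ → ℕ → ℝ) → Prop) {κ : ℕ → Type}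
    (P I : (n : ℕ) → κ n → Protocol) : Prop :=
  (∃ p : Polynomial ℕ, ∀ n k, (P n k).size ≤ p.eval n) ∧
  (∃ p : Polynomial ℕ, ∀ n k, (I n k).size ≤ p.eval n) ∧
  ∃ ε : ℕ → ℕ → ℝ, Neg ε ∧ ∃ p : Polynomial ℕ,
    ∀ n k, ∀ E : Environment, E.Valid (P n k) → E.Avoids (I n k) →
      ∃ S : OpenCircuit, S.ValidSimulator E (P n k) (I n k) ∧ S.size ≤ p.eval n ∧
        Close (E.withProtocol (P n k)) (E.withIdeal (I n k) S) (ε n E.size)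

/-! ## Trees of sub-protocols -/

/-- A finite rooted tree of sub-protocols: every node has a main module and an ideal protocol. -/
structure ProtocolTree where
  Node : Type
  fintypeNode : Fintype Node
  root : Node
  parent : Node → Option Node
  parent_root : parent root = none
  reaches_root : ∀ q, Relation.ReflTransGen (fun a b => parent a = some b) q root
  main : Node → Finset Role
  ideal : Node → Protocol

namespace ProtocolTree

instance (T : ProtocolTree) : Fintype T.Node := T.fintypeNode

/-- The node `i` belongs to the subtree with root `q`. -/
def Below (T : ProtocolTree) (i q : T.Node) : Prop :=
  Relation.ReflTransGen (fun a b => T.parent a = some b) i q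

open Classical in
/-- The nodes called by the main module of `q`. -/
def children (T : ProtocolTree) (q : T.Node) : Finset T.Node :=
  Finset.univ.filter fun i => T.parent i = some q

open Classical in
/-- The sub-protocol with main module `M(q)`: all modules in the subtree of `q`. -/
def sub (T : ProtocolTree) (q : T.Node) : Protocol where
  roles := (Finset.univ.filter fun i => T.Below i q).biUnion T.main
  io := (T.ideal q).io

/-- The main module of `q` together with the ideal protocols of the children of `q`. -/
def tilde (T : ProtocolTree) (q : T.Node) : Protocol where
  roles := T.main q ∪ (T.children q).biUnion fun i => (T.ideal i).roles
  io := (T.ideal q).io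

/-- The whole protocol. -/
def protocol (T : ProtocolTree) : Protocol := T.sub T.root

/-- The main module of `q`, as a protocol. -/
def mainProtocol (T : ProtocolTree) (q : T.Node) : Protocol where
  roles := T.main q
  io := ∅

/-- The register `ρ` occurs in a module or in an ideal protocol in the subtree of `q`. -/
def OccursBelow (T : ProtocolTree) (q : T.Node) (ρ : Reg) : Prop :=
  ∃ i, T.Below i q ∧ (ρ ∈ (T.mainProtocol i).regs ∨ ρ ∈ (T.ideal i).regs)

/-- The conventions on names: different circuits have different gates and different registers,
except that a sub-protocol shares its input/output channels with the outside, and an ideal protocol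
shares its input/output channels and corruption registers with what it replaces. -/
structure WellFormed (T : ProtocolTree) : Prop where
  main_wf : ∀ q, (T.mainProtocol q).WellFormed
  ideal_wf : ∀ q, (T.ideal q).WellFormed
  /-- The circuits of `I(q)` that correspond to the circuits with input/output. -/
  correspondence : ∀ q, (T.tilde q).IOCorrespondence (T.ideal q)
  main_outside : ∀ q j, ¬ T.Below j q → ∀ ρ, T.OccursBelow q ρ →
    ρ ∈ (T.mainProtocol j).regs → ρ ∈ (T.ideal q).io
  ideal_outside : ∀ q j, ¬ T.Below j q → ∀ ρ, T.OccursBelow q ρ →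
    ρ ∈ (T.ideal j).regs →
      ρ ∈ (T.ideal q).io ∨ (T.Below q j ∧ ρ ∈ (T.ideal q).cors)
  ideal_own : ∀ q ρ, ρ ∈ (T.ideal q).regs →
    (ρ ∈ (T.mainProtocol q).regs ∨ ∃ i ∈ T.children q, T.OccursBelow i ρ) →
      ρ ∈ (T.ideal q).io ∨ (ρ ∈ (T.tilde q).cors ∧ ρ ∈ (T.ideal q).cors)
  main_gates : ∀ i j, i ≠ j → Disjoint (T.mainProtocol i).gates (T.mainProtocol j).gates
  ideal_gates : ∀ i j, i ≠ j → Disjoint (T.ideal i).gates (T.ideal j).gates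
  main_ideal_gates : ∀ i j, Disjoint (T.mainProtocol i).gates (T.ideal j).gates

end ProtocolTree

end


/-!
The proof is a hybrid argument along the tree. Starting from `E + P`, the sub-protocols are replaced
one after the other, children before parents: once all children of `Q` have been replaced, `Q~` is
running, and everything else (the environment, the other circuits, and the simulators that are
already there) is a valid environment for `Q~`. The hypothesis for this environment gives a
simulator that turns `Q~` into `I(Q)` at the cost of an error of at most `ε_Q~`. After the last
replacement, `I(P)` is the only protocol left. Each simulator acts only on its private registers, on
the simulated registers, and in the name of corrupted circuits, and these rights are passed up the
tree by the correspondence between the circuits of `Q~` and of `I(Q)`; hence all simulators together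
form a valid simulator for `I(P)`, and the errors add up.

The environment and the simulators are quantified without any regard to the rest of the hybrid, so
that their names can clash with names used elsewhere. Involutive renamings of registers and of gates
remove the clashes; they change neither validity, nor size, nor the distribution of the output.

In the computational scenario, every environment that occurs is larger than `E` by at most the sizes
of all protocols and simulators, which is a polynomial in `n`. The total error is at most a
polynomial times the sum of finitely many errors, taken at the worst sizes below that bound.
-/

noncomputable section

section Involution

variable {α : Type*} {f : α → α} {s : Finset α} {a : α}

theorem mem_image_iff_of_involutive [DecidableEq α] (hf : f.Involutive) :
    a ∈ s.image f ↔ f a ∈ s := by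
  rw [Finset.mem_image]
  refine ⟨?_, fun h => ⟨f a, h, hf a⟩⟩
  rintro ⟨b, hb, rfl⟩
  rwa [hf b]

theorem apply_eq_self_of_apply_mem (hf : f.Involutive) (hs : ∀ b ∈ s, f b = b) (h : f a ∈ s) :
    f a = a := by
  rw [← hs _ h, hf a]

theorem apply_mem_iff_of_fixed (hf : f.Involutive) (hs : ∀ b ∈ s, f b = b) : f a ∈ s ↔ a ∈ s :=
  ⟨fun h => apply_eq_self_of_apply_mem hf hs h ▸ h, fun h => (hs a h).symm ▸ h⟩

theorem image_eq_self_of_fixed [DecidableEq α] (hs : ∀ b ∈ s, f b = b) : s.image f = s :=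
  (Finset.image_congr hs).trans Finset.image_id

end Involution

attribute [ext] Gate Setting

theorem Gate.mem_ctrlRegs {g : Gate} {ρ : Reg} : ρ ∈ g.ctrlRegs ↔ ∃ n, (ρ, n) ∈ g.ctrl := by
  simp [Gate.ctrlRegs]

/-! ### Configurations -/

namespace Conf

theorem val_congr (c : Conf) {ρ σ : Reg} (h : ρ = σ) : (c ρ : ℕ) = c σ := by
  subst h; rfl

variable {A : Finset Reg} {ρ : Reg}

theorem overwrite_of_mem (c : Conf) (a : (ρ : A) → Val ρ.1) (h : ρ ∈ A) :
    c.overwrite A a ρ = a ⟨ρ, h⟩ := dif_pos h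

theorem overwrite_of_notMem (c : Conf) (a : (ρ : A) → Val ρ.1) (h : ρ ∉ A) :
    c.overwrite A a ρ = c ρ := dif_neg h

theorem on_overwrite (c : Conf) (a : (ρ : A) → Val ρ.1) : (c.overwrite A a).on A = a :=
  funext fun ρ => c.overwrite_of_mem a ρ.2

theorem on_surjective (A : Finset Reg) : Function.Surjective fun c : Conf => c.on A :=
  fun a => ⟨_, on_overwrite (fun _ => 0) a⟩

end Conf

namespace Setting

variable (A : Setting)

theorem init_of_notMem (v : (ρ : A.outcomes) → Val ρ.1) {ρ : Reg} (h : ρ ∉ A.outcomes) :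
    A.init v ρ = 0 := Conf.overwrite_of_notMem _ v h

theorem on_init (v : (ρ : A.outcomes) → Val ρ.1) : (A.init v).on A.outcomes = v :=
  Conf.on_overwrite _ v

theorem init_on {x : Conf} (hx : ∀ ρ ∉ A.outcomes, x ρ = 0) : A.init (x.on A.outcomes) = x := by
  funext ρ
  by_cases h : ρ ∈ A.outcomes
  · exact Conf.overwrite_of_mem _ _ h
  · rw [init_of_notMem A _ h, hx ρ h]

end Setting

/-! ### Renaming registers -/

/-- An involutive change of the names of the registers. Only the name changes, so that the values
of a register and of its image are the same by definition. -/
structure Renaming where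
  name : Reg → ℕ
  involutive : ∀ ρ : Reg,
    (⟨name ⟨name ρ, ρ.classical, ρ.top, ρ.kind⟩, ρ.classical, ρ.top, ρ.kind⟩ : Reg) = ρ

namespace Renaming

variable (π : Renaming)

/-- The register with the new name. -/
def reg (ρ : Reg) : Reg := ⟨π.name ρ, ρ.classical, ρ.top, ρ.kind⟩

theorem reg_involutive : Function.Involutive π.reg := π.involutive

@[simp] theorem reg_reg (ρ : Reg) : π.reg (π.reg ρ) = ρ := π.involutive ρ

@[simp] theorem reg_classical (ρ : Reg) : (π.reg ρ).classical = ρ.classical := rfl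

/-- The image of a set of registers. -/
def regs (A : Finset Reg) : Finset Reg := A.image π.reg

@[simp] theorem mem_regs {A : Finset Reg} {ρ : Reg} : ρ ∈ π.regs A ↔ π.reg ρ ∈ A :=
  mem_image_iff_of_involutive π.reg_involutive

@[simp] theorem regs_regs (A : Finset Reg) : π.regs (π.regs A) = A := by
  ext ρ; simp

theorem regs_eq_self {A : Finset Reg} (h : ∀ ρ ∈ A, π.reg ρ = ρ) : π.regs A = A :=
  image_eq_self_of_fixed h

/-- The configuration in which a register has the value of its image in `c`. -/
def conf (c : Conf) : Conf := fun ρ => c (π.reg ρ)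

theorem conf_apply_of_fixed (c : Conf) {ρ : Reg} (h : π.reg ρ = ρ) : π.conf c ρ = c ρ :=
  Fin.ext (c.val_congr h)

@[simp] theorem conf_conf (c : Conf) : π.conf (π.conf c) = c :=
  funext fun ρ => Fin.ext (c.val_congr (π.reg_reg ρ))

theorem conf_injective : Function.Injective π.conf :=
  Function.Involutive.injective π.conf_conf

theorem conf_on_of_fixed {A : Finset Reg} (h : ∀ ρ ∈ A, π.reg ρ = ρ) (c : Conf) :
    (π.conf c).on A = c.on A :=
  funext fun ρ => π.conf_apply_of_fixed c (h ρ.1 ρ.2)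

/-- The joint values of a set of registers, read off from those of the renamed registers. -/
def valEquiv (A : Finset Reg) : ((ρ : π.regs A) → Val ρ.1) ≃ ((ρ : A) → Val ρ.1) where
  toFun a := fun ρ => a ⟨π.reg ρ.1, by simp [ρ.2]⟩
  invFun b := fun ρ => b ⟨π.reg ρ.1, π.mem_regs.1 ρ.2⟩
  left_inv a := by
    obtain ⟨c, rfl⟩ := Conf.on_surjective _ a
    exact congrArg (Conf.on · (π.regs A)) (π.conf_conf c)
  right_inv b := by
    obtain ⟨c, rfl⟩ := Conf.on_surjective _ b
    exact congrArg (Conf.on · A) (π.conf_conf c)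

theorem conf_overwrite (A : Finset Reg) (c : Conf) (a : (ρ : π.regs A) → Val ρ.1) :
    π.conf (c.overwrite (π.regs A) a) = (π.conf c).overwrite A (π.valEquiv A a) := by
  funext ρ
  by_cases h : ρ ∈ A
  · rw [Conf.overwrite_of_mem _ _ h]
    exact Conf.overwrite_of_mem c a (by simpa using h)
  · rw [Conf.overwrite_of_notMem _ _ h]
    exact Conf.overwrite_of_notMem c a (by simpa using h)

end Renaming

/-! ### Renaming the registers of a gate -/

theorem perm_apply_val_congr {A : Finset Reg} (σ : Equiv.Perm ((ρ : A) → Val ρ.1))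
    (a : (ρ : A) → Val ρ.1) {ρ τ : A} (h : ρ.1 = τ.1) : (σ a ρ : ℕ) = σ a τ := by
  rw [Subtype.ext h]

theorem Op.unitary_ext {A B : Finset Reg} (h : A = B)
    (U : Matrix.unitaryGroup ((ρ : A) → Val ρ.1) ℂ) (V : Matrix.unitaryGroup ((ρ : B) → Val ρ.1) ℂ)
    (hUV : ∀ c d : Conf, U.1 (c.on A) (d.on A) = V.1 (c.on B) (d.on B)) :
    Op.unitary A U = Op.unitary B V := by
  subst h
  congr 1
  ext a b
  obtain ⟨c, rfl⟩ := Conf.on_surjective _ a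
  obtain ⟨d, rfl⟩ := Conf.on_surjective _ b
  exact hUV c d

theorem Op.perm_ext {A B : Finset Reg} (h : A = B)
    (σ : Equiv.Perm ((ρ : A) → Val ρ.1)) (τ : Equiv.Perm ((ρ : B) → Val ρ.1))
    (hστ : ∀ (c : Conf) (ρ : Reg) (h₁ : ρ ∈ A) (h₂ : ρ ∈ B),
      (σ (c.on A) ⟨ρ, h₁⟩ : ℕ) = τ (c.on B) ⟨ρ, h₂⟩) :
    Op.perm A σ = Op.perm B τ := by
  subst h
  congr 1
  ext a ρ
  obtain ⟨c, rfl⟩ := Conf.on_surjective _ a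
  exact hστ c ρ.1 ρ.2 ρ.2

namespace Renaming

variable (π : Renaming)

/-- The same operation, on renamed registers. -/
def op : Op → Op
  | .unitary A U => .unitary (π.regs A)
      ⟨U.1.submatrix (π.valEquiv A) (π.valEquiv A), by
        have h := U.2
        rw [Matrix.mem_unitaryGroup_iff, Matrix.star_eq_conjTranspose] at h ⊢
        rw [Matrix.conjTranspose_submatrix, Matrix.submatrix_mul_equiv, h,
          Matrix.submatrix_one_equiv]⟩
  | .perm A σ => .perm (π.regs A) (((π.valEquiv A).trans σ).trans (π.valEquiv A).symm)
  | .measure q c => .measure (π.reg q) (π.reg c)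

@[simp] theorem op_tgt (o : Op) : (π.op o).tgt = π.regs o.tgt := by
  cases o <;> simp [op, Op.tgt, regs]

@[simp] theorem op_outcome (o : Op) : (π.op o).outcome = π.regs o.outcome := by
  cases o <;> simp [op, Op.outcome, regs]

theorem op_wellTyped {o : Op} (h : o.WellTyped) : (π.op o).WellTyped := by
  cases o with
  | unitary A U => exact fun ρ hρ => h (π.reg ρ) (π.mem_regs.1 hρ)
  | perm A σ => exact fun ρ hρ => h (π.reg ρ) (π.mem_regs.1 hρ)
  | measure q c => exact h

@[simp] theorem op_op (o : Op) : π.op (π.op o) = o := by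
  cases o with
  | unitary A U =>
    refine Op.unitary_ext (π.regs_regs A) _ _ fun c d => ?_
    change U.1 ((π.conf (π.conf c)).on A) ((π.conf (π.conf d)).on A) = _
    rw [conf_conf, conf_conf]
  | perm A σ =>
    refine Op.perm_ext (π.regs_regs A) _ _ fun c ρ h₁ h₂ => ?_
    change (σ ((π.conf (π.conf c)).on A) ⟨π.reg (π.reg ρ), _⟩ : ℕ) = _
    rw [conf_conf]
    exact perm_apply_val_congr σ _ (π.reg_reg ρ)
  | measure q c => simp [op]

theorem op_eq_self {o : Op} (h : ∀ ρ ∈ o.tgt, π.reg ρ = ρ) : π.op o = o := by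
  cases o with
  | unitary A U =>
    change ∀ ρ ∈ A, π.reg ρ = ρ at h
    refine Op.unitary_ext (π.regs_eq_self h) _ _ fun c d => ?_
    change U.1 ((π.conf c).on A) ((π.conf d).on A) = _
    rw [conf_on_of_fixed π h, conf_on_of_fixed π h]
  | perm A σ =>
    change ∀ ρ ∈ A, π.reg ρ = ρ at h
    refine Op.perm_ext (π.regs_eq_self h) _ _ fun c ρ h₁ h₂ => ?_
    change (σ ((π.conf c).on A) ⟨π.reg ρ, _⟩ : ℕ) = _
    rw [conf_on_of_fixed π h]
    exact perm_apply_val_congr σ _ (h ρ h₂)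
  | measure q c =>
    simp only [Op.tgt, Finset.mem_insert, Finset.mem_singleton, forall_eq_or_imp, forall_eq] at h
    rw [op, h.1, h.2]

theorem ctrl_map_involutive :
    Function.Involutive fun p : Reg × ℕ => (π.reg p.1, p.2) := fun p => by simp

/-- The same controls, on renamed registers. -/
def ctrl (C : Finset (Reg × ℕ)) : Finset (Reg × ℕ) := C.image fun p => (π.reg p.1, p.2)

@[simp] theorem mem_ctrl {C : Finset (Reg × ℕ)} {p : Reg × ℕ} :
    p ∈ π.ctrl C ↔ (π.reg p.1, p.2) ∈ C :=
  mem_image_iff_of_involutive π.ctrl_map_involutive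

@[simp] theorem ctrl_ctrl (C : Finset (Reg × ℕ)) : π.ctrl (π.ctrl C) = C := by
  ext p; simp

theorem ctrl_eq_self {C : Finset (Reg × ℕ)} (h : ∀ p ∈ C, π.reg p.1 = p.1) : π.ctrl C = C :=
  image_eq_self_of_fixed fun p hp => Prod.ext (h p hp) rfl

/-- The same gate, on renamed registers. -/
def gate (g : Gate) : Gate where
  id := g.id
  ctrl := π.ctrl g.ctrl
  op := π.op g.op
  wake := g.wake.map π.reg
  ctrl_classical p hp := g.ctrl_classical (π.reg p.1, p.2) (π.mem_ctrl.1 hp)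
  op_wellTyped := π.op_wellTyped g.op_wellTyped
  ctrl_tgt p hp := by simpa using g.ctrl_tgt _ (π.mem_ctrl.1 hp)
  wake_ctrl a ha := by
    obtain ⟨b, hb, rfl⟩ := Option.map_eq_some_iff.1 ha
    simpa using g.wake_ctrl _ hb

theorem gate_gate (g : Gate) : π.gate (π.gate g) = g := by
  apply Gate.ext <;> simp [gate, Function.comp_def]

theorem gate_eq_self {g : Gate} (h : ∀ ρ ∈ g.regs, π.reg ρ = ρ) : π.gate g = g := by
  have hctrl : ∀ p ∈ g.ctrl, π.reg p.1 = p.1 := fun p hp =>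
    h _ (Finset.mem_union_left _ (Gate.mem_ctrlRegs.2 ⟨p.2, hp⟩))
  apply Gate.ext
  · rfl
  · exact π.ctrl_eq_self hctrl
  · exact π.op_eq_self fun ρ hρ => h ρ (Finset.mem_union_right _ hρ)
  · change g.wake.map π.reg = g.wake
    rcases hw : g.wake with _ | a
    · rfl
    · rw [Option.map_some, hctrl _ (g.wake_ctrl a hw)]

/-- The renaming that changes no name. -/
def refl : Renaming := ⟨Reg.name, fun _ => rfl⟩

end Renaming

/-! ### Symmetries -/

/-- An involution of the gates that is compatible with a renaming of the registers. The numbers `id`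
of the gates may change, so that a symmetry can be used to rename gates as well. -/
structure Symmetry extends Renaming where
  gateMap : Gate → Gate
  gateMap_involutive : Function.Involutive gateMap
  ctrl_gateMap : ∀ g, (gateMap g).ctrl = toRenaming.ctrl g.ctrl
  op_gateMap : ∀ g, (gateMap g).op = toRenaming.op g.op
  wake_gateMap : ∀ g, (gateMap g).wake = g.wake.map toRenaming.reg

namespace Symmetry

variable (σ : Symmetry)

@[simp] theorem gateMap_gateMap (g : Gate) : σ.gateMap (σ.gateMap g) = g :=
  σ.gateMap_involutive g

theorem gateMap_injective : Function.Injective σ.gateMap := σ.gateMap_involutive.injective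

/-- The image of a set of gates. -/
def gates (G : Finset Gate) : Finset Gate := G.image σ.gateMap

@[simp] theorem mem_gates {G : Finset Gate} {g : Gate} : g ∈ σ.gates G ↔ σ.gateMap g ∈ G :=
  mem_image_iff_of_involutive σ.gateMap_involutive

@[simp] theorem gates_gates (G : Finset Gate) : σ.gates (σ.gates G) = G := by
  ext g; simp

theorem gates_eq_self {G : Finset Gate} (h : ∀ g ∈ G, σ.gateMap g = g) : σ.gates G = G :=
  image_eq_self_of_fixed h

@[simp] theorem tgt_gateMap (g : Gate) : (σ.gateMap g).tgt = σ.regs g.tgt := by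
  simp [Gate.tgt, op_gateMap]

@[simp] theorem outcome_gateMap (g : Gate) : (σ.gateMap g).op.outcome = σ.regs g.op.outcome := by
  simp [op_gateMap]

@[simp] theorem mem_ctrl_gateMap {g : Gate} {p : Reg × ℕ} :
    p ∈ (σ.gateMap g).ctrl ↔ (σ.reg p.1, p.2) ∈ g.ctrl := by
  simp [ctrl_gateMap]

@[simp] theorem ctrlRegs_gateMap (g : Gate) : (σ.gateMap g).ctrlRegs = σ.regs g.ctrlRegs := by
  ext ρ; simp [Gate.mem_ctrlRegs]

@[simp] theorem regs_gateMap (g : Gate) : (σ.gateMap g).regs = σ.regs g.regs := by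
  ext ρ; simp [Gate.regs]

theorem size_gateMap (g : Gate) : (σ.gateMap g).size = g.size := by
  rw [Gate.size, regs_gateMap, Renaming.regs,
    Finset.prod_image σ.reg_involutive.injective.injOn]
  rfl

theorem gatesSize_gates (G : Finset Gate) : gatesSize (σ.gates G) = gatesSize G := by
  rw [gatesSize, gates, Finset.sum_image σ.gateMap_injective.injOn]
  exact Finset.sum_congr rfl fun g _ => σ.size_gateMap g

theorem shareReg_gateMap {g h : Gate} :
    ShareReg (σ.gateMap g) (σ.gateMap h) ↔ ShareReg g h := by
  simp only [ShareReg, regs_gateMap, Renaming.mem_regs]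
  exact (σ.reg_involutive.surjective.exists (p := fun ρ => ρ ∈ g.regs ∧ ρ ∈ h.regs)).symm

theorem shareLink_gateMap {g h : Gate} :
    ShareLink (σ.gateMap g) (σ.gateMap h) ↔ ShareLink g h := by
  simp only [ShareLink, regs_gateMap, Renaming.mem_regs]
  exact (σ.reg_involutive.surjective.exists
    (p := fun ρ => ρ.IsLink ∧ ρ ∈ g.regs ∧ ρ ∈ h.regs)).symm

theorem compatible_gateMap_of_compatible {g h : Gate} (H : g.Compatible h) :
    (σ.gateMap g).Compatible (σ.gateMap h) := fun _ hp q hq hpq =>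
  H _ (σ.mem_ctrl_gateMap.1 hp) (σ.reg q.1, q.2) (σ.mem_ctrl_gateMap.1 hq) (congrArg σ.reg hpq)

theorem compatible_gateMap {g h : Gate} :
    (σ.gateMap g).Compatible (σ.gateMap h) ↔ g.Compatible h :=
  ⟨fun H => by simpa using σ.compatible_gateMap_of_compatible H,
    σ.compatible_gateMap_of_compatible⟩

/-! ### The action on state vectors -/

theorem active_conf_of_active {g : Gate} {c : Conf} (H : g.Active c) :
    (σ.gateMap g).Active (σ.conf c) :=
  fun _ hp => H _ (σ.mem_ctrl_gateMap.1 hp)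

theorem active_gateMap {g : Gate} {c : Conf} :
    (σ.gateMap g).Active c ↔ g.Active (σ.conf c) :=
  ⟨fun H => by simpa using σ.active_conf_of_active H,
    fun H => by simpa using σ.active_conf_of_active H⟩

theorem onBasis_gateMap (g : Gate) (c : Conf) :
    (σ.gateMap g).onBasis c = Finsupp.mapDomain σ.conf (g.onBasis (σ.conf c)) := by
  unfold Gate.onBasis
  rw [σ.op_gateMap g]
  by_cases ha : g.Active (σ.conf c)
  · rw [if_pos ha, if_pos (σ.active_gateMap.2 ha)]
    rcases g.op with ⟨A, U⟩ | ⟨A, p⟩ | ⟨q, o⟩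
    · simp only [Renaming.op]
      rw [Finsupp.mapDomain_finsetSum]
      refine Fintype.sum_equiv (σ.valEquiv A) _ _ fun a => ?_
      rw [Finsupp.mapDomain_single, ← Renaming.conf_overwrite, Renaming.conf_conf]
      rfl
    · simp only [Renaming.op]
      rw [Finsupp.mapDomain_single]
      congr 1
      apply σ.conf_injective
      rw [Renaming.conf_conf, Renaming.conf_overwrite]
      simp only [Equiv.trans_apply, Equiv.apply_symm_apply]
      rfl
    · change (if (c (σ.reg q) : ℕ) = c (σ.reg o) then _ else _) =
        Finsupp.mapDomain σ.conf (if (c (σ.reg q) : ℕ) = c (σ.reg o) then _ else _)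
      split_ifs <;> simp
  · rw [if_neg ha, if_neg (mt σ.active_gateMap.1 ha)]
    rcases g.op with ⟨A, U⟩ | ⟨A, p⟩ | ⟨q, o⟩
    · simp [Renaming.op]
    · simp [Renaming.op]
    · change (if (c (σ.reg o) : ℕ) = 0 then _ else _) =
        Finsupp.mapDomain σ.conf (if (c (σ.reg o) : ℕ) = 0 then _ else _)
      split_ifs <;> simp

theorem apply_gateMap (ψ : Conf →₀ ℂ) (g : Gate) :
    Gate.apply (Finsupp.mapDomain σ.conf ψ) (σ.gateMap g) =
      Finsupp.mapDomain σ.conf (Gate.apply ψ g) := by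
  rw [Gate.apply, Gate.apply, Finsupp.sum_mapDomain_index_inj σ.conf_injective, Finsupp.sum,
    Finsupp.sum, Finsupp.mapDomain_finsetSum]
  refine Finset.sum_congr rfl fun c _ => ?_
  rw [onBasis_gateMap, Renaming.conf_conf, Finsupp.mapDomain_smul]

theorem foldl_apply_map (l : List Gate) (ψ : Conf →₀ ℂ) :
    (l.map σ.gateMap).foldl Gate.apply (Finsupp.mapDomain σ.conf ψ) =
      Finsupp.mapDomain σ.conf (l.foldl Gate.apply ψ) := by
  induction l generalizing ψ with
  | nil => rfl
  | cons g l ih => rw [List.map_cons, List.foldl_cons, List.foldl_cons, apply_gateMap, ih]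

theorem final_map (x : Conf) (l : List Gate) :
    Setting.final (σ.conf x) (l.map σ.gateMap) =
      Finsupp.mapDomain σ.conf (Setting.final x l) := by
  rw [Setting.final, Setting.final, ← foldl_apply_map, Finsupp.mapDomain_single]

/-! ### The action on settings -/

/-- The action on a value-dependent relation. -/
def rel (r : Conf → Gate → Gate → Prop) : Conf → Gate → Gate → Prop :=
  fun x g h => r (σ.conf x) (σ.gateMap g) (σ.gateMap h)

theorem rel_rel (r : Conf → Gate → Gate → Prop) : σ.rel (σ.rel r) = r := by
  funext x g h
  simp [rel]

/-- The action on settings. -/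
def setting (A : Setting) : Setting := ⟨σ.gates A.gates, σ.rel A.rel, σ.reg A.out⟩

variable {A B : Setting}

@[simp] theorem mem_gates_setting {g : Gate} :
    g ∈ (σ.setting A).gates ↔ σ.gateMap g ∈ A.gates := σ.mem_gates

@[simp] theorem rel_setting {x : Conf} {g h : Gate} :
    (σ.setting A).rel x g h ↔ A.rel (σ.conf x) (σ.gateMap g) (σ.gateMap h) := Iff.rfl

@[simp] theorem setting_setting (A : Setting) : σ.setting (σ.setting A) = A :=
  Setting.ext (σ.gates_gates _) (σ.rel_rel _) (σ.reg_reg _)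

@[simp] theorem mem_outcomes_setting {ρ : Reg} :
    ρ ∈ (σ.setting A).outcomes ↔ σ.reg ρ ∈ A.outcomes := by
  simp only [Setting.outcomes, Finset.mem_biUnion, mem_gates_setting]
  rw [σ.gateMap_involutive.surjective.exists]
  simp

theorem conf_init_of_notMem (v : (ρ : (σ.setting A).outcomes) → Val ρ.1) {ρ : Reg}
    (hρ : ρ ∉ A.outcomes) : σ.conf ((σ.setting A).init v) ρ = 0 :=
  (σ.setting A).init_of_notMem v (by simpa using hρ)

/-- The initial values given by the image of a setting are those given by the setting itself, on
renamed registers. -/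
def initEquiv (A : Setting) :
    ((ρ : (σ.setting A).outcomes) → Val ρ.1) ≃ ((ρ : A.outcomes) → Val ρ.1) where
  toFun v := (σ.conf ((σ.setting A).init v)).on A.outcomes
  invFun w := (σ.conf (A.init w)).on (σ.setting A).outcomes
  left_inv v := by
    dsimp only
    rw [A.init_on fun ρ hρ => σ.conf_init_of_notMem v hρ, Renaming.conf_conf, Setting.on_init]
  right_inv w := by
    dsimp only
    rw [(σ.setting A).init_on (x := σ.conf (A.init w)) fun ρ hρ =>
      A.init_of_notMem w (by simpa using hρ), Renaming.conf_conf, Setting.on_init]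

theorem init_initEquiv (v : (ρ : (σ.setting A).outcomes) → Val ρ.1) :
    A.init (σ.initEquiv A v) = σ.conf ((σ.setting A).init v) :=
  A.init_on fun _ hρ => σ.conf_init_of_notMem v hρ

theorem lt_map_of_lt {x : Conf} {g h : Gate} (H : (σ.setting A).lt x g h) :
    A.lt (σ.conf x) (σ.gateMap g) (σ.gateMap h) :=
  Relation.TransGen.lift (p := A.rel (σ.conf x)) σ.gateMap (fun _ _ hab => hab) g h H

theorem lt_setting {x : Conf} {g h : Gate} :
    (σ.setting A).lt x g h ↔ A.lt (σ.conf x) (σ.gateMap g) (σ.gateMap h) :=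
  ⟨σ.lt_map_of_lt, fun H => by
    rw [← σ.setting_setting A] at H
    simpa only [Renaming.conf_conf, gateMap_gateMap] using σ.lt_map_of_lt H⟩

theorem isCircuit_setting (hA : A.IsCircuit) : (σ.setting A).IsCircuit where
  acyclic v g H := by
    rw [lt_setting, ← init_initEquiv] at H
    exact hA.acyclic _ _ H
  ordered v g hg h hh hne ρ hρ hc := by
    simp only [rel_setting, ← init_initEquiv]
    refine hA.ordered _ _ (σ.mem_gates.1 hg) _ (σ.mem_gates.1 hh) (σ.gateMap_injective.ne hne)
      (σ.reg ρ) (by simpa using hρ) ?_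
    simpa [compatible_gateMap] using hc
  awake v g hg h hh a ha hat := by
    simp only [rel_setting, ← init_initEquiv]
    exact hA.awake _ _ (σ.mem_gates.1 hg) _ (σ.mem_gates.1 hh) (σ.reg a)
      (by rw [wake_gateMap, ha, Option.map_some]) (by simpa using hat)
  fresh v m hm h hh hne ρ hρ hρh := by
    simp only [rel_setting, ← init_initEquiv]
    exact hA.fresh _ _ (σ.mem_gates.1 hm) _ (σ.mem_gates.1 hh) (σ.gateMap_injective.ne hne)
      (σ.reg ρ) (by simpa using hρ) (by simpa using hρh)
  causal v w g hg H h := by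
    simp only [rel_setting, ← init_initEquiv] at H ⊢
    refine hA.causal _ _ _ (σ.mem_gates.1 hg) (fun m hm hmg ρ hρ => ?_) _
    rw [init_initEquiv, init_initEquiv]
    exact H (σ.gateMap m) (by simpa using hm) (by simpa using hmg) (σ.reg ρ) (by simpa using hρ)

/-- The action on schedules. -/
def schedule (s : A.Schedule) : (σ.setting A).Schedule where
  seq x := (s.seq (σ.conf x)).map σ.gateMap
  isSequence v := by
    obtain ⟨hnodup, hmem, hlt⟩ := s.isSequence (σ.initEquiv A v)
    rw [← init_initEquiv]
    refine ⟨hnodup.map σ.gateMap_injective, fun g => ?_, ?_⟩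
    · rw [mem_gates_setting, ← hmem, List.mem_map]
      exact ⟨fun ⟨h, hh, hg⟩ => by rwa [← hg, gateMap_gateMap],
        fun h => ⟨_, h, gateMap_gateMap σ g⟩⟩
    · rw [List.pairwise_map]
      refine hlt.imp fun hab => ?_
      rwa [lt_setting, ← init_initEquiv, gateMap_gateMap, gateMap_gateMap]

theorem zeroProb_schedule (s : A.Schedule) :
    (σ.setting A).zeroProb (σ.schedule s) = A.zeroProb s := by
  refine Fintype.sum_equiv (σ.initEquiv A) _ _ fun v => ?_
  rw [init_initEquiv]
  set x := (σ.setting A).init v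
  have hfinal : Setting.final x ((σ.schedule s).seq x) =
      Finsupp.mapDomain σ.conf (Setting.final (σ.conf x) (s.seq (σ.conf x))) := by
    rw [← final_map, Renaming.conf_conf]
    rfl
  have hout : ∀ c, (σ.conf c (σ.setting A).out : ℕ) = c A.out :=
    fun c => c.val_congr (σ.reg_reg A.out)
  rw [hfinal, Finsupp.sum_mapDomain_index_inj σ.conf_injective]
  simp only [hout]

theorem close_of_setting {ε : ℝ} (h : Close (σ.setting A) (σ.setting B) ε) : Close A B ε := by
  intro s t
  rw [← zeroProb_schedule σ s, ← zeroProb_schedule σ t]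
  exact h _ _

end Symmetry

/-! ### Access to the registers of a protocol -/

namespace Role

variable {r : Role} {ρ : Reg}

theorem mem_regs : ρ ∈ r.regs ↔ ρ ∈ r.priv ∨ ρ ∈ r.links ∨ r.cor = some ρ := by
  simp [regs]

theorem WellFormed.mem_regs_of_gate (hr : r.WellFormed) {g : Gate} (hg : g ∈ r.gates)
    (h : ρ ∈ g.regs) : ρ ∈ r.regs := by
  rcases Finset.mem_union.1 h with h | h
  · exact mem_regs.2 (hr.read g hg ρ h)
  · exact mem_regs.2 ((hr.write g hg ρ h).imp_right fun h => .inl h.1)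

/-- Acting in the name of the circuit `r` gives access of a degree that satisfies `acc`. -/
def Grants (r : Role) (acc : Access → Prop) (ρ : Reg) : Prop :=
  ρ ∈ r.priv ∨ (ρ ∈ r.links ∧ acc (ρ.accessAs r.id))

theorem Grants.mem_regs {acc : Access → Prop} (h : r.Grants acc ρ) : ρ ∈ r.regs :=
  Role.mem_regs.2 (h.imp_right fun h => .inl h.1)

end Role

namespace Protocol

variable {P : Protocol} {r : Role} {ρ : Reg} {g : Gate} {acc : Access → Prop}

theorem mem_links : ρ ∈ P.links ↔ ∃ r ∈ P.roles, ρ ∈ r.links := Finset.mem_biUnion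

theorem mem_cors : ρ ∈ P.cors ↔ ∃ r ∈ P.roles, r.cor = some ρ := by
  simp [cors]

theorem mem_gates : g ∈ P.gates ↔ ∃ r ∈ P.roles, g ∈ r.gates := Finset.mem_biUnion

theorem mem_regs : ρ ∈ P.regs ↔ (∃ r ∈ P.roles, ρ ∈ r.regs) ∨ ρ ∈ P.io := by
  simp [regs]

theorem mem_regs_of_role (hr : r ∈ P.roles) (h : ρ ∈ r.regs) : ρ ∈ P.regs :=
  mem_regs.2 (.inl ⟨r, hr, h⟩)

theorem mem_regs_of_io (h : ρ ∈ P.io) : ρ ∈ P.regs := mem_regs.2 (.inr h)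

theorem mem_regs_of_links (h : ρ ∈ P.links) : ρ ∈ P.regs := by
  obtain ⟨r, hr, h⟩ := mem_links.1 h
  exact mem_regs_of_role hr (Role.mem_regs.2 (.inr (.inl h)))

theorem mem_regs_of_cors (h : ρ ∈ P.cors) : ρ ∈ P.regs := by
  obtain ⟨r, hr, h⟩ := mem_cors.1 h
  exact mem_regs_of_role hr (Role.mem_regs.2 (.inr (.inr h)))

theorem mem_regs_of_gate (hP : ∀ r ∈ P.roles, r.WellFormed) (hg : g ∈ P.gates)
    (h : ρ ∈ g.regs) : ρ ∈ P.regs := by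
  obtain ⟨r, hr, hg⟩ := mem_gates.1 hg
  exact mem_regs_of_role hr ((hP r hr).mem_regs_of_gate hg h)

/-- A gate `g` of an environment has access to the register `ρ` of `P`, of a degree that satisfies
`acc`. -/
def Exposes (P : Protocol) (acc : Access → Prop) (g : Gate) (ρ : Reg) : Prop :=
  ρ ∈ P.io ∨ ρ ∈ P.cors ∨ (ρ ∈ P.links ∧ acc ρ.outsider) ∨ ∃ r, P.ActsFor g r ∧ r.Grants acc ρ

/-- A gate `g` of a simulator has access to the register `ρ` of the ideal protocol `I`, of a degree
that satisfies `acc`, because it acts for a corrupted circuit of `I`. -/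
def ExposesAsCorrupted (I : Protocol) (acc : Access → Prop) (g : Gate) (ρ : Reg) : Prop :=
  ∃ r, I.ActsFor g r ∧ (r.Grants acc ρ ∨ (ρ ∈ I.links ∧ ρ ∉ I.io ∧ acc ρ.outsider))

theorem Exposes.mem_regs (h : P.Exposes acc g ρ) : ρ ∈ P.regs := by
  rcases h with h | h | h | ⟨r, hr, h⟩
  · exact mem_regs_of_io h
  · exact mem_regs_of_cors h
  · exact mem_regs_of_links h.1
  · exact mem_regs_of_role hr.1 h.mem_regs

theorem ExposesAsCorrupted.mem_regs (h : P.ExposesAsCorrupted acc g ρ) : ρ ∈ P.regs := by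
  obtain ⟨r, hr, h | h⟩ := h
  · exact mem_regs_of_role hr.1 h.mem_regs
  · exact mem_regs_of_links h.1

/-- The gates `g` and `h` belong to distinct circuits of `P` that share a channel register, and both
access this register. -/
def CrossPair (P : Protocol) (g h : Gate) : Prop :=
  g ∈ P.gates ∧ h ∈ P.gates ∧ ShareLink g h ∧ ∀ r ∈ P.roles, ¬ (g ∈ r.gates ∧ h ∈ r.gates)

theorem crossPair_of_shareReg {h : Gate} (hP : ∀ r ∈ P.roles, r.WellFormed)
    (hlink : ∀ r ∈ P.roles, ∀ s ∈ P.roles, r ≠ s → ∀ ρ, ρ ∈ r.regs → ρ ∈ s.regs → ρ.IsLink)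
    (hg : g ∈ P.gates) (hh : h ∈ P.gates) (hshare : ShareReg g h)
    (hroles : ∀ r ∈ P.roles, ¬ (g ∈ r.gates ∧ h ∈ r.gates)) : P.CrossPair g h := by
  refine ⟨hg, hh, ?_, hroles⟩
  obtain ⟨ρ, hρg, hρh⟩ := hshare
  obtain ⟨r, hr, hg⟩ := mem_gates.1 hg
  obtain ⟨s, hs, hh⟩ := mem_gates.1 hh
  exact ⟨ρ, hlink r hr s hs (fun e => hroles r hr ⟨hg, e ▸ hh⟩) ρ
    ((hP r hr).mem_regs_of_gate hg hρg) ((hP s hs).mem_regs_of_gate hh hρh), hρg, hρh⟩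

end Protocol

theorem Environment.mayWrite_iff {E : Environment} {P : Protocol} {g : Gate} {ρ : Reg} :
    E.MayWrite P g ρ ↔ ρ ∈ E.regs ∨ P.Exposes (· = .full) g ρ := Iff.rfl

theorem Environment.mayRead_iff {E : Environment} {P : Protocol} {g : Gate} {ρ : Reg} :
    E.MayRead P g ρ ↔ ρ ∈ E.regs ∨ P.Exposes (· ≠ .none) g ρ := Iff.rfl

theorem OpenCircuit.simMayWrite_iff {S : OpenCircuit} {P I : Protocol} {g : Gate} {ρ : Reg} :
    S.SimMayWrite P I g ρ ↔ ρ ∈ S.simRegs P I ∨ I.ExposesAsCorrupted (· = .full) g ρ := by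
  simp only [SimMayWrite, Protocol.ExposesAsCorrupted, Role.Grants, or_assoc]

theorem OpenCircuit.simMayRead_iff {S : OpenCircuit} {P I : Protocol} {g : Gate} {ρ : Reg} :
    S.SimMayRead P I g ρ ↔
      ρ ∈ S.simRegs P I ∨ ρ ∈ I.cors ∨ I.ExposesAsCorrupted (· ≠ .none) g ρ := by
  simp only [SimMayRead, Protocol.ExposesAsCorrupted, Role.Grants, or_assoc]

/-! ### Symmetries that fix a protocol -/

namespace Symmetry

variable (σ : Symmetry)

/-- The action on open circuits. -/
def openCircuit (S : OpenCircuit) : OpenCircuit :=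
  ⟨σ.regs S.regs, σ.gates S.gates, σ.rel S.ord, fun g h => S.cross (σ.gateMap g) (σ.gateMap h)⟩

/-- The action on environments. -/
def environment (E : Environment) : Environment :=
  ⟨σ.openCircuit E.toOpenCircuit, σ.reg E.out⟩

theorem openCircuit_openCircuit (S : OpenCircuit) : σ.openCircuit (σ.openCircuit S) = S := by
  cases S
  simp [openCircuit, rel_rel]

theorem environment_environment (E : Environment) : σ.environment (σ.environment E) = E := by
  cases E
  simp [environment, openCircuit_openCircuit]

theorem size_openCircuit (S : OpenCircuit) : (σ.openCircuit S).size = S.size :=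
  σ.gatesSize_gates S.gates

theorem disjoint_regs {A B : Finset Reg} (h : Disjoint A B) :
    Disjoint (σ.regs A) (σ.regs B) :=
  (Finset.disjoint_image σ.reg_involutive.injective).2 h

theorem disjoint_gates {G H : Finset Gate} (h : Disjoint G H) :
    Disjoint (σ.gates G) (σ.gates H) :=
  (Finset.disjoint_image σ.gateMap_injective).2 h

theorem dependsOnlyOn_rel {r : Conf → Gate → Gate → Prop} {A B : Finset Reg}
    (h : DependsOnlyOn r A) (hAB : ∀ ρ ∈ A, σ.reg ρ ∈ B) : DependsOnlyOn (σ.rel r) B :=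
  fun _ _ hxy _ _ => h _ _ (fun ρ hρ => hxy (σ.reg ρ) (hAB ρ hρ)) _ _

/-- The symmetry leaves the registers and gates of the protocol as they are. -/
structure Fixes (P : Protocol) : Prop where
  regs : ∀ ρ ∈ P.regs, σ.reg ρ = ρ
  gates : ∀ g ∈ P.gates, σ.gateMap g = g

namespace Fixes

variable {σ} {P I : Protocol} {E : Environment} {S : OpenCircuit}

theorem reg_eq (hσ : σ.Fixes P) {ρ : Reg} (h : σ.reg ρ ∈ P.regs) : σ.reg ρ = ρ :=
  apply_eq_self_of_apply_mem σ.reg_involutive hσ.regs h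

theorem mem_gates (hσ : σ.Fixes P) {g : Gate} : σ.gateMap g ∈ P.gates ↔ g ∈ P.gates :=
  apply_mem_iff_of_fixed σ.gateMap_involutive hσ.gates

theorem gates_eq (hσ : σ.Fixes P) : σ.gates P.gates = P.gates := σ.gates_eq_self hσ.gates

theorem disjoint_regs (hσ : σ.Fixes P) {A : Finset Reg} (h : Disjoint A P.regs) :
    Disjoint (σ.regs A) P.regs := by
  simpa only [σ.regs_eq_self hσ.regs] using σ.disjoint_regs h

theorem disjoint_gates (hσ : σ.Fixes P) {G : Finset Gate} (h : Disjoint G P.gates) :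
    Disjoint (σ.gates G) P.gates := by
  simpa only [hσ.gates_eq] using σ.disjoint_gates h

theorem role_mem_gates (hσ : σ.Fixes P) {r : Role} (hr : r ∈ P.roles) {g : Gate} :
    σ.gateMap g ∈ r.gates ↔ g ∈ r.gates :=
  apply_mem_iff_of_fixed σ.gateMap_involutive fun g hg =>
    hσ.gates g (Protocol.mem_gates.2 ⟨r, hr, hg⟩)

theorem role_ord_map (hσ : σ.Fixes P) (hP : ∀ r ∈ P.roles, r.WellFormed) {r : Role}
    (hr : r ∈ P.roles) {x : Conf} {g h : Gate} (H : r.ord x g h) :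
    r.ord (σ.conf x) (σ.gateMap g) (σ.gateMap h) := by
  have hgh := (hP r hr).ord_gates _ _ _ H
  rw [hσ.gates g (Protocol.mem_gates.2 ⟨r, hr, hgh.1⟩),
    hσ.gates h (Protocol.mem_gates.2 ⟨r, hr, hgh.2⟩)]
  refine ((hP r hr).ord_local _ _ (fun ρ hρ => ?_) g h).2 H
  exact σ.conf_apply_of_fixed x
    (hσ.regs ρ (Protocol.mem_regs_of_role hr (Role.mem_regs.2 (.inl hρ))))

theorem exists_role_ord (hσ : σ.Fixes P) (hP : ∀ r ∈ P.roles, r.WellFormed) (x : Conf)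
    (g h : Gate) :
    (∃ r ∈ P.roles, r.ord (σ.conf x) (σ.gateMap g) (σ.gateMap h)) ↔
      ∃ r ∈ P.roles, r.ord x g h :=
  exists_congr fun _ => and_congr_right fun hr =>
    ⟨fun H => by simpa using hσ.role_ord_map hP hr H, hσ.role_ord_map hP hr⟩

theorem actsFor (hσ : σ.Fixes P) {g : Gate} {r : Role} (h : P.ActsFor (σ.gateMap g) r) :
    P.ActsFor g r := by
  obtain ⟨hr, C, hC, hg⟩ := h
  rw [mem_ctrl_gateMap,
    hσ.regs C (Protocol.mem_regs_of_role hr (Role.mem_regs.2 (.inr (.inr hC))))] at hg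
  exact ⟨hr, C, hC, hg⟩

variable {acc : Access → Prop} {g h : Gate} {ρ : Reg}

theorem exposes (hσ : σ.Fixes P) (h : P.Exposes acc (σ.gateMap g) (σ.reg ρ)) :
    P.Exposes acc g ρ := by
  rw [hσ.reg_eq h.mem_regs] at h
  exact h.imp_right (Or.imp_right (Or.imp_right fun ⟨r, hr, h⟩ => ⟨r, hσ.actsFor hr, h⟩))

theorem exposesAsCorrupted (hσ : σ.Fixes P)
    (h : P.ExposesAsCorrupted acc (σ.gateMap g) (σ.reg ρ)) : P.ExposesAsCorrupted acc g ρ := by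
  rw [hσ.reg_eq h.mem_regs] at h
  exact h.imp fun r => And.imp_left hσ.actsFor

theorem crossPair (hσ : σ.Fixes P) (H : P.CrossPair (σ.gateMap g) (σ.gateMap h)) :
    P.CrossPair g h :=
  ⟨hσ.mem_gates.1 H.1, hσ.mem_gates.1 H.2.1, σ.shareLink_gateMap.1 H.2.2.1, fun r hr hgh =>
    H.2.2.2 r hr (hgh.imp (hσ.role_mem_gates hr).2 (hσ.role_mem_gates hr).2)⟩

theorem setting_withProtocol (hσ : σ.Fixes P) (hP : ∀ r ∈ P.roles, r.WellFormed) :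
    σ.setting (E.withProtocol P) = (σ.environment E).withProtocol P := by
  apply Setting.ext
  · change σ.gates (E.gates ∪ P.gates) = σ.gates E.gates ∪ P.gates
    rw [Symmetry.gates, Finset.image_union, ← Symmetry.gates, ← Symmetry.gates, hσ.gates_eq]
  · funext x g h
    simp only [rel_setting, Environment.withProtocol, hσ.exists_role_ord hP]
    rfl
  · rfl

theorem setting_withIdeal (hσ : σ.Fixes I) (hI : ∀ r ∈ I.roles, r.WellFormed) :
    σ.setting (E.withIdeal I S) = (σ.environment E).withIdeal I (σ.openCircuit S) := by
  apply Setting.ext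
  · change σ.gates (E.gates ∪ I.gates ∪ S.gates) = σ.gates E.gates ∪ I.gates ∪ σ.gates S.gates
    simp only [Symmetry.gates, Finset.image_union]
    rw [← Symmetry.gates, ← Symmetry.gates, hσ.gates_eq]
  · funext x g h
    simp only [rel_setting, Environment.withIdeal, hσ.exists_role_ord hI]
    rfl
  · rfl

theorem avoids (hσ : σ.Fixes I) (h : E.Avoids I) : (σ.environment E).Avoids I :=
  ⟨hσ.disjoint_regs h.1, hσ.disjoint_gates h.2⟩

theorem valid (hσ : σ.Fixes P) (hP : ∀ r ∈ P.roles, r.WellFormed) (hE : E.Valid P) :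
    (σ.environment E).Valid P where
  regs_disjoint := hσ.disjoint_regs hE.regs_disjoint
  gates_disjoint := hσ.disjoint_gates hE.gates_disjoint
  out_mem := Finset.mem_image_of_mem _ hE.out_mem
  out_bit := hE.out_bit
  write g hg ρ hρ := Environment.mayWrite_iff.2 <|
    (hE.write _ (σ.mem_gates.1 hg) (σ.reg ρ) (by simpa using hρ)).imp σ.mem_regs.2 hσ.exposes
  read g hg ρ hρ := Environment.mayRead_iff.2 <|
    (hE.read _ (σ.mem_gates.1 hg) (σ.reg ρ) (by simpa using hρ)).imp σ.mem_regs.2 hσ.exposes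
  ord_gates _ _ _ H := (hE.ord_gates _ _ _ H).imp σ.mem_gates.2 σ.mem_gates.2
  ord_local := σ.dependsOnlyOn_rel hE.ord_local fun _ => Finset.mem_image_of_mem _
  cross_pairs g k H := by
    have hE' : ∀ {g}, σ.gateMap g ∈ E.gates ↔ g ∈ (σ.environment E).gates := σ.mem_gates.symm
    refine (hE.cross_pairs _ _ H).imp ?_ (Or.imp ?_ hσ.crossPair) <;>
      simp only [hσ.mem_gates, shareReg_gateMap, hE', imp_self]
  isCircuit := by
    rw [← hσ.setting_withProtocol hP]
    exact σ.isCircuit_setting hE.isCircuit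

theorem mem_simRegs (hP : ∀ ρ ∈ P.regs, σ.reg ρ = ρ) (h : σ.reg ρ ∈ S.simRegs P I) :
    ρ ∈ (σ.openCircuit S).simRegs P I := by
  rcases Finset.mem_union.1 h with h | h
  · exact Finset.mem_union_left _ (σ.mem_regs.2 h)
  · rw [apply_eq_self_of_apply_mem σ.reg_involutive hP (Finset.mem_sdiff.1 h).1] at h
    exact Finset.mem_union_right _ h

theorem validSimulator (hσ : σ.Fixes I) (hP : ∀ ρ ∈ P.regs, σ.reg ρ = ρ)
    (hI : ∀ r ∈ I.roles, r.WellFormed) (hS : S.ValidSimulator E P I) :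
    (σ.openCircuit S).ValidSimulator (σ.environment E) P I where
  regs_disjoint :=
    ⟨σ.disjoint_regs hS.regs_disjoint.1,
      σ.regs_eq_self hP ▸ σ.disjoint_regs hS.regs_disjoint.2.1,
      hσ.disjoint_regs hS.regs_disjoint.2.2⟩
  gates_disjoint := ⟨σ.disjoint_gates hS.gates_disjoint.1, hσ.disjoint_gates hS.gates_disjoint.2⟩
  write g hg ρ hρ := OpenCircuit.simMayWrite_iff.2 <|
    (OpenCircuit.simMayWrite_iff.1
      (hS.write _ (σ.mem_gates.1 hg) (σ.reg ρ) (by simpa using hρ))).imp (mem_simRegs hP)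
      hσ.exposesAsCorrupted
  read g hg ρ hρ := OpenCircuit.simMayRead_iff.2 <|
    (OpenCircuit.simMayRead_iff.1
      (hS.read _ (σ.mem_gates.1 hg) (σ.reg ρ) (by simpa using hρ))).imp (mem_simRegs hP)
      (Or.imp (fun h => by rwa [hσ.reg_eq (Protocol.mem_regs_of_cors h)] at h)
        hσ.exposesAsCorrupted)
  ord_gates _ _ _ H := (hS.ord_gates _ _ _ H).imp σ.mem_gates.2 σ.mem_gates.2
  ord_local := σ.dependsOnlyOn_rel hS.ord_local fun ρ hρ => mem_simRegs hP (by simpa using hρ)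
  cross_pairs g k H := by
    have hE : ∀ {g}, σ.gateMap g ∈ E.gates ↔ g ∈ (σ.environment E).gates := σ.mem_gates.symm
    have hS' : ∀ {g}, σ.gateMap g ∈ S.gates ↔ g ∈ (σ.openCircuit S).gates := σ.mem_gates.symm
    refine (hS.cross_pairs _ _ H).imp ?_ (Or.imp ?_ (Or.imp ?_ (Or.imp ?_ hσ.crossPair))) <;>
      simp only [Finset.mem_union, hσ.mem_gates, shareReg_gateMap, hE, hS', imp_self]
  isCircuit := by
    rw [← hσ.setting_withIdeal hI]
    exact σ.isCircuit_setting hS.isCircuit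

end Fixes

end Symmetry

/-! ### Fresh names -/

section Swap

variable {α : Type*}

theorem exists_involutive_of_leftInverse {s t : α → α} (hts : Function.LeftInverse t s)
    {A : Finset α} (hA : ∀ a ∈ A, s a ∉ A) :
    ∃ f : α → α, f.Involutive ∧ (∀ x, f x = x ∨ f x = s x ∨ f x = t x) ∧
      (∀ a ∈ A, f a = s a) ∧ ∀ x ∉ A, x ∉ s '' A → f x = x := by
  classical
  let f x := if x ∈ A then s x else if x ∈ s '' A then t x else x
  have hfA : ∀ a ∈ A, f a = s a := fun a ha => if_pos ha
  have hfs : ∀ a ∈ A, f (s a) = a := fun a ha => by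
    simp only [f, if_neg (hA a ha), if_pos (Set.mem_image_of_mem s ha), hts a]
  have hf : ∀ x ∉ A, x ∉ s '' A → f x = x := fun x hx hx' => by
    simp only [f, if_neg hx, if_neg hx']
  refine ⟨f, fun x => ?_, fun x => ?_, hfA, hf⟩
  · by_cases hx : x ∈ A
    · rw [hfA x hx, hfs x hx]
    · by_cases hx' : x ∈ s '' A
      · obtain ⟨a, ha, rfl⟩ := hx'
        rw [hfs a ha, hfA a ha]
      · rw [hf x hx hx', hf x hx hx']
  · simp only [f]
    split_ifs <;> simp

theorem exists_involutive_renumber (num : α → ℕ) (renum : α → ℕ → α)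
    (hnum : ∀ x n, num (renum x n) = n) (hself : ∀ x, renum x (num x) = x)
    (hrenum : ∀ x m n, renum (renum x m) n = renum x n) (A F : Finset α) :
    ∃ f : α → α, f.Involutive ∧ (∀ x, renum x (num (f x)) = f x) ∧
      (∀ x ∈ F, x ∉ A → f x = x) ∧ ∀ x ∈ A, f x ∉ F := by
  classical
  set N := (A ∪ F).sup num + 1
  have hN : ∀ x ∈ A ∪ F, num x < N := fun x hx => Nat.lt_succ_of_le (Finset.le_sup hx)
  set s : α → α := fun x => renum x (num x + N)
  have hs : ∀ x, s x ∉ A ∪ F := fun x hx => by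
    have := hN _ hx
    simp only [s, hnum] at this
    omega
  obtain ⟨f, hf, hfst, hfA, hfix⟩ := exists_involutive_of_leftInverse (s := s)
    (t := fun x => renum x (num x - N))
    (fun x => by simp only [s, hnum, hrenum, Nat.add_sub_cancel, hself]) (A := A)
    fun a _ h => hs a (Finset.mem_union_left _ h)
  refine ⟨f, hf, fun x => ?_, fun x hxF hxA => hfix x hxA ?_, fun x hx h => ?_⟩
  · rcases hfst x with h | h | h <;> simp only [h, s, hnum, hself]
  · rintro ⟨a, -, rfl⟩
    exact hs a (Finset.mem_union_right _ hxF)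
  · exact hs x (Finset.mem_union_right _ (hfA x hx ▸ h))

end Swap

namespace Symmetry

theorem exists_gates_disjoint (A F : Finset Gate) :
    ∃ σ : Symmetry, (∀ ρ, σ.reg ρ = ρ) ∧ (∀ g ∈ F, g ∉ A → σ.gateMap g = g) ∧
      Disjoint (σ.gates A) F := by
  obtain ⟨f, hf, hid, hfix, hF⟩ := exists_involutive_renumber Gate.id
    (fun g n => { g with id := n }) (fun _ _ => rfl) (fun _ => rfl) (fun _ _ _ => rfl) A F
  refine ⟨{ Renaming.refl with
    gateMap := f
    gateMap_involutive := hf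
    ctrl_gateMap := fun g => ?_
    op_gateMap := fun g => ?_
    wake_gateMap := fun g => ?_ }, fun _ => rfl, hfix, ?_⟩
  · rw [← hid g]
    exact (Renaming.refl.ctrl_eq_self fun _ _ => rfl).symm
  · rw [← hid g]
    exact (Renaming.refl.op_eq_self fun _ _ => rfl).symm
  · rw [← hid g]
    exact (Option.map_id_apply).symm
  · exact Finset.disjoint_left.2 fun g hg => hf g ▸ hF _ (mem_gates _ |>.1 hg)

theorem exists_regs_disjoint (A F : Finset Reg) :
    ∃ σ : Symmetry, (∀ g : Gate, (∀ ρ ∈ g.regs, σ.reg ρ = ρ) → σ.gateMap g = g) ∧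
      (∀ ρ ∈ F, ρ ∉ A → σ.reg ρ = ρ) ∧ Disjoint (σ.regs A) F := by
  obtain ⟨f, hf, hname, hfix, hF⟩ := exists_involutive_renumber Reg.name
    (fun ρ n => { ρ with name := n }) (fun _ _ => rfl) (fun _ => rfl) (fun _ _ _ => rfl) A F
  let π : Renaming := ⟨fun ρ => (f ρ).name, fun ρ => by rw [hname ρ, hf]⟩
  have hπ : ∀ ρ, π.reg ρ = f ρ := hname
  refine ⟨{ π with
    gateMap := π.gate
    gateMap_involutive := π.gate_gate
    ctrl_gateMap := fun _ => rfl
    op_gateMap := fun _ => rfl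
    wake_gateMap := fun _ => rfl }, fun _ => π.gate_eq_self,
    fun ρ hρ hρA => (hπ ρ).trans (hfix ρ hρ hρA), Finset.disjoint_left.2 fun ρ hρ => ?_⟩
  exact hf ρ ▸ hF _ (hπ ρ ▸ π.mem_regs.1 hρ)

variable {P I : Protocol}

theorem exists_fixes_gates_disjoint {G : Finset Gate} (hP : Disjoint G P.gates)
    (hI : Disjoint G I.gates) (F : Finset Gate) :
    ∃ σ : Symmetry, (∀ ρ, σ.reg ρ = ρ) ∧ σ.Fixes P ∧ σ.Fixes I ∧ Disjoint (σ.gates G) F := by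
  obtain ⟨σ, hreg, hfix, hdisj⟩ := exists_gates_disjoint G (F ∪ P.gates ∪ I.gates)
  refine ⟨σ, hreg, ⟨fun ρ _ => hreg ρ, fun g hg => ?_⟩, ⟨fun ρ _ => hreg ρ, fun g hg => ?_⟩,
    hdisj.mono_right fun g hg => by simp [hg]⟩
  · exact hfix g (by simp [hg]) (Finset.disjoint_right.1 hP hg)
  · exact hfix g (by simp [hg]) (Finset.disjoint_right.1 hI hg)

theorem exists_fixes_regs_disjoint (hP : ∀ r ∈ P.roles, r.WellFormed)
    (hI : ∀ r ∈ I.roles, r.WellFormed) {A : Finset Reg} (hAP : Disjoint A P.regs)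
    (hAI : Disjoint A I.regs) (F : Finset Reg) :
    ∃ σ : Symmetry, σ.Fixes P ∧ σ.Fixes I ∧ Disjoint (σ.regs A) F := by
  obtain ⟨σ, hgate, hfix, hdisj⟩ := exists_regs_disjoint A (F ∪ P.regs ∪ I.regs)
  have hσP : ∀ ρ ∈ P.regs, σ.reg ρ = ρ := fun ρ hρ =>
    hfix ρ (by simp [hρ]) (Finset.disjoint_right.1 hAP hρ)
  have hσI : ∀ ρ ∈ I.regs, σ.reg ρ = ρ := fun ρ hρ =>
    hfix ρ (by simp [hρ]) (Finset.disjoint_right.1 hAI hρ)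
  exact ⟨σ, ⟨hσP, fun g hg => hgate g fun ρ hρ => hσP ρ (Protocol.mem_regs_of_gate hP hg hρ)⟩,
    ⟨hσI, fun g hg => hgate g fun ρ hρ => hσI ρ (Protocol.mem_regs_of_gate hI hg hρ)⟩,
    hdisj.mono_right fun ρ hρ => by simp [hρ]⟩

end Symmetry

/-! ### Schedules -/

theorem Setting.IsCircuit.exists_isSequence {A : Setting} (hA : A.IsCircuit)
    (v : (ρ : A.outcomes) → Val ρ.1) : ∃ l, A.IsSequence (A.init v) l := by
  classical
  have : IsPartialOrder Gate (Relation.ReflTransGen (A.rel (A.init v))) :=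
    { antisymm := fun g h hgh hhg => by
        rcases Relation.reflTransGen_iff_eq_or_transGen.1 hgh with rfl | hgh
        · rfl
        · exact absurd (hgh.trans_left hhg) (hA.acyclic v g) }
  obtain ⟨s, hs, hle⟩ := extend_partialOrder (Relation.ReflTransGen (A.rel (A.init v)))
  refine ⟨A.gates.sort s, Finset.sort_nodup _ _, fun g => Finset.mem_sort _,
    (Finset.pairwise_sort _ _).imp fun {g h} hgh hlt => ?_⟩
  obtain rfl : g = h := hs.antisymm _ _ hgh (hle _ _ hlt.to_reflTransGen)
  exact hA.acyclic v g hlt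

open Classical in
theorem Setting.IsCircuit.nonempty_schedule {A : Setting} (hA : A.IsCircuit) :
    Nonempty A.Schedule :=
  ⟨⟨fun x => if h : ∃ l, A.IsSequence x l then h.choose else [], fun v => by
    rw [dif_pos (hA.exists_isSequence v)]
    exact (hA.exists_isSequence v).choose_spec⟩⟩

theorem Close.trans {A B C : Setting} {ε δ : ℝ} (hB : B.IsCircuit) (h : Close A B ε)
    (h' : Close B C δ) : Close A C (ε + δ) := by
  obtain ⟨t⟩ := hB.nonempty_schedule
  intro s u
  exact (abs_sub_le _ (B.zeroProb t) _).trans (add_le_add (h s t) (h' t u))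

theorem Symmetry.close_setting_right (σ : Symmetry) {A B : Setting} {ε : ℝ} (h : Close A B ε) :
    Close A (σ.setting B) ε := by
  obtain ⟨B, rfl⟩ : ∃ B', B = σ.setting B' := ⟨_, (σ.setting_setting B).symm⟩
  rw [setting_setting]
  intro s t
  rw [← σ.zeroProb_schedule t]
  exact h s _

/-! ### Fresh environments and simulators -/

theorem OpenCircuit.ValidSimulator.of_with_cross {S : OpenCircuit} {E : Environment}
    {P I : Protocol} {c : Gate → Gate → Prop}
    (h : S.ValidSimulator { E with cross := c } P I) : S.ValidSimulator E P I :=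
  ⟨h.regs_disjoint, h.gates_disjoint, h.write, h.read, h.ord_gates, h.ord_local, h.cross_pairs,
    h.isCircuit⟩

theorem Symmetry.environment_eq_with_cross {σ : Symmetry} (hreg : ∀ ρ, σ.reg ρ = ρ)
    {E : Environment} (hord : ∀ x g k, E.ord x g k → g ∈ E.gates ∧ k ∈ E.gates)
    (hgates : ∀ g ∈ E.gates, σ.gateMap g = g) :
    σ.environment E = { E with cross := (σ.environment E).cross } := by
  have hmap : ∀ x g k, E.ord x g k → E.ord x (σ.gateMap g) (σ.gateMap k) := fun x g k H => by
    rwa [hgates g (hord _ _ _ H).1, hgates k (hord _ _ _ H).2]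
  have hrel : σ.rel E.ord = E.ord := by
    funext x g k
    rw [Symmetry.rel, show σ.conf x = x from funext fun ρ => σ.conf_apply_of_fixed x (hreg ρ)]
    exact propext ⟨fun H => by simpa using hmap _ _ _ H, hmap x g k⟩
  simp only [environment, openCircuit, σ.regs_eq_self fun ρ _ => hreg ρ, σ.gates_eq_self hgates,
    hrel, hreg]

theorem OpenCircuit.ValidSimulator.exists_gates_disjoint {S : OpenCircuit} {E : Environment}
    {P I : Protocol} (h : S.ValidSimulator E P I) (hI : ∀ r ∈ I.roles, r.WellFormed)
    (hE : ∀ x g k, E.ord x g k → g ∈ E.gates ∧ k ∈ E.gates) (F : Finset Gate) :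
    ∃ S' : OpenCircuit, S'.ValidSimulator E P I ∧ S'.size = S.size ∧ Disjoint S'.gates F ∧
      ∀ A ε, Close A (E.withIdeal I S) ε → Close A (E.withIdeal I S') ε := by
  obtain ⟨σ, hreg, hfix, hdisj⟩ := Symmetry.exists_gates_disjoint S.gates (F ∪ E.gates ∪ I.gates)
  have hσE : ∀ g ∈ E.gates, σ.gateMap g = g := fun g hg =>
    hfix g (by simp [hg]) (Finset.disjoint_right.1 h.gates_disjoint.1 hg)
  have hσI : σ.Fixes I := ⟨fun ρ _ => hreg ρ, fun g hg =>
    hfix g (by simp [hg]) (Finset.disjoint_right.1 h.gates_disjoint.2 hg)⟩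
  have hσ := Symmetry.environment_eq_with_cross hreg hE hσE
  refine ⟨σ.openCircuit S, .of_with_cross (hσ ▸ hσI.validSimulator (fun ρ _ => hreg ρ) hI h),
    σ.size_openCircuit S, hdisj.mono_right fun g hg => by simp [hg], fun A ε hA => ?_⟩
  have hA' := σ.close_setting_right hA
  rw [hσI.setting_withIdeal hI, hσ] at hA'
  exact hA'

/-- Some valid simulator against `E` has a size and an error that satisfy `Q`. -/
def Simulates (P I : Protocol) (E : Environment) (Q : ℕ → ℝ → Prop) : Prop :=
  ∃ (S : OpenCircuit) (ε : ℝ), S.ValidSimulator E P I ∧ Q S.size ε ∧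
    Close (E.withProtocol P) (E.withIdeal I S) ε

section Simulates

variable {P I : Protocol} {E : Environment} {Q : ℕ → ℝ → Prop}

theorem Symmetry.Fixes.simulates {σ : Symmetry} (hP : ∀ r ∈ P.roles, r.WellFormed)
    (hI : ∀ r ∈ I.roles, r.WellFormed) (hσP : σ.Fixes P) (hσI : σ.Fixes I)
    (h : Simulates P I (σ.environment E) Q) : Simulates P I E Q := by
  obtain ⟨S, ε, hS, hQ, hclose⟩ := h
  refine ⟨σ.openCircuit S, ε, ?_, by rwa [σ.size_openCircuit], σ.close_of_setting ?_⟩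
  · simpa only [σ.environment_environment] using hσI.validSimulator hσP.regs hI hS
  · rwa [hσP.setting_withProtocol hP, hσI.setting_withIdeal hI, σ.openCircuit_openCircuit]

theorem Simulates.of_forall_disjoint (hP : ∀ r ∈ P.roles, r.WellFormed)
    (hI : ∀ r ∈ I.roles, r.WellFormed) (A : Finset Reg) (G : Finset Gate) (hE : E.Valid P)
    (hEI : E.Avoids I)
    (h : ∀ E' : Environment, E'.Valid P → E'.Avoids I → Disjoint E'.regs A →
      Disjoint E'.gates G → E'.size = E.size → Simulates P I E' Q) :
    Simulates P I E Q := by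
  obtain ⟨σ, hσP, hσI, hσA⟩ := Symmetry.exists_fixes_regs_disjoint hP hI hE.regs_disjoint hEI.1 A
  have hE' := hσP.valid hP hE
  have hEI' := hσI.avoids hEI
  obtain ⟨τ, hreg, hτP, hτI, hτG⟩ :=
    Symmetry.exists_fixes_gates_disjoint hE'.gates_disjoint hEI'.2 G
  refine hσP.simulates hP hI hσI (hτP.simulates hP hI hτI (h _ (hτP.valid hP hE')
    (hτI.avoids hEI') ?_ hτG ((τ.size_openCircuit _).trans (σ.size_openCircuit _))))
  change Disjoint (τ.regs (σ.regs E.regs)) A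
  rwa [τ.regs_eq_self fun ρ _ => hreg ρ]

end Simulates

/-! ### The registers of a tree of sub-protocols -/

theorem Reg.IsLink.kind_ne_storage {ρ : Reg} (h : ρ.IsLink) : ρ.kind ≠ .storage := by
  rcases h with ⟨t, s, d, h⟩ | ⟨t, s, d, h⟩ <;> simp [h]

theorem Reg.IsLink.kind_ne_corruption {ρ : Reg} (h : ρ.IsLink) : ρ.kind ≠ .corruption := by
  rcases h with ⟨t, s, d, h⟩ | ⟨t, s, d, h⟩ <;> simp [h]

namespace Protocol

variable {P : Protocol} {ρ : Reg} (hP : ∀ r ∈ P.roles, r.WellFormed)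
include hP

theorem kind_of_mem_cors (h : ρ ∈ P.cors) : ρ.kind = .corruption := by
  obtain ⟨r, hr, h⟩ := mem_cors.1 h
  exact ((hP r hr).cor_kind ρ h).1

theorem isLink_of_mem_links (h : ρ ∈ P.links) : ρ.IsLink := by
  obtain ⟨r, hr, h⟩ := mem_links.1 h
  exact ((hP r hr).links_kind ρ h).1

theorem mem_io_or_mem_links (h : ρ ∈ P.regs) (hl : ρ.IsLink) : ρ ∈ P.io ∨ ρ ∈ P.links := by
  rcases mem_regs.1 h with ⟨r, hr, h⟩ | h
  · rcases Role.mem_regs.1 h with h | h | h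
    · exact absurd ((hP r hr).priv_kind ρ h) hl.kind_ne_storage
    · exact .inr (mem_links.2 ⟨r, hr, h⟩)
    · exact absurd ((hP r hr).cor_kind ρ h).1 hl.kind_ne_corruption
  · exact .inl h

theorem mem_cors_of_kind (hio : ∀ ρ ∈ P.io, ρ.IsLink) (h : ρ ∈ P.regs)
    (hk : ρ.kind = .corruption) : ρ ∈ P.cors := by
  rcases mem_regs.1 h with ⟨r, hr, h⟩ | h
  · rcases Role.mem_regs.1 h with h | h | h
    · exact absurd (((hP r hr).priv_kind ρ h).symm.trans hk) (by simp)
    · exact absurd hk ((hP r hr).links_kind ρ h).1.kind_ne_corruption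
    · exact mem_cors.2 ⟨r, hr, h⟩
  · exact absurd hk (hio ρ h).kind_ne_corruption

end Protocol

namespace ProtocolTree

variable {T : ProtocolTree} {q : T.Node} {r : Role} {ρ : Reg} {g : Gate}

theorem Below.refl (q : T.Node) : T.Below q q := Relation.ReflTransGen.refl

theorem Below.trans {a b c : T.Node} (h : T.Below a b) (h' : T.Below b c) : T.Below a c :=
  Relation.ReflTransGen.trans h h'

theorem below_of_parent {a b : T.Node} (h : T.parent a = some b) : T.Below a b :=
  Relation.ReflTransGen.single h

theorem Below.exists_parent {j q : T.Node} (h : T.Below j q) (hne : j ≠ q) :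
    ∃ p, T.parent j = some p ∧ T.Below p q :=
  (Relation.ReflTransGen.cases_head h).resolve_left hne

theorem Below.exists_child {j q : T.Node} (h : T.Below j q) (hne : j ≠ q) :
    ∃ i, T.parent i = some q ∧ T.Below j i := by
  obtain ⟨i, h, h'⟩ := (Relation.ReflTransGen.cases_tail h).resolve_left hne.symm
  exact ⟨i, h', h⟩

theorem not_below_of_parent {j p : T.Node} (h : T.parent j = some p) : ¬ T.Below p j := by
  -- A cycle through `j` would also be a cycle through its ancestors, hence through the root.
  have key : ∀ j, ∀ p, T.parent j = some p → ¬ T.Below p j := fun j => by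
    refine Relation.ReflTransGen.head_induction_on
      (motive := fun j _ => ∀ p, T.parent j = some p → ¬ T.Below p j) (T.reaches_root j) ?_ ?_
    · intro p h
      simp [T.parent_root] at h
    · intro a b hab _ ih p h hpa
      obtain rfl : b = p := Option.some.inj (hab.symm.trans h)
      by_cases hba : b = a
      · subst hba
        exact ih _ hab (Below.refl _)
      · obtain ⟨c, hbc, hca⟩ := hpa.exists_parent hba
        exact ih c hbc (hca.trans (below_of_parent hab))
  exact key j p h

theorem Below.antisymm {a b : T.Node} (h : T.Below a b) (h' : T.Below b a) : a = b := by
  by_contra hne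
  obtain ⟨p, hp, hpb⟩ := h.exists_parent hne
  exact not_below_of_parent hp (hpb.trans h')

theorem below_root (q : T.Node) : T.Below q T.root := T.reaches_root q

theorem Below.eq_or_below_of_parent {k j : T.Node} (h : T.Below k j) (hk : T.parent k = some q) :
    k = j ∨ T.Below q j := by
  refine or_iff_not_imp_left.2 fun hne => ?_
  obtain ⟨p, hp, hpj⟩ := h.exists_parent hne
  obtain rfl : q = p := Option.some.inj (hk.symm.trans hp)
  exact hpj

theorem mem_children {i q : T.Node} : i ∈ T.children q ↔ T.parent i = some q := by
  simp [children]

/-- The register occurs in the main module or in the ideal protocol of the node `j`. -/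
def Occurs (T : ProtocolTree) (j : T.Node) (ρ : Reg) : Prop :=
  ρ ∈ (T.mainProtocol j).regs ∨ ρ ∈ (T.ideal j).regs

/-- All registers of the main modules and of the ideal protocols of the tree. -/
def allRegs (T : ProtocolTree) : Finset Reg :=
  Finset.univ.biUnion fun j => (T.mainProtocol j).regs ∪ (T.ideal j).regs

/-- All gates of the main modules and of the ideal protocols of the tree. -/
def allGates (T : ProtocolTree) : Finset Gate :=
  Finset.univ.biUnion fun j => (T.mainProtocol j).gates ∪ (T.ideal j).gates

/-- The registers of the two protocols `tilde q` and `ideal q` that are exchanged at the node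
`q`. -/
def exchangedRegs (T : ProtocolTree) (q : T.Node) : Finset Reg :=
  (T.tilde q).regs ∪ (T.ideal q).regs

theorem mem_allRegs : ρ ∈ T.allRegs ↔ ∃ j, T.Occurs j ρ := by
  simp [allRegs, Occurs]

theorem mem_allGates :
    g ∈ T.allGates ↔ ∃ j, g ∈ (T.mainProtocol j).gates ∨ g ∈ (T.ideal j).gates := by
  simp [allGates]

theorem mem_tilde_roles :
    r ∈ (T.tilde q).roles ↔ r ∈ T.main q ∨ ∃ i, T.parent i = some q ∧ r ∈ (T.ideal i).roles := by
  simp [tilde, mem_children]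

theorem mem_protocol_roles : r ∈ T.protocol.roles ↔ ∃ j, r ∈ T.main j := by
  simp [protocol, sub, below_root]

theorem mem_mainProtocol_regs (hr : r ∈ T.main q) (h : ρ ∈ r.regs) :
    ρ ∈ (T.mainProtocol q).regs :=
  Protocol.mem_regs_of_role (P := T.mainProtocol q) hr h

theorem mem_mainProtocol_gates (hr : r ∈ T.main q) (hg : g ∈ r.gates) :
    g ∈ (T.mainProtocol q).gates := Protocol.mem_gates.2 ⟨r, hr, hg⟩

theorem mem_main_or_occursBelow_child_of_role (hr : r ∈ (T.tilde q).roles) (h : ρ ∈ r.regs) :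
    ρ ∈ (T.mainProtocol q).regs ∨ ∃ i ∈ T.children q, T.OccursBelow i ρ := by
  rcases mem_tilde_roles.1 hr with hr | ⟨i, hi, hr⟩
  · exact .inl (mem_mainProtocol_regs hr h)
  · exact .inr ⟨i, mem_children.2 hi, i, Below.refl i, .inr (Protocol.mem_regs_of_role hr h)⟩

theorem occursBelow_of_role (hr : r ∈ (T.tilde q).roles) (h : ρ ∈ r.regs) :
    T.OccursBelow q ρ := by
  rcases mem_main_or_occursBelow_child_of_role hr h with h | ⟨i, hi, j, hj, h⟩
  · exact ⟨q, Below.refl q, .inl h⟩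
  · exact ⟨j, hj.trans (below_of_parent (mem_children.1 hi)), h⟩

theorem occursBelow_of_mem_ideal (h : ρ ∈ (T.ideal q).regs) : T.OccursBelow q ρ :=
  ⟨q, Below.refl q, .inr h⟩

theorem occursBelow_of_mem_tilde (h : ρ ∈ (T.tilde q).regs) : T.OccursBelow q ρ := by
  rcases Protocol.mem_regs.1 h with ⟨r, hr, h⟩ | h
  · exact occursBelow_of_role hr h
  · exact occursBelow_of_mem_ideal (Protocol.mem_regs_of_io (P := T.ideal q) h)

theorem occursBelow_of_mem_exchangedRegs (h : ρ ∈ T.exchangedRegs q) : T.OccursBelow q ρ :=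
  (Finset.mem_union.1 h).elim occursBelow_of_mem_tilde occursBelow_of_mem_ideal

theorem OccursBelow.mem_allRegs (h : T.OccursBelow q ρ) : ρ ∈ T.allRegs := by
  obtain ⟨i, -, h⟩ := h
  exact ProtocolTree.mem_allRegs.2 ⟨i, h⟩

theorem exchangedRegs_subset_allRegs : T.exchangedRegs q ⊆ T.allRegs := fun _ h =>
  (occursBelow_of_mem_exchangedRegs h).mem_allRegs

theorem protocol_regs_subset_allRegs : T.protocol.regs ⊆ T.allRegs := fun _ h => by
  rcases Protocol.mem_regs.1 h with ⟨r, hr, h⟩ | h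
  · obtain ⟨j, hj⟩ := mem_protocol_roles.1 hr
    exact mem_allRegs.2 ⟨j, .inl (mem_mainProtocol_regs hj h)⟩
  · exact mem_allRegs.2 ⟨T.root, .inr (Protocol.mem_regs_of_io h)⟩

theorem mem_main_or_ideal_of_tilde_gate (h : g ∈ (T.tilde q).gates) :
    g ∈ (T.mainProtocol q).gates ∨ ∃ i, T.parent i = some q ∧ g ∈ (T.ideal i).gates := by
  obtain ⟨r, hr, hg⟩ := Protocol.mem_gates.1 h
  rcases mem_tilde_roles.1 hr with hr | ⟨i, hi, hr⟩
  · exact .inl (mem_mainProtocol_gates hr hg)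
  · exact .inr ⟨i, hi, Protocol.mem_gates.2 ⟨r, hr, hg⟩⟩

theorem ideal_gates_subset_allGates : (T.ideal q).gates ⊆ T.allGates := fun _ h =>
  mem_allGates.2 ⟨q, .inr h⟩

theorem tilde_gates_subset_allGates : (T.tilde q).gates ⊆ T.allGates := fun _ h => by
  rcases mem_main_or_ideal_of_tilde_gate h with h | ⟨i, -, h⟩
  · exact mem_allGates.2 ⟨q, .inl h⟩
  · exact ideal_gates_subset_allGates h

/-- The register `ρ` occurs outside of the subtree of `p`, or in the ideal protocol of `p`. -/
def VisibleOutside (T : ProtocolTree) (p : T.Node) (ρ : Reg) : Prop :=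
  (∃ j, ¬ T.Below j p ∧ T.Occurs j ρ) ∨ ρ ∈ (T.ideal p).regs

theorem VisibleOutside.of_below {j p : T.Node} (hρ : T.VisibleOutside p ρ) (h : T.Below j p) :
    T.VisibleOutside j ρ := by
  refine Relation.ReflTransGen.head_induction_on
    (motive := fun j _ => T.VisibleOutside j ρ) h hρ ?_
  rintro a b hab - (⟨i, hi, hρ⟩ | hρ)
  · exact .inl ⟨i, fun hij => hi (hij.trans (below_of_parent hab)), hρ⟩
  · exact .inl ⟨b, not_below_of_parent hab, .inr hρ⟩

theorem visibleOutside_child_of_mem_tilde {i : T.Node} (hi : T.parent i = some q)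
    (h : ρ ∈ (T.tilde q).regs) : T.VisibleOutside i ρ := by
  have hq := not_below_of_parent hi
  rcases Protocol.mem_regs.1 h with ⟨s, hs, h⟩ | h
  · rcases mem_tilde_roles.1 hs with hs | ⟨k, hk, hs⟩
    · exact .inl ⟨q, hq, .inl (mem_mainProtocol_regs hs h)⟩
    · have h' := Protocol.mem_regs_of_role hs h
      by_cases hki : k = i
      · exact .inr (hki ▸ h')
      · exact .inl ⟨k, fun hb => (hb.eq_or_below_of_parent hk).elim hki hq, .inr h'⟩
  · exact .inl ⟨q, hq, .inr (Protocol.mem_regs_of_io (P := T.ideal q) h)⟩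

namespace WellFormed

variable (hT : T.WellFormed) {j : T.Node}
include hT

theorem ideal_role (q : T.Node) : ∀ r ∈ (T.ideal q).roles, r.WellFormed :=
  (hT.ideal_wf q).roles_wf

theorem tilde_role (q : T.Node) : ∀ r ∈ (T.tilde q).roles, r.WellFormed := fun r hr => by
  rcases mem_tilde_roles.1 hr with hr | ⟨i, _, hr⟩
  · exact (hT.main_wf q).roles_wf r hr
  · exact hT.ideal_role i r hr

theorem protocol_role : ∀ r ∈ T.protocol.roles, r.WellFormed := fun r hr => by
  obtain ⟨j, hr⟩ := mem_protocol_roles.1 hr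
  exact (hT.main_wf j).roles_wf r hr

theorem io_link : ∀ ρ ∈ (T.ideal q).io, ρ.IsLink := (hT.ideal_wf q).io_link

theorem mem_io_of_not_below (hjq : ¬ T.Below j q) (hqj : ¬ T.Below q j) (h : T.OccursBelow q ρ)
    (hρ : ρ ∈ (T.ideal j).regs) : ρ ∈ (T.ideal q).io :=
  (hT.ideal_outside q j hjq ρ h hρ).resolve_right fun h => hqj h.1

theorem mem_io_of_isLink (hjq : ¬ T.Below j q) (h : T.OccursBelow q ρ)
    (hρ : ρ ∈ (T.ideal j).regs) (hl : ρ.IsLink) : ρ ∈ (T.ideal q).io :=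
  (hT.ideal_outside q j hjq ρ h hρ).resolve_right fun h =>
    hl.kind_ne_corruption (Protocol.kind_of_mem_cors (hT.ideal_role q) h.2)

theorem mem_io_or_mem_cors_of_occurs (hjq : ¬ T.Below j q) (h : T.OccursBelow q ρ)
    (hρ : T.Occurs j ρ) : ρ ∈ (T.ideal q).io ∨ ρ ∈ (T.ideal q).cors :=
  hρ.elim (fun hρ => .inl (hT.main_outside q j hjq ρ h hρ)) fun hρ =>
    (hT.ideal_outside q j hjq ρ h hρ).imp_right And.right

theorem mem_ideal_of_occurs (hjq : ¬ T.Below j q) (h : T.OccursBelow q ρ) (hρ : T.Occurs j ρ) :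
    ρ ∈ (T.ideal q).regs :=
  (hT.mem_io_or_mem_cors_of_occurs hjq h hρ).elim Protocol.mem_regs_of_io
    Protocol.mem_regs_of_cors

theorem mem_tilde_of_ideal_own (hρ : ρ ∈ (T.ideal q).regs)
    (h : ρ ∈ (T.mainProtocol q).regs ∨ ∃ i ∈ T.children q, T.OccursBelow i ρ) :
    ρ ∈ (T.tilde q).regs :=
  (hT.ideal_own q ρ hρ h).elim (Protocol.mem_regs_of_io (P := T.tilde q)) fun h =>
    Protocol.mem_regs_of_cors h.1

theorem mem_tilde_of_mem_main (hρ : ρ ∈ (T.mainProtocol j).regs) (h : ρ ∈ T.exchangedRegs q) :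
    ρ ∈ (T.tilde q).regs := by
  refine (Finset.mem_union.1 h).elim id fun hI => ?_
  by_cases hjq : T.Below j q
  · refine hT.mem_tilde_of_ideal_own hI ?_
    by_cases hne : j = q
    · exact .inl (hne ▸ hρ)
    · obtain ⟨i, hi, hji⟩ := hjq.exists_child hne
      exact .inr ⟨i, mem_children.2 hi, j, hji, .inl hρ⟩
  · exact Protocol.mem_regs_of_io (P := T.tilde q)
      (hT.main_outside q j hjq ρ (occursBelow_of_mem_ideal hI) hρ)

theorem mem_tilde_of_mem_ideal (hqj : ¬ T.Below q j) (hρ : ρ ∈ (T.ideal j).regs)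
    (h : ρ ∈ T.exchangedRegs q) : ρ ∈ (T.tilde q).regs := by
  refine (Finset.mem_union.1 h).elim id fun hI => ?_
  by_cases hjq : T.Below j q
  · obtain ⟨i, hi, hji⟩ := hjq.exists_child fun e => hqj (e ▸ Below.refl q)
    exact hT.mem_tilde_of_ideal_own hI (.inr ⟨i, mem_children.2 hi, j, hji, .inr hρ⟩)
  · exact Protocol.mem_regs_of_io (P := T.tilde q)
      (hT.mem_io_of_not_below hjq hqj (occursBelow_of_mem_ideal hI) hρ)

theorem mem_io_or_mem_cors_of_visibleOutside (hr : r ∈ (T.tilde q).roles) (h : ρ ∈ r.regs)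
    (hρ : T.VisibleOutside q ρ) : ρ ∈ (T.ideal q).io ∨ ρ ∈ (T.ideal q).cors := by
  rcases hρ with ⟨j, hj, hρ⟩ | hρ
  · exact hT.mem_io_or_mem_cors_of_occurs hj (occursBelow_of_role hr h) hρ
  · exact (hT.ideal_own q ρ hρ (mem_main_or_occursBelow_child_of_role hr h)).imp_right And.right

theorem mem_io_of_visibleOutside (hr : r ∈ (T.tilde q).roles) (h : ρ ∈ r.links)
    (hρ : T.VisibleOutside q ρ) : ρ ∈ (T.ideal q).io :=
  (hT.mem_io_or_mem_cors_of_visibleOutside hr (Role.mem_regs.2 (.inr (.inl h)))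
    hρ).resolve_right fun h' => ((hT.tilde_role q r hr).links_kind ρ h).1.kind_ne_corruption
      (Protocol.kind_of_mem_cors (hT.ideal_role q) h')

theorem notMem_priv_of_visibleOutside (hr : r ∈ (T.tilde q).roles)
    (hρ : T.VisibleOutside q ρ) : ρ ∉ r.priv := fun h => by
  have hk := (hT.tilde_role q r hr).priv_kind ρ h
  rcases hT.mem_io_or_mem_cors_of_visibleOutside hr (Role.mem_regs.2 (.inl h)) hρ with h | h
  · exact (hT.io_link ρ h).kind_ne_storage hk
  · exact absurd ((Protocol.kind_of_mem_cors (hT.ideal_role q) h).symm.trans hk) (by simp)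

theorem exists_counterpart {i : T.Node} (hji : T.Below j i) (hr : r ∈ (T.tilde j).roles)
    (h : ρ ∈ r.links) (hρ : T.VisibleOutside i ρ) :
    ∃ r' ∈ (T.ideal i).roles, r'.id = r.id ∧ r'.cor = r.cor ∧ ρ ∈ r'.links := by
  have step : ∀ {j}, T.Below j i → ∀ r ∈ (T.tilde j).roles, ρ ∈ r.links →
      ∃ r' ∈ (T.ideal j).roles, r'.id = r.id ∧ r'.cor = r.cor ∧ ρ ∈ r'.links :=
    fun {j} hji r hr h => hT.correspondence j r hr ρ h
      (hT.mem_io_of_visibleOutside hr h (hρ.of_below hji))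
  refine Relation.ReflTransGen.head_induction_on (motive := fun j _ => ∀ r ∈ (T.tilde j).roles,
    ρ ∈ r.links → ∃ r' ∈ (T.ideal i).roles, r'.id = r.id ∧ r'.cor = r.cor ∧ ρ ∈ r'.links)
    hji (step (Below.refl i)) ?_ r hr h
  intro a b hab hbi ih r hr h
  obtain ⟨r', hr', hid, hcor, hlinks⟩ := step ((below_of_parent hab).trans hbi) r hr h
  obtain ⟨s, hs, hid', hcor', hlinks'⟩ := ih r' (mem_tilde_roles.2 (.inr ⟨a, hab, hr'⟩)) hlinks
  exact ⟨s, hs, hid'.trans hid, hcor'.trans hcor, hlinks'⟩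

theorem isLink_of_main_of_ideal {k : T.Node} {s : Role} (hk : T.parent k = some q)
    (hr : r ∈ T.main q) (hs : s ∈ (T.ideal k).roles) (h : ρ ∈ r.regs) (h' : ρ ∈ s.regs) :
    ρ.IsLink :=
  hT.io_link ρ (hT.main_outside k q (not_below_of_parent hk) ρ
    (occursBelow_of_mem_ideal (Protocol.mem_regs_of_role hs h')) (mem_mainProtocol_regs hr h))

theorem isLink_of_tilde_roles {s : Role} (hr : r ∈ (T.tilde q).roles)
    (hs : s ∈ (T.tilde q).roles) (hne : r ≠ s) (h : ρ ∈ r.regs) (h' : ρ ∈ s.regs) :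
    ρ.IsLink := by
  rcases mem_tilde_roles.1 hr with hr | ⟨k, hk, hr⟩ <;>
    rcases mem_tilde_roles.1 hs with hs | ⟨l, hl, hs⟩
  · exact (hT.main_wf q).roles_regs r hr s hs hne ρ h h'
  · exact hT.isLink_of_main_of_ideal hl hr hs h h'
  · exact hT.isLink_of_main_of_ideal hk hs hr h' h
  · by_cases hkl : k = l
    · subst hkl
      exact (hT.ideal_wf k).roles_regs r hr s hs hne ρ h h'
    · refine hT.io_link ρ (hT.mem_io_of_not_below (q := k) (j := l) (fun hb => ?_) (fun hb => ?_)
        (occursBelow_of_mem_ideal (Protocol.mem_regs_of_role hr h))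
        (Protocol.mem_regs_of_role hs h'))
      · exact (hb.eq_or_below_of_parent hl).elim (Ne.symm hkl) (not_below_of_parent hk)
      · exact (hb.eq_or_below_of_parent hk).elim hkl (not_below_of_parent hl)

/-! ### Access through the tree -/

variable {acc : Access → Prop}

theorem exposes_of_grants {p : T.Node} (hpq : T.Below p q) (hr : r ∈ (T.tilde p).roles)
    (hg : ∃ C, r.cor = some C ∧ (C, 1) ∈ g.ctrl) (hρ : r.Grants acc ρ)
    (hq : ρ ∈ (T.tilde q).regs) : (T.tilde q).Exposes acc g ρ := by
  by_cases hne : p = q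
  · subst hne
    exact .inr (.inr (.inr ⟨r, ⟨hr, hg⟩, hρ⟩))
  -- Below the child `i` of `q`, only channels of circuits with a counterpart in `I(i)` matter.
  obtain ⟨i, hi, hpi⟩ := hpq.exists_child hne
  have hvis := visibleOutside_child_of_mem_tilde hi hq
  obtain ⟨hlink, hacc⟩ :=
    hρ.resolve_left (hT.notMem_priv_of_visibleOutside hr (hvis.of_below hpi))
  obtain ⟨r', hr', hid, hcor, hlink'⟩ := hT.exists_counterpart hpi hr hlink hvis
  refine .inr (.inr (.inr ⟨r', ⟨mem_tilde_roles.2 (.inr ⟨i, hi, hr'⟩), ?_⟩, .inr ⟨hlink', ?_⟩⟩))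
  · rwa [hcor]
  · rwa [hid]

theorem exposes_of_links (hl : ρ.IsLink) (hacc : acc ρ.outsider) (hq : ρ ∈ (T.tilde q).regs) :
    (T.tilde q).Exposes acc g ρ := by
  rcases Protocol.mem_io_or_mem_links (hT.tilde_role q) hq hl with h | h
  · exact .inl h
  · exact .inr (.inr (.inl ⟨h, hacc⟩))

theorem exposes_tilde_of_exposes_protocol (h : T.protocol.Exposes acc g ρ)
    (hq : ρ ∈ T.exchangedRegs q) : (T.tilde q).Exposes acc g ρ := by
  have hmain : ∀ {r}, r ∈ T.protocol.roles → ρ ∈ r.regs → ρ ∈ (T.tilde q).regs := fun hr h => by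
    obtain ⟨j, hj⟩ := mem_protocol_roles.1 hr
    exact hT.mem_tilde_of_mem_main (mem_mainProtocol_regs hj h) hq
  rcases h with h | h | ⟨h, hacc⟩ | ⟨r, ⟨hr, hg⟩, h⟩
  · change ρ ∈ (T.ideal T.root).io at h
    refine .inl ?_
    by_cases hroot : T.root = q
    · exact hroot ▸ h
    · exact hT.mem_io_of_isLink (fun hb => hroot (hb.antisymm (below_root q)))
        (occursBelow_of_mem_exchangedRegs hq) (Protocol.mem_regs_of_io h) (hT.io_link ρ h)
  · obtain ⟨r, hr, hcor⟩ := Protocol.mem_cors.1 h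
    exact .inr (.inl (Protocol.mem_cors_of_kind (hT.tilde_role q) hT.io_link
      (hmain hr (Role.mem_regs.2 (.inr (.inr hcor))))
      (Protocol.kind_of_mem_cors hT.protocol_role h)))
  · obtain ⟨r, hr, hlink⟩ := Protocol.mem_links.1 h
    exact hT.exposes_of_links (Protocol.isLink_of_mem_links hT.protocol_role h) hacc
      (hmain hr (Role.mem_regs.2 (.inr (.inl hlink))))
  · have hρ := hmain hr h.mem_regs
    obtain ⟨j, hj⟩ := mem_protocol_roles.1 hr
    by_cases hjq : T.Below j q
    · exact hT.exposes_of_grants hjq (mem_tilde_roles.2 (.inl hj)) hg h hρ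
    · exact .inl (hT.main_outside q j hjq ρ (occursBelow_of_mem_tilde hρ)
        (mem_mainProtocol_regs hj h.mem_regs))

theorem notMem_exchangedRegs_of_simulated (hqj : ¬ T.Below q j) (h : ρ ∈ (T.tilde j).regs)
    (hI : ρ ∉ (T.ideal j).regs) : ρ ∉ T.exchangedRegs q := by
  have hout : ∀ k, ¬ T.Below k j → ¬ T.Occurs k ρ := fun k hk ho =>
    hI (hT.mem_ideal_of_occurs hk (occursBelow_of_mem_tilde h) ho)
  intro hq
  rcases Finset.mem_union.1 hq with hq | hq
  · rcases Protocol.mem_regs.1 hq with ⟨s, hs, h'⟩ | h'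
    · rcases mem_tilde_roles.1 hs with hs | ⟨k, hk, hs⟩
      · exact hout q hqj (.inl (mem_mainProtocol_regs hs h'))
      · have hρk := Protocol.mem_regs_of_role hs h'
        by_cases hkj : k = j
        · exact hI (hkj ▸ hρk)
        · exact hout k (fun hb => (hb.eq_or_below_of_parent hk).elim hkj hqj) (.inr hρk)
    · exact hout q hqj (.inr (Protocol.mem_regs_of_io (P := T.ideal q) h'))
  · exact hout q hqj (.inr hq)

theorem mem_tilde_cors_of_mem_ideal_cors (hqj : ¬ T.Below q j) (h : ρ ∈ (T.ideal j).cors)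
    (hq : ρ ∈ T.exchangedRegs q) : ρ ∈ (T.tilde q).cors :=
  Protocol.mem_cors_of_kind (hT.tilde_role q) hT.io_link
    (hT.mem_tilde_of_mem_ideal hqj (Protocol.mem_regs_of_cors h) hq)
    (Protocol.kind_of_mem_cors (hT.ideal_role j) h)

theorem exposes_tilde_of_exposesAsCorrupted (hqj : ¬ T.Below q j)
    (h : (T.ideal j).ExposesAsCorrupted acc g ρ) (hq : ρ ∈ T.exchangedRegs q) :
    (T.tilde q).Exposes acc g ρ := by
  have hρ := hT.mem_tilde_of_mem_ideal hqj h.mem_regs hq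
  by_cases hjq : T.Below j q
  · obtain ⟨r, ⟨hr, hg⟩, h | ⟨h, -, hacc⟩⟩ := h
    · obtain ⟨p, hp, hpq⟩ := hjq.exists_parent fun e => hqj (e ▸ Below.refl q)
      exact hT.exposes_of_grants hpq (mem_tilde_roles.2 (.inr ⟨j, hp, hr⟩)) hg h hρ
    · exact hT.exposes_of_links (Protocol.isLink_of_mem_links (hT.ideal_role j) h) hacc hρ
  · exact .inl (hT.mem_io_of_not_below hjq hqj (occursBelow_of_mem_tilde hρ) h.mem_regs)

theorem notMem_ideal_of_simulated (hjq : T.Below j q) (h : ρ ∈ (T.tilde j).regs)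
    (hI : ρ ∉ (T.ideal j).regs) : ρ ∉ (T.ideal q).regs := fun hq => by
  by_cases hne : j = q
  · exact hI (hne ▸ hq)
  · exact hI (hT.mem_ideal_of_occurs (fun hb => hne (hjq.antisymm hb))
      (occursBelow_of_mem_tilde h) (.inr hq))

theorem mem_ideal_cors_of_mem_ideal_cors (h : ρ ∈ (T.ideal j).cors)
    (hq : ρ ∈ (T.ideal q).regs) : ρ ∈ (T.ideal q).cors :=
  Protocol.mem_cors_of_kind (hT.ideal_role q) hT.io_link hq
    (Protocol.kind_of_mem_cors (hT.ideal_role j) h)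

theorem exposesAsCorrupted_of_below (hjq : T.Below j q)
    (h : (T.ideal j).ExposesAsCorrupted acc g ρ) (hq : ρ ∈ (T.ideal q).regs) :
    (T.ideal q).ExposesAsCorrupted acc g ρ := by
  by_cases hne : j = q
  · exact hne ▸ h
  have hI := h.mem_regs
  obtain ⟨r, ⟨hr, hg⟩, h | ⟨h, hio, -⟩⟩ := h
  · obtain ⟨p, hp, hpq⟩ := hjq.exists_parent hne
    have hrp : r ∈ (T.tilde p).roles := mem_tilde_roles.2 (.inr ⟨j, hp, hr⟩)
    have hvis : T.VisibleOutside q ρ := .inr hq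
    obtain ⟨hlink, hacc⟩ :=
      h.resolve_left (hT.notMem_priv_of_visibleOutside hrp (hvis.of_below hpq))
    obtain ⟨r', hr', hid, hcor, hlink'⟩ := hT.exists_counterpart hpq hrp hlink hvis
    exact ⟨r', ⟨hr', hcor ▸ hg⟩, .inl (.inr ⟨hlink', by rwa [hid]⟩)⟩
  · exact absurd (hT.mem_io_of_isLink (fun hb => hne (hjq.antisymm hb))
      (occursBelow_of_mem_ideal hI) hq (Protocol.isLink_of_mem_links (hT.ideal_role j) h)) hio

end WellFormed

end ProtocolTree

theorem gatesSize_mono {A B : Finset Gate} (h : A ⊆ B) : gatesSize A ≤ gatesSize B :=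
  Finset.sum_le_sum_of_subset h

theorem gatesSize_union_le (A B : Finset Gate) :
    gatesSize (A ∪ B) ≤ gatesSize A + gatesSize B := by
  unfold gatesSize
  rw [← Finset.sum_union_inter]
  exact Nat.le_add_right _ _

theorem gatesSize_biUnion_le {ι : Type*} (s : Finset ι) (f : ι → Finset Gate) :
    gatesSize (s.biUnion f) ≤ ∑ i ∈ s, gatesSize (f i) := by
  classical
  induction s using Finset.induction_on with
  | empty => simp [gatesSize]
  | insert a s ha ih =>
    rw [Finset.biUnion_insert, Finset.sum_insert ha]
    exact (gatesSize_union_le _ _).trans (Nat.add_le_add_left ih _)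

/-! ### Hybrids -/

/-- A stage between the protocol of the tree and the ideal protocol of its root: the sub-protocols
of the nodes in `done` have been replaced by ideal protocols and by simulators, and `cross` is the
order of gates that belong to different circuits. -/
structure Hybrid (T : ProtocolTree) where
  done : Finset T.Node
  sim : T.Node → OpenCircuit
  cross : Gate → Gate → Prop

namespace Hybrid

open ProtocolTree

variable {T : ProtocolTree} (H : Hybrid T) (E : Environment) (q : T.Node)

/-- Whole subtrees have been replaced. -/
def Closed : Prop := ∀ ⦃j p⦄, T.parent j = some p → p ∈ H.done → j ∈ H.done

/-- The node `q` can be replaced next. -/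
structure Ready : Prop where
  notMem : q ∉ H.done
  child_mem : ∀ i, T.parent i = some q → i ∈ H.done

open Classical in
/-- The nodes whose ideal protocol is present in the hybrid. -/
def front : Finset T.Node := {k ∈ H.done | ∀ p, T.parent k = some p → p ∉ H.done}

open Classical in
/-- The protocol circuits that are present in the hybrid. -/
def roles : Finset Role :=
  (Finset.univ \ H.done).biUnion T.main ∪ H.front.biUnion fun k => (T.ideal k).roles

open Classical in
/-- The protocol circuits that are present in the hybrid and do not belong to `T.tilde q`. -/
def rolesOutside : Finset Role :=
  (Finset.univ \ insert q H.done).biUnion T.main ∪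
    (H.front \ T.children q).biUnion fun k => (T.ideal k).roles

open Classical in
/-- The gates of the simulators. -/
def simGates : Finset Gate := H.done.biUnion fun j => (H.sim j).gates

open Classical in
/-- The hybrid, run with the environment `E`. -/
def setting : Setting where
  gates := E.gates ∪ H.roles.biUnion Role.gates ∪ H.simGates
  rel x g h := E.ord x g h ∨ (∃ r ∈ H.roles, r.ord x g h) ∨ (∃ j ∈ H.done, (H.sim j).ord x g h) ∨
    H.cross g h
  out := E.out

open Classical in
/-- The gates of the hybrid that do not belong to `T.tilde q`. -/
def envGates : Finset Gate := E.gates ∪ (H.rolesOutside q).biUnion Role.gates ∪ H.simGates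

open Classical in
/-- The part of the hybrid outside of `T.tilde q`, as an environment for `T.tilde q`. It owns all
registers that are not registers of `T.tilde q` or of `T.ideal q`, even those that no longer occur
in the hybrid. -/
def env : Environment where
  regs := (E.regs ∪ T.allRegs ∪ H.done.biUnion fun j => (H.sim j).regs) \ T.exchangedRegs q
  gates := H.envGates E q
  ord x g h := E.ord x g h ∨ (∃ r ∈ H.rolesOutside q, r.ord x g h) ∨
    (∃ j ∈ H.done, (H.sim j).ord x g h) ∨ (H.cross g h ∧ g ∈ H.envGates E q ∧ h ∈ H.envGates E q)
  cross g h := H.cross g h ∧ ¬ (g ∈ H.envGates E q ∧ h ∈ H.envGates E q)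
  out := E.out

open Classical in
/-- The hybrid in which `T.tilde q` has been replaced by `T.ideal q` and the simulator `S`. -/
def next (S : OpenCircuit) : Hybrid T where
  done := insert q H.done
  sim := Function.update H.sim q S
  cross g h := (H.cross g h ∧ g ∈ H.envGates E q ∧ h ∈ H.envGates E q) ∨ S.cross g h

variable {H E q} {r : Role} {g : Gate} {S : OpenCircuit}

theorem mem_front {k : T.Node} :
    k ∈ H.front ↔ k ∈ H.done ∧ ∀ p, T.parent k = some p → p ∉ H.done := by
  simp [front]

theorem mem_roles :
    r ∈ H.roles ↔ (∃ j, j ∉ H.done ∧ r ∈ T.main j) ∨ ∃ k ∈ H.front, r ∈ (T.ideal k).roles := by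
  simp [roles]

theorem mem_rolesOutside :
    r ∈ H.rolesOutside q ↔ (∃ j, (j ≠ q ∧ j ∉ H.done) ∧ r ∈ T.main j) ∨
      ∃ k, (k ∈ H.front ∧ T.parent k ≠ some q) ∧ r ∈ (T.ideal k).roles := by
  simp [rolesOutside, mem_children]

theorem mem_simGates : g ∈ H.simGates ↔ ∃ j ∈ H.done, g ∈ (H.sim j).gates := by
  simp [simGates]

theorem mem_envGates :
    g ∈ H.envGates E q ↔ g ∈ E.gates ∨ (∃ r ∈ H.rolesOutside q, g ∈ r.gates) ∨ g ∈ H.simGates := by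
  simp [envGates]

theorem mem_setting_gates :
    g ∈ (H.setting E).gates ↔ g ∈ E.gates ∨ (∃ r ∈ H.roles, g ∈ r.gates) ∨ g ∈ H.simGates := by
  simp [setting]

theorem mem_next_done {j : T.Node} : j ∈ (H.next E q S).done ↔ j = q ∨ j ∈ H.done := by
  simp [next]

theorem Ready.mem_roles_iff (hq : H.Ready q) :
    r ∈ H.roles ↔ r ∈ H.rolesOutside q ∨ r ∈ (T.tilde q).roles := by
  rw [mem_roles, mem_rolesOutside, mem_tilde_roles]
  constructor
  · rintro (⟨j, hj, hr⟩ | ⟨k, hk, hr⟩)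
    · by_cases hjq : j = q
      · exact .inr (.inl (hjq ▸ hr))
      · exact .inl (.inl ⟨j, ⟨hjq, hj⟩, hr⟩)
    · by_cases hkq : T.parent k = some q
      · exact .inr (.inr ⟨k, hkq, hr⟩)
      · exact .inl (.inr ⟨k, ⟨hk, hkq⟩, hr⟩)
  · rintro ((⟨j, hj, hr⟩ | ⟨k, hk, hr⟩) | hr | ⟨k, hk, hr⟩)
    · exact .inl ⟨j, hj.2, hr⟩
    · exact .inr ⟨k, hk.1, hr⟩
    · exact .inl ⟨q, hq.notMem, hr⟩
    · refine .inr ⟨k, mem_front.2 ⟨hq.child_mem k hk, fun p hp => ?_⟩, hr⟩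
      exact Option.some.inj (hk.symm.trans hp) ▸ hq.notMem

theorem Closed.mem_next_front (hH : H.Closed) (hq : q ∉ H.done) {k : T.Node} :
    k ∈ (H.next E q S).front ↔ (k ∈ H.front ∧ T.parent k ≠ some q) ∨ k = q := by
  simp only [mem_front, mem_next_done, not_or]
  constructor
  · rintro ⟨rfl | hk, h⟩
    · exact .inr rfl
    · exact .inl ⟨⟨hk, fun p hp => (h p hp).2⟩, fun hp => (h q hp).1 rfl⟩
  · rintro (⟨⟨hk, h⟩, h'⟩ | rfl)
    · exact ⟨.inr hk, fun p hp => ⟨fun e => h' (e ▸ hp), h p hp⟩⟩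
    · refine ⟨.inl rfl, fun p hp => ⟨?_, fun hd => hq (hH hp hd)⟩⟩
      rintro rfl
      exact not_below_of_parent hp (Below.refl p)

theorem Closed.mem_next_roles (hH : H.Closed) (hq : q ∉ H.done) :
    r ∈ (H.next E q S).roles ↔ r ∈ H.rolesOutside q ∨ r ∈ (T.ideal q).roles := by
  simp only [mem_roles, mem_rolesOutside, hH.mem_next_front hq, mem_next_done, not_or, or_and_right,
    exists_or, exists_eq_left, or_assoc]

theorem next_sim_self : (H.next E q S).sim q = S := by
  simp [next]

theorem next_sim_of_mem (hq : q ∉ H.done) {j : T.Node} (hj : j ∈ H.done) :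
    (H.next E q S).sim j = H.sim j := by
  simp [next, ne_of_mem_of_not_mem hj hq]

theorem exists_sim_next (hq : q ∉ H.done) (S : OpenCircuit) (p : OpenCircuit → Prop) :
    (∃ j ∈ (H.next E q S).done, p ((H.next E q S).sim j)) ↔ (∃ j ∈ H.done, p (H.sim j)) ∨ p S := by
  constructor
  · rintro ⟨j, hj, h⟩
    rcases mem_next_done.1 hj with rfl | hj
    · exact .inr (by rwa [next_sim_self] at h)
    · exact .inl ⟨j, hj, by rwa [next_sim_of_mem hq hj] at h⟩
  · rintro (⟨j, hj, h⟩ | h)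
    · exact ⟨j, mem_next_done.2 (.inr hj), by rwa [next_sim_of_mem hq hj]⟩
    · exact ⟨q, mem_next_done.2 (.inl rfl), by rwa [next_sim_self]⟩

theorem env_withProtocol (hq : H.Ready q) :
    (H.env E q).withProtocol (T.tilde q) = H.setting E := by
  refine Setting.ext (Finset.ext fun g => ?_)
    (funext fun x => funext fun g => funext fun h => propext ?_) rfl
  · change g ∈ H.envGates E q ∪ (T.tilde q).gates ↔ _
    rw [Finset.mem_union, mem_envGates, mem_setting_gates, Protocol.mem_gates]
    simp only [hq.mem_roles_iff, or_and_right, exists_or]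
    grind
  · change ((_ ∨ _ ∨ _ ∨ _) ∨ (_ ∧ _) ∨ _) ↔ _ ∨ _ ∨ _ ∨ _
    simp only [hq.mem_roles_iff, or_and_right, exists_or]
    grind

theorem env_withIdeal (hH : H.Closed) (hq : q ∉ H.done) (S : OpenCircuit) :
    (H.env E q).withIdeal (T.ideal q) S = (H.next E q S).setting E := by
  refine Setting.ext (Finset.ext fun g => ?_)
    (funext fun x => funext fun g => funext fun h => propext ?_) rfl
  · change g ∈ H.envGates E q ∪ (T.ideal q).gates ∪ S.gates ↔ _
    rw [mem_setting_gates, mem_simGates, exists_sim_next hq S fun S => g ∈ S.gates,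
      Finset.mem_union, Finset.mem_union, mem_envGates, Protocol.mem_gates, mem_simGates]
    simp only [hH.mem_next_roles hq, or_and_right, exists_or]
    grind
  · change (_ ∨ _ ∨ _ ∨ _) ∨ _ ∨ _ ∨ _ ↔ _ ∨ _ ∨ (∃ j ∈ (H.next E q S).done, _) ∨ (_ ∨ _)
    rw [exists_sim_next hq S fun S => S.ord x g h]
    simp only [hH.mem_next_roles hq, or_and_right, exists_or]
    grind

end Hybrid

/-! ### The invariant of the hybrids -/

/-- The environment is valid for the protocol of the tree, and it uses no name that occurs in the
tree. -/
structure Environment.Fresh (E : Environment) (T : ProtocolTree) : Prop where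
  valid : E.Valid T.protocol
  regs : Disjoint E.regs T.allRegs
  gates : Disjoint E.gates T.allGates

/-- `S` is a simulator for `T.tilde j` and `T.ideal j` that uses no name of the environment or of
the tree, and its size is at most `b j`. This is the part of the validity of a simulator that does
not refer to the other circuits of a hybrid. -/
structure ProtocolTree.IsSimulatorAt (T : ProtocolTree) (E : Environment) (b : T.Node → ℕ∞)
    (j : T.Node) (S : OpenCircuit) : Prop where
  regs_env : Disjoint S.regs E.regs
  regs_tree : Disjoint S.regs T.allRegs
  gates_env : Disjoint S.gates E.gates
  gates_tree : Disjoint S.gates T.allGates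
  write : ∀ g ∈ S.gates, ∀ ρ ∈ g.tgt, S.SimMayWrite (T.tilde j) (T.ideal j) g ρ
  read : ∀ g ∈ S.gates, ∀ ρ ∈ g.ctrlRegs, S.SimMayRead (T.tilde j) (T.ideal j) g ρ
  ord_gates : ∀ x g h, S.ord x g h → g ∈ S.gates ∧ h ∈ S.gates
  ord_local : DependsOnlyOn S.ord (S.simRegs (T.tilde j) (T.ideal j))
  size : (S.size : ℕ∞) ≤ b j

namespace Hybrid

open ProtocolTree

variable {T : ProtocolTree} {H : Hybrid T} {E : Environment} {q j : T.Node} {r : Role} {g : Gate}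
  {ρ : Reg} {b : T.Node → ℕ∞} {S : OpenCircuit} {acc : Access → Prop}

/-- The properties of a hybrid that are preserved when the next sub-protocol is replaced. -/
structure Invariant (E : Environment) (b : T.Node → ℕ∞) (H : Hybrid T) : Prop where
  closed : H.Closed
  sim : ∀ j ∈ H.done, T.IsSimulatorAt E b j (H.sim j)
  cross_pairs : ∀ g h, H.cross g h →
    g ∈ (H.setting E).gates ∧ h ∈ (H.setting E).gates ∧ ShareReg g h ∧
      ¬ (g ∈ E.gates ∧ h ∈ E.gates) ∧ ∀ r ∈ H.roles, ¬ (g ∈ r.gates ∧ h ∈ r.gates)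
  isCircuit : (H.setting E).IsCircuit

theorem Closed.mem_of_below (hH : H.Closed) {i : T.Node} (hi : i ∈ H.done) (h : T.Below j i) :
    j ∈ H.done :=
  Relation.ReflTransGen.head_induction_on (motive := fun j _ => j ∈ H.done) h hi
    fun hac _ ih => hH hac ih

theorem Closed.not_below (hH : H.Closed) (hq : q ∉ H.done) (hj : j ∈ H.done) : ¬ T.Below q j :=
  fun h => hq (hH.mem_of_below hj h)

theorem Closed.mem_of_below_ready (hH : H.Closed) (hq : H.Ready q) (h : T.Below j q)
    (hne : j ≠ q) : j ∈ H.done := by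
  obtain ⟨i, hi, hji⟩ := h.exists_child hne
  exact hH.mem_of_below (hq.child_mem i hi) hji

theorem Closed.not_below_of_mem_front (hH : H.Closed) (hq : H.Ready q) (hj : j ∈ H.front)
    (hne : T.parent j ≠ some q) : ¬ T.Below j q := fun h => by
  obtain ⟨hjd, hj⟩ := mem_front.1 hj
  obtain ⟨p, hp, hpq⟩ := h.exists_parent (ne_of_mem_of_not_mem hjd hq.notMem)
  exact hj p hp (hH.mem_of_below_ready hq hpq fun e => hne (e ▸ hp))

theorem Closed.next (hH : H.Closed) (hq : H.Ready q) : (H.next E q S).Closed := fun j p hjp hp => by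
  rcases mem_next_done.1 hp with rfl | hp
  · exact mem_next_done.2 (.inr (hq.child_mem j hjp))
  · exact mem_next_done.2 (.inr (hH hjp hp))

theorem wellFormed_of_mem_rolesOutside (hT : T.WellFormed) (hr : r ∈ H.rolesOutside q) :
    r.WellFormed := by
  rcases mem_rolesOutside.1 hr with ⟨j, -, hr⟩ | ⟨k, -, hr⟩
  · exact (hT.main_wf j).roles_wf r hr
  · exact hT.ideal_role k r hr

theorem mem_allRegs_of_mem_rolesOutside (hr : r ∈ H.rolesOutside q) (hρ : ρ ∈ r.regs) :
    ρ ∈ T.allRegs := by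
  rcases mem_rolesOutside.1 hr with ⟨j, -, hr⟩ | ⟨k, -, hr⟩
  · exact mem_allRegs.2 ⟨j, .inl (mem_mainProtocol_regs hr hρ)⟩
  · exact mem_allRegs.2 ⟨k, .inr (Protocol.mem_regs_of_role hr hρ)⟩

theorem mem_env_regs_or_mem_exchangedRegs
    (h : ρ ∈ E.regs ∨ ρ ∈ T.allRegs ∨ ∃ j ∈ H.done, ρ ∈ (H.sim j).regs) :
    ρ ∈ (H.env E q).regs ∨ ρ ∈ T.exchangedRegs q := by
  classical
  refine or_iff_not_imp_right.2 fun hq => Finset.mem_sdiff.2 ⟨?_, hq⟩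
  simpa [or_assoc] using h

theorem mem_env_regs_of_mem_allRegs (h : ρ ∈ T.allRegs) (hq : ρ ∉ T.exchangedRegs q) :
    ρ ∈ (H.env E q).regs :=
  (mem_env_regs_or_mem_exchangedRegs (.inr (.inl h))).resolve_right hq

theorem notMem_exchangedRegs_of_mem_env_regs (h : ρ ∈ (H.env E q).regs) :
    ρ ∉ T.exchangedRegs q := by
  classical
  exact (Finset.mem_sdiff.1 h).2

theorem mem_env_regs_of_mem_env (hE : E.Fresh T) (hρ : ρ ∈ E.regs) : ρ ∈ (H.env E q).regs :=
  (mem_env_regs_or_mem_exchangedRegs (.inl hρ)).resolve_right fun h =>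
    Finset.disjoint_left.1 hE.regs hρ (exchangedRegs_subset_allRegs h)

theorem mem_envGates_of_mem_env (hg : g ∈ E.gates) : g ∈ H.envGates E q :=
  mem_envGates.2 (.inl hg)

theorem mem_envGates_of_role (hr : r ∈ H.rolesOutside q) (hg : g ∈ r.gates) :
    g ∈ H.envGates E q :=
  mem_envGates.2 (.inr (.inl ⟨r, hr, hg⟩))

theorem mem_envGates_of_sim (hj : j ∈ H.done) (hg : g ∈ (H.sim j).gates) :
    g ∈ H.envGates E q :=
  mem_envGates.2 (.inr (.inr (mem_simGates.2 ⟨j, hj, hg⟩)))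

theorem isSimulatorAt_of_validSimulator (hE : E.Fresh T)
    (hS : S.ValidSimulator (H.env E q) (T.tilde q) (T.ideal q)) (hsize : (S.size : ℕ∞) ≤ b q)
    (hgates : Disjoint S.gates T.allGates) : T.IsSimulatorAt E b q S where
  regs_env := hS.regs_disjoint.1.mono_right fun _ => mem_env_regs_of_mem_env hE
  regs_tree := Finset.disjoint_left.2 fun ρ hρ hρT => by
    by_cases hq : ρ ∈ T.exchangedRegs q
    · exact (Finset.mem_union.1 hq).elim (Finset.disjoint_left.1 hS.regs_disjoint.2.1 hρ)
        (Finset.disjoint_left.1 hS.regs_disjoint.2.2 hρ)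
    · exact Finset.disjoint_left.1 hS.regs_disjoint.1 hρ (mem_env_regs_of_mem_allRegs hρT hq)
  gates_env := hS.gates_disjoint.1.mono_right fun _ => mem_envGates_of_mem_env
  gates_tree := hgates
  write := hS.write
  read := hS.read
  ord_gates := hS.ord_gates
  ord_local := hS.ord_local
  size := hsize

namespace Invariant

variable (hH : H.Invariant E b)
include hH

theorem mem_io_of_mem_rolesOutside (hT : T.WellFormed) (hq : H.Ready q)
    (hr : r ∈ H.rolesOutside q) (hρ : ρ ∈ r.regs) (h : T.OccursBelow q ρ) :
    ρ ∈ (T.ideal q).io := by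
  rcases mem_rolesOutside.1 hr with ⟨j, ⟨hne, hj⟩, hr⟩ | ⟨k, ⟨hk, hne⟩, hr⟩
  · exact hT.main_outside q j (fun hb => hj (hH.closed.mem_of_below_ready hq hb hne)) ρ h
      (mem_mainProtocol_regs hr hρ)
  · exact hT.mem_io_of_not_below (hH.closed.not_below_of_mem_front hq hk hne)
      (hH.closed.not_below hq.notMem (mem_front.1 hk).1) h (Protocol.mem_regs_of_role hr hρ)

theorem mem_env_regs_or_mem_io (hT : T.WellFormed) (hq : H.Ready q) (hr : r ∈ H.rolesOutside q)
    (hρ : ρ ∈ r.regs) : ρ ∈ (H.env E q).regs ∨ ρ ∈ (T.tilde q).io :=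
  (mem_env_regs_or_mem_exchangedRegs
    (.inr (.inl (mem_allRegs_of_mem_rolesOutside hr hρ)))).imp_right fun h =>
      hH.mem_io_of_mem_rolesOutside hT hq hr hρ (occursBelow_of_mem_exchangedRegs h)

theorem mem_env_regs_of_sim (hj : j ∈ H.done) (hρ : ρ ∈ (H.sim j).regs) :
    ρ ∈ (H.env E q).regs :=
  (mem_env_regs_or_mem_exchangedRegs (.inr (.inr ⟨j, hj, hρ⟩))).resolve_right fun h =>
    Finset.disjoint_left.1 (hH.sim j hj).regs_tree hρ (exchangedRegs_subset_allRegs h)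

theorem mem_env_regs_of_simRegs (hT : T.WellFormed) (hq : q ∉ H.done) (hj : j ∈ H.done)
    (hρ : ρ ∈ (H.sim j).simRegs (T.tilde j) (T.ideal j)) : ρ ∈ (H.env E q).regs := by
  rcases Finset.mem_union.1 hρ with hρ | hρ
  · exact hH.mem_env_regs_of_sim hj hρ
  · obtain ⟨hρ, hI⟩ := Finset.mem_sdiff.1 hρ
    exact mem_env_regs_of_mem_allRegs (occursBelow_of_mem_tilde hρ).mem_allRegs
      (hT.notMem_exchangedRegs_of_simulated (hH.closed.not_below hq hj) hρ hI)

theorem disjoint_envGates_tilde_gates (hT : T.WellFormed) (hE : E.Fresh T) :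
    Disjoint (H.envGates E q) (T.tilde q).gates := by
  refine Finset.disjoint_left.2 fun g hg hgt => ?_
  rcases mem_envGates.1 hg with hg | ⟨r, hr, hg⟩ | hg
  · exact Finset.disjoint_left.1 hE.gates hg (tilde_gates_subset_allGates hgt)
  · rcases mem_rolesOutside.1 hr with ⟨j, ⟨hj, -⟩, hr⟩ | ⟨k, ⟨-, hk⟩, hr⟩
    · have hgj := mem_mainProtocol_gates hr hg
      rcases mem_main_or_ideal_of_tilde_gate hgt with h | ⟨i, -, h⟩
      · exact Finset.disjoint_left.1 (hT.main_gates j q hj) hgj h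
      · exact Finset.disjoint_left.1 (hT.main_ideal_gates j i) hgj h
    · have hgk : g ∈ (T.ideal k).gates := Protocol.mem_gates.2 ⟨r, hr, hg⟩
      rcases mem_main_or_ideal_of_tilde_gate hgt with h | ⟨i, hi, h⟩
      · exact Finset.disjoint_left.1 (hT.main_ideal_gates q k) h hgk
      · exact Finset.disjoint_left.1 (hT.ideal_gates k i fun e => hk (e ▸ hi)) hgk h
  · obtain ⟨j, hj, hg⟩ := mem_simGates.1 hg
    exact Finset.disjoint_left.1 (hH.sim j hj).gates_tree hg (tilde_gates_subset_allGates hgt)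

theorem disjoint_envGates_ideal_gates (hT : T.WellFormed) (hE : E.Fresh T) (hq : q ∉ H.done) :
    Disjoint (H.envGates E q) (T.ideal q).gates := by
  refine Finset.disjoint_left.2 fun g hg hgI => ?_
  rcases mem_envGates.1 hg with hg | ⟨r, hr, hg⟩ | hg
  · exact Finset.disjoint_left.1 hE.gates hg (ideal_gates_subset_allGates hgI)
  · rcases mem_rolesOutside.1 hr with ⟨j, -, hr⟩ | ⟨k, ⟨hk, -⟩, hr⟩
    · exact Finset.disjoint_left.1 (hT.main_ideal_gates j q) (mem_mainProtocol_gates hr hg) hgI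
    · exact Finset.disjoint_left.1
        (hT.ideal_gates k q (ne_of_mem_of_not_mem (mem_front.1 hk).1 hq))
        (Protocol.mem_gates.2 ⟨r, hr, hg⟩) hgI
  · obtain ⟨j, hj, hg⟩ := mem_simGates.1 hg
    exact Finset.disjoint_left.1 (hH.sim j hj).gates_tree hg (ideal_gates_subset_allGates hgI)

theorem env_avoids (hT : T.WellFormed) (hE : E.Fresh T) (hq : q ∉ H.done) :
    (H.env E q).Avoids (T.ideal q) :=
  ⟨Finset.disjoint_left.2 fun _ hρ h =>
      notMem_exchangedRegs_of_mem_env_regs hρ (Finset.mem_union_right _ h),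
    hH.disjoint_envGates_ideal_gates hT hE hq⟩

theorem env_access (hT : T.WellFormed) (hE : E.Fresh T) (hq : H.Ready q)
    (hg : g ∈ H.envGates E q) (hρ : ρ ∈ g.regs)
    (henv : g ∈ E.gates → ρ ∈ E.regs ∨ T.protocol.Exposes acc g ρ)
    (hsim : ∀ j ∈ H.done, g ∈ (H.sim j).gates →
      ρ ∈ (H.sim j).simRegs (T.tilde j) (T.ideal j) ∨ ρ ∈ (T.ideal j).cors ∨
        (T.ideal j).ExposesAsCorrupted acc g ρ) :
    ρ ∈ (H.env E q).regs ∨ (T.tilde q).Exposes acc g ρ := by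
  rcases mem_envGates.1 hg with hg | ⟨r, hr, hg⟩ | hg
  · rcases henv hg with h | h
    · exact .inl (mem_env_regs_of_mem_env hE h)
    · exact (mem_env_regs_or_mem_exchangedRegs
        (.inr (.inl (protocol_regs_subset_allRegs h.mem_regs)))).imp_right
          (hT.exposes_tilde_of_exposes_protocol h)
  · exact (hH.mem_env_regs_or_mem_io hT hq hr
      ((wellFormed_of_mem_rolesOutside hT hr).mem_regs_of_gate hg hρ)).imp_right .inl
  · obtain ⟨j, hj, hg⟩ := mem_simGates.1 hg
    have hqj := hH.closed.not_below hq.notMem hj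
    have hmem : ρ ∈ (T.ideal j).regs → ρ ∈ (H.env E q).regs ∨ ρ ∈ T.exchangedRegs q := fun h =>
      mem_env_regs_or_mem_exchangedRegs (.inr (.inl (mem_allRegs.2 ⟨j, .inr h⟩)))
    rcases hsim j hj hg with h | h | h
    · exact .inl (hH.mem_env_regs_of_simRegs hT hq.notMem hj h)
    · exact (hmem (Protocol.mem_regs_of_cors h)).imp_right fun hx =>
        .inr (.inl (hT.mem_tilde_cors_of_mem_ideal_cors hqj h hx))
    · exact (hmem h.mem_regs).imp_right (hT.exposes_tilde_of_exposesAsCorrupted hqj h)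

theorem env_write (hT : T.WellFormed) (hE : E.Fresh T) (hq : H.Ready q)
    (hg : g ∈ H.envGates E q) (hρ : ρ ∈ g.tgt) : (H.env E q).MayWrite (T.tilde q) g ρ :=
  hH.env_access hT hE hq hg (Finset.mem_union_right _ hρ)
    (fun hg => Environment.mayWrite_iff.1 (hE.valid.write g hg ρ hρ))
    fun j hj hg => (OpenCircuit.simMayWrite_iff.1 ((hH.sim j hj).write g hg ρ hρ)).imp_right .inr

theorem env_read (hT : T.WellFormed) (hE : E.Fresh T) (hq : H.Ready q)
    (hg : g ∈ H.envGates E q) (hρ : ρ ∈ g.ctrlRegs) : (H.env E q).MayRead (T.tilde q) g ρ :=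
  hH.env_access hT hE hq hg (Finset.mem_union_left _ hρ)
    (fun hg => Environment.mayRead_iff.1 (hE.valid.read g hg ρ hρ))
    fun j hj hg => OpenCircuit.simMayRead_iff.1 ((hH.sim j hj).read g hg ρ hρ)

theorem env_ord_gates (hT : T.WellFormed) (hE : E.Fresh T) {x : Conf} {g h : Gate}
    (hgh : (H.env E q).ord x g h) : g ∈ H.envGates E q ∧ h ∈ H.envGates E q := by
  rcases hgh with hgh | ⟨r, hr, hgh⟩ | ⟨j, hj, hgh⟩ | hgh
  · exact (hE.valid.ord_gates x g h hgh).imp mem_envGates_of_mem_env mem_envGates_of_mem_env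
  · exact ((wellFormed_of_mem_rolesOutside hT hr).ord_gates x g h hgh).imp
      (mem_envGates_of_role hr) (mem_envGates_of_role hr)
  · exact ((hH.sim j hj).ord_gates x g h hgh).imp
      (mem_envGates_of_sim hj) (mem_envGates_of_sim hj)
  · exact hgh.2

theorem env_ord_local (hT : T.WellFormed) (hE : E.Fresh T) (hq : H.Ready q) :
    DependsOnlyOn (H.env E q).ord (H.env E q).regs := by
  intro x y hxy g h
  refine or_congr
    (hE.valid.ord_local x y (fun ρ hρ => hxy ρ (mem_env_regs_of_mem_env hE hρ)) g h)
    (or_congr (exists_congr fun r => and_congr_right fun hr => ?_)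
      (or_congr (exists_congr fun j => and_congr_right fun hj => ?_) Iff.rfl))
  · have hwf := wellFormed_of_mem_rolesOutside hT hr
    refine hwf.ord_local x y (fun ρ hρ => hxy ρ ?_) g h
    exact (hH.mem_env_regs_or_mem_io hT hq hr (Role.mem_regs.2 (.inl hρ))).resolve_right
      fun hio => (hT.io_link ρ hio).kind_ne_storage (hwf.priv_kind ρ hρ)
  · exact (hH.sim j hj).ord_local x y
      (fun ρ hρ => hxy ρ (hH.mem_env_regs_of_simRegs hT hq.notMem hj hρ)) g h

theorem env_cross_pairs (hT : T.WellFormed) (hq : H.Ready q) {g h : Gate}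
    (hgh : (H.env E q).cross g h) :
    (g ∈ H.envGates E q ∧ h ∈ (T.tilde q).gates ∧ ShareReg g h) ∨
      (g ∈ (T.tilde q).gates ∧ h ∈ H.envGates E q ∧ ShareReg g h) ∨
        (T.tilde q).CrossPair g h := by
  obtain ⟨hgh, hnot⟩ := hgh
  obtain ⟨hg, hh, hshare, -, hroles⟩ := hH.cross_pairs g h hgh
  rw [← env_withProtocol hq] at hg hh
  rcases Finset.mem_union.1 hg with hg | hg <;> rcases Finset.mem_union.1 hh with hh | hh
  · exact absurd ⟨hg, hh⟩ hnot
  · exact .inl ⟨hg, hh, hshare⟩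
  · exact .inr (.inl ⟨hg, hh, hshare⟩)
  · exact .inr (.inr (Protocol.crossPair_of_shareReg (hT.tilde_role q)
      (fun _ hr _ hs hne _ => hT.isLink_of_tilde_roles hr hs hne) hg hh hshare
      fun r hr => hroles r (hq.mem_roles_iff.2 (.inr hr))))

theorem env_valid (hT : T.WellFormed) (hE : E.Fresh T) (hq : H.Ready q) :
    (H.env E q).Valid (T.tilde q) where
  regs_disjoint := Finset.disjoint_left.2 fun _ hρ h =>
    notMem_exchangedRegs_of_mem_env_regs hρ (Finset.mem_union_left _ h)
  gates_disjoint := hH.disjoint_envGates_tilde_gates hT hE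
  out_mem := mem_env_regs_of_mem_env hE hE.valid.out_mem
  out_bit := hE.valid.out_bit
  write _ hg _ hρ := hH.env_write hT hE hq hg hρ
  read _ hg _ hρ := hH.env_read hT hE hq hg hρ
  ord_gates _ _ _ h := hH.env_ord_gates hT hE h
  ord_local := hH.env_ord_local hT hE hq
  cross_pairs _ _ h := hH.env_cross_pairs hT hq h
  isCircuit := by
    rw [env_withProtocol hq]
    exact hH.isCircuit

theorem next_cross_pairs (hT : T.WellFormed) (hE : E.Fresh T) (hq : H.Ready q)
    (hS : S.ValidSimulator (H.env E q) (T.tilde q) (T.ideal q)) {g h : Gate}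
    (hgh : (H.next E q S).cross g h) :
    g ∈ ((H.next E q S).setting E).gates ∧ h ∈ ((H.next E q S).setting E).gates ∧ ShareReg g h ∧
      ¬ (g ∈ E.gates ∧ h ∈ E.gates) ∧
        ∀ r ∈ (H.next E q S).roles, ¬ (g ∈ r.gates ∧ h ∈ r.gates) := by
  have hsetting : ∀ {g}, g ∈ ((H.next E q S).setting E).gates ↔
      (g ∈ H.envGates E q ∨ g ∈ (T.ideal q).gates) ∨ g ∈ S.gates := by
    intro g
    rw [← env_withIdeal hH.closed hq.notMem]
    exact Finset.mem_union.trans (or_congr_left Finset.mem_union)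
  have henvE : ∀ {g}, g ∈ E.gates → g ∈ H.envGates E q := mem_envGates_of_mem_env
  have henvI : ∀ ⦃g⦄, g ∈ H.envGates E q → g ∉ (T.ideal q).gates :=
    Finset.disjoint_left.1 (hH.disjoint_envGates_ideal_gates hT hE hq.notMem)
  have henvS : ∀ ⦃g⦄, g ∈ S.gates → g ∉ H.envGates E q :=
    Finset.disjoint_left.1 hS.gates_disjoint.1
  have hIS : ∀ ⦃g⦄, g ∈ S.gates → g ∉ (T.ideal q).gates :=
    Finset.disjoint_left.1 hS.gates_disjoint.2
  have hrole : ∀ {r}, r ∈ (H.next E q S).roles →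
      (r ∈ H.roles ∧ ∀ g ∈ r.gates, g ∈ H.envGates E q) ∨
        (r ∈ (T.ideal q).roles ∧ ∀ g ∈ r.gates, g ∈ (T.ideal q).gates) := fun hr =>
    ((hH.closed.mem_next_roles hq.notMem).1 hr).imp
      (fun hr => ⟨hq.mem_roles_iff.2 (.inl hr), fun _ => mem_envGates_of_role hr⟩)
      (fun hr => ⟨hr, fun _ hg => Protocol.mem_gates.2 ⟨_, hr, hg⟩⟩)
  rw [hsetting, hsetting]
  rcases hgh with ⟨hgh, hg, hh⟩ | hgh
  · have := hH.cross_pairs g h hgh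
    grind
  · have hshare : ShareLink g h → ShareReg g h := fun ⟨ρ, _, hρ⟩ => ⟨ρ, hρ⟩
    have := hS.cross_pairs g h hgh
    change (_ ∧ h ∈ H.envGates E q ∪ _ ∧ _) ∨ (g ∈ H.envGates E q ∪ _ ∧ _ ∧ _) ∨
      (g ∈ H.envGates E q ∧ _ ∧ _) ∨ (_ ∧ h ∈ H.envGates E q ∧ _) ∨ _ at this
    simp only [Finset.mem_union] at this
    grind

theorem next (hT : T.WellFormed) (hE : E.Fresh T) (hq : H.Ready q)
    (hS : S.ValidSimulator (H.env E q) (T.tilde q) (T.ideal q)) (hsize : (S.size : ℕ∞) ≤ b q)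
    (hgates : Disjoint S.gates T.allGates) : (H.next E q S).Invariant E b where
  closed := hH.closed.next hq
  sim j hj := by
    rcases mem_next_done.1 hj with rfl | hj
    · rw [next_sim_self]
      exact isSimulatorAt_of_validSimulator hE hS hsize hgates
    · rw [next_sim_of_mem hq.notMem hj]
      exact hH.sim j hj
  cross_pairs _ _ h := hH.next_cross_pairs hT hE hq hS h
  isCircuit := by
    rw [← env_withIdeal hH.closed hq.notMem]
    exact hS.isCircuit

end Invariant

end Hybrid

/-! ### Complete hybrids -/

namespace Hybrid

open ProtocolTree

variable {T : ProtocolTree} {H : Hybrid T} {E : Environment} {q j : T.Node} {r : Role} {g : Gate}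
  {ρ : Reg} {b : T.Node → ℕ∞}

/-- All sub-protocols have been replaced, so that only the ideal protocol of the root is left. -/
def Complete (H : Hybrid T) : Prop := ∀ j, j ∈ H.done

open Classical in
/-- The simulators of all nodes, as one simulator for the protocol of the tree and the ideal
protocol of the root. -/
def simulator (H : Hybrid T) : OpenCircuit where
  regs := (T.allRegs ∪ H.done.biUnion fun j => (H.sim j).regs) \
    (T.protocol.regs ∪ (T.ideal T.root).regs)
  gates := H.simGates
  ord x g h := (∃ j ∈ H.done, (H.sim j).ord x g h) ∨
    (H.cross g h ∧ g ∈ H.simGates ∧ h ∈ H.simGates)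
  cross g h := H.cross g h ∧ ¬ (g ∈ H.simGates ∧ h ∈ H.simGates)

theorem Complete.mem_roles_iff (hall : H.Complete) :
    r ∈ H.roles ↔ r ∈ (T.ideal T.root).roles := by
  rw [mem_roles]
  constructor
  · rintro (⟨j, hj, -⟩ | ⟨k, hk, hr⟩)
    · exact absurd (hall j) hj
    · obtain rfl : k = T.root := by
        by_contra hne
        obtain ⟨p, hp, -⟩ := (below_root k).exists_parent hne
        exact (mem_front.1 hk).2 p hp (hall p)
      exact hr
  · exact fun hr => .inr ⟨T.root, mem_front.2 ⟨hall _, by simp [T.parent_root]⟩, hr⟩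

theorem Complete.withIdeal_simulator (hall : H.Complete) :
    E.withIdeal (T.ideal T.root) H.simulator = H.setting E := by
  refine Setting.ext (Finset.ext fun g => ?_)
    (funext fun x => funext fun g => funext fun h => propext ?_) rfl
  · change g ∈ E.gates ∪ (T.ideal T.root).gates ∪ H.simGates ↔ _
    rw [mem_setting_gates, Finset.mem_union, Finset.mem_union, Protocol.mem_gates, or_assoc]
    simp only [hall.mem_roles_iff]
  · change _ ∨ (_ ∨ _) ∨ (_ ∧ _) ∨ _ ↔ _ ∨ _ ∨ _ ∨ _
    simp only [hall.mem_roles_iff]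
    grind

theorem mem_simulator_regs (h : ρ ∈ T.allRegs ∨ ∃ j ∈ H.done, ρ ∈ (H.sim j).regs)
    (hP : ρ ∉ T.protocol.regs) (hI : ρ ∉ (T.ideal T.root).regs) : ρ ∈ H.simulator.regs := by
  refine Finset.mem_sdiff.2 ⟨?_, fun h => (Finset.mem_union.1 h).elim hP hI⟩
  simpa using h

theorem mem_simulator_simRegs_of_mem_allRegs (h : ρ ∈ T.allRegs)
    (hI : ρ ∉ (T.ideal T.root).regs) :
    ρ ∈ H.simulator.simRegs T.protocol (T.ideal T.root) := by
  by_cases hP : ρ ∈ T.protocol.regs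
  · exact Finset.mem_union_right _ (Finset.mem_sdiff.2 ⟨hP, hI⟩)
  · exact Finset.mem_union_left _ (mem_simulator_regs (.inl h) hP hI)

namespace Invariant

variable (hH : H.Invariant E b)
include hH

theorem simulator_regs_disjoint (hE : E.Fresh T) :
    Disjoint H.simulator.regs E.regs ∧ Disjoint H.simulator.regs T.protocol.regs ∧
      Disjoint H.simulator.regs (T.ideal T.root).regs := by
  simp only [Finset.disjoint_left]
  refine ⟨fun ρ hρ hρE => ?_,
    fun ρ hρ h => (Finset.mem_sdiff.1 hρ).2 (Finset.mem_union_left _ h),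
    fun ρ hρ h => (Finset.mem_sdiff.1 hρ).2 (Finset.mem_union_right _ h)⟩
  rcases Finset.mem_union.1 (Finset.mem_sdiff.1 hρ).1 with hρ | hρ
  · exact Finset.disjoint_left.1 hE.regs hρE hρ
  · obtain ⟨j, hj, hρ⟩ := Finset.mem_biUnion.1 hρ
    exact Finset.disjoint_left.1 (hH.sim j hj).regs_env hρ hρE

theorem simulator_gates_disjoint :
    Disjoint H.simulator.gates E.gates ∧ Disjoint H.simulator.gates (T.ideal T.root).gates := by
  simp only [Finset.disjoint_left]
  constructor <;> intro g hg h <;> obtain ⟨j, hj, hg⟩ := mem_simGates.1 hg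
  · exact Finset.disjoint_left.1 (hH.sim j hj).gates_env hg h
  · exact Finset.disjoint_left.1 (hH.sim j hj).gates_tree hg (ideal_gates_subset_allGates h)

theorem mem_simulator_simRegs_of_sim (hT : T.WellFormed) (hj : j ∈ H.done)
    (hρ : ρ ∈ (H.sim j).simRegs (T.tilde j) (T.ideal j)) :
    ρ ∈ H.simulator.simRegs T.protocol (T.ideal T.root) := by
  rcases Finset.mem_union.1 hρ with hρ | hρ
  · have hρT := Finset.disjoint_left.1 (hH.sim j hj).regs_tree hρ
    exact Finset.mem_union_left _ (mem_simulator_regs (.inr ⟨j, hj, hρ⟩)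
      (fun h => hρT (protocol_regs_subset_allRegs h))
      fun h => hρT (mem_allRegs.2 ⟨T.root, .inr h⟩))
  · obtain ⟨hρ, hI⟩ := Finset.mem_sdiff.1 hρ
    exact mem_simulator_simRegs_of_mem_allRegs (occursBelow_of_mem_tilde hρ).mem_allRegs
      (hT.notMem_ideal_of_simulated (below_root j) hρ hI)

omit hH in
theorem mem_simulator_simRegs_or_exposesAsCorrupted {acc : Access → Prop} (hT : T.WellFormed)
    (h : (T.ideal j).ExposesAsCorrupted acc g ρ) :
    ρ ∈ H.simulator.simRegs T.protocol (T.ideal T.root) ∨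
      (T.ideal T.root).ExposesAsCorrupted acc g ρ := by
  by_cases hI : ρ ∈ (T.ideal T.root).regs
  · exact .inr (hT.exposesAsCorrupted_of_below (below_root j) h hI)
  · exact .inl (mem_simulator_simRegs_of_mem_allRegs (mem_allRegs.2 ⟨j, .inr h.mem_regs⟩) hI)

theorem simulator_write (hT : T.WellFormed) (hg : g ∈ H.simGates) (hρ : ρ ∈ g.tgt) :
    H.simulator.SimMayWrite T.protocol (T.ideal T.root) g ρ := by
  obtain ⟨j, hj, hg⟩ := mem_simGates.1 hg
  refine OpenCircuit.simMayWrite_iff.2 ?_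
  rcases OpenCircuit.simMayWrite_iff.1 ((hH.sim j hj).write g hg ρ hρ) with h | h
  · exact .inl (hH.mem_simulator_simRegs_of_sim hT hj h)
  · exact mem_simulator_simRegs_or_exposesAsCorrupted hT h

theorem simulator_read (hT : T.WellFormed) (hg : g ∈ H.simGates) (hρ : ρ ∈ g.ctrlRegs) :
    H.simulator.SimMayRead T.protocol (T.ideal T.root) g ρ := by
  obtain ⟨j, hj, hg⟩ := mem_simGates.1 hg
  refine OpenCircuit.simMayRead_iff.2 ?_
  rcases OpenCircuit.simMayRead_iff.1 ((hH.sim j hj).read g hg ρ hρ) with h | h | h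
  · exact .inl (hH.mem_simulator_simRegs_of_sim hT hj h)
  · by_cases hI : ρ ∈ (T.ideal T.root).regs
    · exact .inr (.inl (hT.mem_ideal_cors_of_mem_ideal_cors h hI))
    · exact .inl (mem_simulator_simRegs_of_mem_allRegs
        (mem_allRegs.2 ⟨j, .inr (Protocol.mem_regs_of_cors h)⟩) hI)
  · exact (mem_simulator_simRegs_or_exposesAsCorrupted hT h).imp_right .inr

theorem simulator_ord_gates {x : Conf} {g h : Gate} (hgh : H.simulator.ord x g h) :
    g ∈ H.simGates ∧ h ∈ H.simGates := by
  rcases hgh with ⟨j, hj, hgh⟩ | hgh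
  · exact ((hH.sim j hj).ord_gates x g h hgh).imp (fun hg => mem_simGates.2 ⟨j, hj, hg⟩)
      fun hh => mem_simGates.2 ⟨j, hj, hh⟩
  · exact hgh.2

theorem simulator_ord_local (hT : T.WellFormed) :
    DependsOnlyOn H.simulator.ord (H.simulator.simRegs T.protocol (T.ideal T.root)) := by
  intro x y hxy g h
  refine or_congr_left (exists_congr fun j => and_congr_right fun hj => ?_)
  exact (hH.sim j hj).ord_local x y
    (fun ρ hρ => hxy ρ (hH.mem_simulator_simRegs_of_sim hT hj hρ)) g h

theorem simulator_cross_pairs (hT : T.WellFormed) (hall : H.Complete) {g h : Gate}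
    (hgh : H.simulator.cross g h) :
    (g ∈ H.simGates ∧ h ∈ E.gates ∪ (T.ideal T.root).gates ∧ ShareReg g h) ∨
      (g ∈ E.gates ∪ (T.ideal T.root).gates ∧ h ∈ H.simGates ∧ ShareReg g h) ∨
      (g ∈ E.gates ∧ h ∈ (T.ideal T.root).gates ∧ ShareReg g h) ∨
      (g ∈ (T.ideal T.root).gates ∧ h ∈ E.gates ∧ ShareReg g h) ∨
      (T.ideal T.root).CrossPair g h := by
  obtain ⟨hgh, hnot⟩ := hgh
  have hsetting : ∀ {g}, g ∈ (H.setting E).gates →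
      g ∈ E.gates ∪ (T.ideal T.root).gates ∨ g ∈ H.simGates := by
    intro g hg
    rw [← hall.withIdeal_simulator] at hg
    exact Finset.mem_union.1 hg
  have hcross : g ∈ (T.ideal T.root).gates → h ∈ (T.ideal T.root).gates → ShareReg g h →
      (∀ r ∈ H.roles, ¬ (g ∈ r.gates ∧ h ∈ r.gates)) → (T.ideal T.root).CrossPair g h :=
    fun hg hh hshare hroles => Protocol.crossPair_of_shareReg (hT.ideal_role _)
      (hT.ideal_wf _).roles_regs hg hh hshare fun r hr => hroles r (hall.mem_roles_iff.2 hr)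
  obtain ⟨hg, hh, hshare, hE, hroles⟩ := hH.cross_pairs g h hgh
  have hg := hsetting hg
  have hh := hsetting hh
  simp only [Finset.mem_union] at hg hh ⊢
  grind

theorem simulator_valid (hT : T.WellFormed) (hE : E.Fresh T) (hall : H.Complete) :
    H.simulator.ValidSimulator E T.protocol (T.ideal T.root) where
  regs_disjoint := hH.simulator_regs_disjoint hE
  gates_disjoint := hH.simulator_gates_disjoint
  write _ hg _ hρ := hH.simulator_write hT hg hρ
  read _ hg _ hρ := hH.simulator_read hT hg hρ
  ord_gates _ _ _ h := hH.simulator_ord_gates h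
  ord_local := hH.simulator_ord_local hT
  cross_pairs _ _ h := hH.simulator_cross_pairs hT hall h
  isCircuit := by
    rw [hall.withIdeal_simulator]
    exact hH.isCircuit

end Invariant

end Hybrid

/-! ### Composition in one tree -/

namespace ProtocolTree

variable {T : ProtocolTree}

/-- The size of all protocols `T.tilde q` and `T.ideal q` together. -/
def totalSize (T : ProtocolTree) : ℕ := ∑ q, ((T.tilde q).size + (T.ideal q).size)

/-- A bound for the sizes of the environments that the hybrids provide for the sub-protocols, if the
protocol of the tree runs in an environment of size `k` and `b q` bounds the size of the simulator
for `q`. -/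
def envSizeBound (T : ProtocolTree) (b : T.Node → ℕ∞) (k : ℕ) : ℕ∞ := k + T.totalSize + ∑ q, b q

/-- For every `q`, there are simulators for `T.tilde q` and `T.ideal q` of size at most `b q`, and
with an error of `ε q k` against environments of size `k`. There is no bound on the size where
`b q = ⊤`. -/
def LocallySimulable (T : ProtocolTree) (b : T.Node → ℕ∞) (ε : T.Node → ℕ → ℝ) : Prop :=
  ∀ q (E : Environment), E.Valid (T.tilde q) → E.Avoids (T.ideal q) →
    Simulates (T.tilde q) (T.ideal q) E fun s δ => (s : ℕ∞) ≤ b q ∧ δ = ε q E.size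

theorem protocol_size_le_totalSize : T.protocol.size ≤ T.totalSize := by
  classical
  have hsub : T.protocol.gates ⊆ Finset.univ.biUnion fun q => (T.tilde q).gates := fun g hg => by
    obtain ⟨r, hr, hg⟩ := Protocol.mem_gates.1 hg
    obtain ⟨q, hr⟩ := mem_protocol_roles.1 hr
    exact Finset.mem_biUnion.2 ⟨q, Finset.mem_univ _,
      Protocol.mem_gates.2 ⟨r, mem_tilde_roles.2 (.inl hr), hg⟩⟩
  calc T.protocol.size ≤ ∑ q, (T.tilde q).size :=
        (gatesSize_mono hsub).trans (gatesSize_biUnion_le _ _)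
    _ ≤ T.totalSize := Finset.sum_le_sum fun _ _ => Nat.le_add_right _ _

theorem ideal_size_le_totalSize (q : T.Node) : (T.ideal q).size ≤ T.totalSize :=
  (Nat.le_add_left _ _).trans (Finset.single_le_sum
    (f := fun q => (T.tilde q).size + (T.ideal q).size) (fun _ _ => Nat.zero_le _)
    (Finset.mem_univ q))

theorem wellFounded_parent : WellFounded fun i q => T.parent i = some q := by
  have : IsTrans T.Node fun i q => T.Below i q ∧ i ≠ q :=
    ⟨fun _ _ _ h h' => ⟨h.1.trans h'.1, fun e => h.2 (h.1.antisymm (e ▸ h'.1))⟩⟩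
  have : Std.Irrefl fun i q => T.Below i q ∧ i ≠ q := ⟨fun _ h => h.2 rfl⟩
  refine Subrelation.wf (fun {i q} h => ?_)
    (Finite.wellFounded_of_trans_of_irrefl fun i q => T.Below i q ∧ i ≠ q)
  refine ⟨below_of_parent h, ?_⟩
  rintro rfl
  exact not_below_of_parent h (Below.refl i)

end ProtocolTree

namespace Hybrid

open ProtocolTree

variable {T : ProtocolTree} {H : Hybrid T} {E : Environment} {q : T.Node} {r : Role}
  {b : T.Node → ℕ∞} {ε : T.Node → ℕ → ℝ}

theorem exists_ready (h : ¬ H.Complete) : ∃ q, H.Ready q := by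
  obtain ⟨q, hq, hmin⟩ := wellFounded_parent.has_min {q | q ∉ H.done} (not_forall.1 h)
  exact ⟨q, hq, fun i hi => not_not.1 fun hid => hmin i hid hi⟩

theorem gatesSize_rolesOutside_le :
    gatesSize ((H.rolesOutside q).biUnion Role.gates) ≤ T.totalSize := by
  classical
  have hsub : (H.rolesOutside q).biUnion Role.gates ⊆
      Finset.univ.biUnion fun j => (T.tilde j).gates ∪ (T.ideal j).gates := fun g hg => by
    obtain ⟨r, hr, hg⟩ := Finset.mem_biUnion.1 hg
    rw [Finset.mem_biUnion]
    rcases mem_rolesOutside.1 hr with ⟨j, _, hr⟩ | ⟨k, _, hr⟩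
    · exact ⟨j, Finset.mem_univ _, Finset.mem_union_left _
        (Protocol.mem_gates.2 ⟨r, mem_tilde_roles.2 (.inl hr), hg⟩)⟩
    · exact ⟨k, Finset.mem_univ _, Finset.mem_union_right _ (Protocol.mem_gates.2 ⟨r, hr, hg⟩)⟩
  exact (gatesSize_mono hsub).trans ((gatesSize_biUnion_le _ _).trans
    (Finset.sum_le_sum fun j _ => gatesSize_union_le _ _))

theorem env_size_le : (H.env E q).size ≤ E.size + T.totalSize + gatesSize H.simGates := by
  classical
  calc (H.env E q).size
      ≤ gatesSize (E.gates ∪ (H.rolesOutside q).biUnion Role.gates) + gatesSize H.simGates :=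
        gatesSize_union_le _ _
    _ ≤ E.size + gatesSize ((H.rolesOutside q).biUnion Role.gates) + gatesSize H.simGates := by
        gcongr
        exact gatesSize_union_le _ _
    _ ≤ E.size + T.totalSize + gatesSize H.simGates := by
        gcongr
        exact gatesSize_rolesOutside_le

theorem Invariant.simGates_size (hH : H.Invariant E b) :
    (gatesSize H.simGates : ℕ∞) ≤ ∑ q, b q :=
  calc (gatesSize H.simGates : ℕ∞) ≤ ((∑ j ∈ H.done, (H.sim j).size : ℕ) : ℕ∞) := by
        exact_mod_cast gatesSize_biUnion_le _ _
    _ = ∑ j ∈ H.done, ((H.sim j).size : ℕ∞) := Nat.cast_sum _ _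
    _ ≤ ∑ j ∈ H.done, b j := Finset.sum_le_sum fun j hj => (hH.sim j hj).size
    _ ≤ ∑ q, b q := Finset.sum_le_sum_of_subset (Finset.subset_univ _)

theorem Invariant.env_size (hH : H.Invariant E b) :
    ((H.env E q).size : ℕ∞) ≤ T.envSizeBound b E.size :=
  calc ((H.env E q).size : ℕ∞)
      ≤ ((E.size + T.totalSize + gatesSize H.simGates : ℕ) : ℕ∞) := Nat.cast_le.2 env_size_le
    _ = E.size + T.totalSize + (gatesSize H.simGates : ℕ∞) := by push_cast; rfl
    _ ≤ T.envSizeBound b E.size := add_le_add_right hH.simGates_size _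

variable (T E) in
/-- The hybrid in which nothing has been replaced. -/
def start : Hybrid T where
  done := ∅
  sim _ := ⟨∅, ∅, fun _ _ _ => False, fun _ _ => False⟩
  cross := E.cross

theorem mem_start_roles : r ∈ (start T E).roles ↔ r ∈ T.protocol.roles := by
  rw [mem_roles, mem_protocol_roles]
  simp [start, mem_front]

theorem start_setting : (start T E).setting E = E.withProtocol T.protocol := by
  refine Setting.ext (Finset.ext fun g => ?_)
    (funext fun x => funext fun g => funext fun h => propext ?_) rfl
  · change _ ↔ g ∈ E.gates ∪ T.protocol.gates
    rw [mem_setting_gates, mem_simGates, Finset.mem_union, Protocol.mem_gates]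
    simp only [mem_start_roles]
    simp [start]
  · change _ ∨ _ ∨ _ ∨ _ ↔ _ ∨ _ ∨ _
    simp only [mem_start_roles]
    simp [start, or_comm]

theorem start_invariant (hE : E.Fresh T) : (start T E).Invariant E b where
  closed _ _ _ hp := absurd hp (Finset.notMem_empty _)
  sim _ hj := absurd hj (Finset.notMem_empty _)
  cross_pairs g h hgh := by
    have hdisj : ∀ ⦃g⦄, g ∈ T.protocol.gates → g ∉ E.gates :=
      Finset.disjoint_right.1 hE.valid.gates_disjoint
    have hrole : ∀ {r g}, r ∈ T.protocol.roles → g ∈ r.gates → g ∈ T.protocol.gates :=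
      fun hr hg => Protocol.mem_gates.2 ⟨_, hr, hg⟩
    have hshare : ShareLink g h → ShareReg g h := fun ⟨ρ, _, hρ⟩ => ⟨ρ, hρ⟩
    have hpairs := hE.valid.cross_pairs g h hgh
    rw [start_setting]
    change g ∈ E.gates ∪ T.protocol.gates ∧ h ∈ E.gates ∪ T.protocol.gates ∧ _
    simp only [mem_start_roles, Finset.mem_union]
    grind
  isCircuit := by
    rw [start_setting]
    exact hE.valid.isCircuit

theorem Invariant.exists_next (hH : H.Invariant E b) (hT : T.WellFormed) (hE : E.Fresh T)
    (hS : T.LocallySimulable b ε) (hq : H.Ready q) :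
    ∃ S, (H.next E q S).Invariant E b ∧
      Close (H.setting E) ((H.next E q S).setting E) (ε q (H.env E q).size) := by
  have hvalid := hH.env_valid hT hE hq
  obtain ⟨S, _, hS, ⟨hsize, rfl⟩, hclose⟩ :=
    hS q (H.env E q) hvalid (hH.env_avoids hT hE hq.notMem)
  obtain ⟨S', hS', hsize', hgates, hclose'⟩ :=
    hS.exists_gates_disjoint (hT.ideal_role q) hvalid.ord_gates T.allGates
  refine ⟨S', hH.next hT hE hq hS' (hsize' ▸ hsize) hgates, ?_⟩
  rw [← env_withIdeal hH.closed hq.notMem, ← env_withProtocol hq]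
  exact hclose' _ _ hclose

open Classical in
theorem Invariant.exists_complete (hH : H.Invariant E b) (hT : T.WellFormed) (hE : E.Fresh T)
    (hS : T.LocallySimulable b ε) (hne : ¬ H.Complete) :
    ∃ (H' : Hybrid T) (m : T.Node → ℕ), H'.Invariant E b ∧ H'.Complete ∧
      (∀ q, (m q : ℕ∞) ≤ T.envSizeBound b E.size) ∧
      Close (H.setting E) (H'.setting E) (∑ q ∈ H.doneᶜ, ε q (m q)) := by
  induction hk : H.doneᶜ.card generalizing H with
  | zero => exact absurd (fun j => by simpa using Finset.ext_iff.1 (Finset.card_eq_zero.1 hk) j) hne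
  | succ k ih =>
    obtain ⟨q, hq⟩ := exists_ready hne
    obtain ⟨S, hnext, hclose⟩ := hH.exists_next hT hE hS hq
    have hqc : q ∈ H.doneᶜ := Finset.mem_compl.2 hq.notMem
    have hdone : (H.next E q S).doneᶜ = H.doneᶜ.erase q := Finset.compl_insert
    by_cases hcomplete : (H.next E q S).Complete
    · refine ⟨_, fun _ => (H.env E q).size, hnext, hcomplete, fun _ => hH.env_size, ?_⟩
      have hempty : (H.next E q S).doneᶜ = ∅ := by
        rw [Finset.compl_eq_empty_iff, Finset.eq_univ_iff_forall]
        exact hcomplete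
      rwa [← Finset.add_sum_erase _ _ hqc, ← hdone, hempty, Finset.sum_empty, add_zero]
    · obtain ⟨H', m, hH', hcomplete', hm, hclose'⟩ := ih hnext hcomplete
        (by rw [hdone, Finset.card_erase_of_mem hqc, hk, Nat.add_sub_cancel])
      refine ⟨H', Function.update m q (H.env E q).size, hH', hcomplete', fun j => ?_, ?_⟩
      · rcases eq_or_ne j q with rfl | hj
        · exact (Function.update_self j _ m).symm ▸ hH.env_size
        · exact (Function.update_of_ne hj _ m).symm ▸ hm j
      · rw [← Finset.add_sum_erase _ _ hqc, ← hdone, Function.update_self,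
          Finset.sum_congr rfl fun j hj => by
            rw [Function.update_of_ne (Finset.ne_of_mem_erase (hdone ▸ hj))]]
        exact hclose.trans hnext.isCircuit hclose'

end Hybrid

theorem ProtocolTree.WellFormed.simulates {T : ProtocolTree} (hT : T.WellFormed)
    {b : T.Node → ℕ∞} {ε : T.Node → ℕ → ℝ} (hS : T.LocallySimulable b ε) {E : Environment}
    (hE : E.Valid T.protocol) (hEI : E.Avoids (T.ideal T.root)) :
    Simulates T.protocol (T.ideal T.root) E fun s δ => (s : ℕ∞) ≤ ∑ q, b q ∧
      ∃ m : T.Node → ℕ, (∀ q, (m q : ℕ∞) ≤ T.envSizeBound b E.size) ∧ δ = ∑ q, ε q (m q) := by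
  refine Simulates.of_forall_disjoint hT.protocol_role (hT.ideal_role _) T.allRegs T.allGates hE hEI
    fun E' hE' _ hregs hgates hsize => ?_
  have hfresh : E'.Fresh T := ⟨hE', hregs, hgates⟩
  obtain ⟨H, m, hH, hcomplete, hm, hclose⟩ := (Hybrid.start_invariant hfresh).exists_complete hT
    hfresh hS fun hcomplete => Finset.notMem_empty _ (hcomplete T.root)
  refine ⟨H.simulator, _, hH.simulator_valid hT hfresh hcomplete,
    ⟨hH.simGates_size, m, hsize ▸ hm, rfl⟩, ?_⟩
  rw [hcomplete.withIdeal_simulator, ← Hybrid.start_setting]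
  simpa [Hybrid.start] using hclose

theorem ProtocolTree.WellFormed.securelyRealizes {T : ProtocolTree} (hT : T.WellFormed)
    {ε : T.Node → ℝ} (h : ∀ q, SecurelyRealizes (T.tilde q) (T.ideal q) fun _ => ε q) :
    SecurelyRealizes T.protocol (T.ideal T.root) fun _ => ∑ q, ε q := fun E hE hEI => by
  have hlocal : T.LocallySimulable (fun _ => ⊤) fun q _ => ε q := fun q E hE hEI =>
    have ⟨S, hS, hclose⟩ := h q E hE hEI
    ⟨S, _, hS, ⟨le_top, rfl⟩, hclose⟩
  obtain ⟨S, _, hS, ⟨-, m, -, rfl⟩, hclose⟩ := hT.simulates hlocal hE hEI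
  exact ⟨S, hS, hclose⟩

/-! ### Negligible errors -/

theorem eventually_eval_mul_two_rpow_le (c : Polynomial ℕ) {α : ℝ} (hα : 0 < α) :
    ∀ᶠ n : ℕ in Filter.atTop, ((c.eval n : ℕ) : ℝ) * (2 : ℝ) ^ (-(α * (n : ℝ))) ≤ 1 := by
  set β := Real.log 2 * α
  have hβ : 0 < β := mul_pos (Real.log_pos one_lt_two) hα
  -- `p (β n) = c n`, so that the decay of `p x / exp x` applies at `x = β n`
  set p : Polynomial ℝ := (c.map (Nat.castRingHom ℝ)).comp (Polynomial.C β⁻¹ * Polynomial.X)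
  have hp : ∀ n : ℕ, p.eval (β * n) = ((c.eval n : ℕ) : ℝ) := fun n => by
    simp only [p, Polynomial.eval_comp, Polynomial.eval_mul, Polynomial.eval_C, Polynomial.eval_X]
    rw [inv_mul_cancel_left₀ hβ.ne', Polynomial.eval_natCast_map]
    rfl
  have hβn : Filter.Tendsto (fun n : ℕ => β * (n : ℝ)) Filter.atTop Filter.atTop :=
    tendsto_natCast_atTop_atTop.const_mul_atTop hβ
  filter_upwards [((Polynomial.tendsto_div_exp_atTop p).comp hβn).eventually_le_const zero_lt_one]
    with n hn
  rw [Function.comp_apply, hp] at hn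
  rwa [Real.rpow_def_of_pos two_pos, mul_neg, Real.exp_neg, ← mul_assoc, ← div_eq_mul_inv]

section

variable {ε : ℕ → ℕ → ℝ} {a : ℕ → ℕ → ℕ} {R : Polynomial ℕ}

theorem eval_bound_of_le_add (ha : ∀ n k, a n k ≤ k + R.eval n) {p : Polynomial ℕ} {f : ℕ → ℕ}
    (hf : ∀ n, f n ≤ p.eval n) (n : ℕ) : a n (f n) ≤ (p + R).eval n := by
  rw [Polynomial.eval_add]
  exact (ha n (f n)).trans (Nat.add_le_add_right (hf n) _)

theorem Negligible.comp_of_le_add (h : Negligible ε) (ha : ∀ n k, a n k ≤ k + R.eval n) :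
    Negligible fun n k => ε n (a n k) :=
  fun p _ hf => h (p + R) _ (eval_bound_of_le_add ha hf)

theorem ExpNegligible.comp_of_le_add (h : ExpNegligible ε) (ha : ∀ n k, a n k ≤ k + R.eval n) :
    ExpNegligible fun n k => ε n (a n k) :=
  fun p _ hf => h (p + R) _ (eval_bound_of_le_add ha hf)

end

section

variable {D : Type} [Fintype D] {ε : D → ℕ → ℕ → ℝ}

theorem Negligible.eval_mul_sum (hε : ∀ d, Negligible (ε d)) (c : Polynomial ℕ) :
    Negligible fun n k => ((c.eval n : ℕ) : ℝ) * ∑ d, max (ε d n k) 0 := by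
  intro p f hf q
  filter_upwards [Filter.eventually_all.2 fun d =>
    hε d p f hf (Polynomial.C (Fintype.card D) * c * q)] with n hn
  rcases isEmpty_or_nonempty D with hD | hD
  · simp
  have hcard : (0 : ℝ) < Fintype.card D := by exact_mod_cast Fintype.card_pos
  have hterm : ∀ d, ((c.eval n : ℕ) : ℝ) * ((q.eval n : ℕ) : ℝ) * max (ε d n (f n)) 0 ≤
      (Fintype.card D : ℝ)⁻¹ := fun d => by
    rw [inv_eq_one_div, le_div_iff₀ hcard]
    have hd := hn d
    simp only [Polynomial.eval_mul, Polynomial.eval_C, Nat.cast_mul] at hd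
    rcases max_cases (ε d n (f n)) 0 with ⟨h, -⟩ | ⟨h, -⟩ <;> rw [h]
    · linarith
    · simp
  calc ((c.eval n : ℕ) : ℝ) * (∑ d, max (ε d n (f n)) 0) * ((q.eval n : ℕ) : ℝ)
      = ∑ d, ((c.eval n : ℕ) : ℝ) * ((q.eval n : ℕ) : ℝ) * max (ε d n (f n)) 0 := by
        rw [← Finset.mul_sum, mul_right_comm]
    _ ≤ ∑ _d : D, (Fintype.card D : ℝ)⁻¹ := Finset.sum_le_sum fun d _ => hterm d
    _ = 1 := by
        rw [Finset.sum_const, Finset.card_univ, nsmul_eq_mul, mul_inv_cancel₀ hcard.ne']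

theorem ExpNegligible.eval_mul_sum (hε : ∀ d, ExpNegligible (ε d)) (c : Polynomial ℕ) :
    ExpNegligible fun n k => ((c.eval n : ℕ) : ℝ) * ∑ d, max (ε d n k) 0 := by
  intro p f hf
  choose α hα hdecay using fun d => hε d p f hf
  -- half of the exponent absorbs the polynomial factor
  obtain ⟨γ, hγ, hγα⟩ : ∃ γ : ℝ, 0 < γ ∧ ∀ d, γ + γ ≤ α d := by
    rcases isEmpty_or_nonempty D with hD | hD
    · exact ⟨1, one_pos, isEmptyElim⟩
    · obtain ⟨d, hd⟩ := Finite.exists_min α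
      exact ⟨α d / 2, half_pos (hα d), fun d' => (add_halves (α d)).trans_le (hd d')⟩
  refine ⟨γ, hγ, ?_⟩
  filter_upwards [Filter.eventually_all.2 hdecay,
    eventually_eval_mul_two_rpow_le (Polynomial.C (Fintype.card D) * c) hγ] with n hn hc
  simp only [Polynomial.eval_mul, Polynomial.eval_C, Nat.cast_mul] at hc
  set x : ℝ := (2 : ℝ) ^ (-(γ * (n : ℝ)))
  have hx : 0 ≤ x := Real.rpow_nonneg two_pos.le _
  have hterm : ∀ d, max (ε d n (f n)) 0 ≤ x * x := fun d => by
    refine max_le ((hn d).trans ?_) (mul_nonneg hx hx)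
    rw [← Real.rpow_add two_pos, ← neg_add, ← add_mul]
    gcongr
    · exact one_le_two
    · exact hγα d
  calc ((c.eval n : ℕ) : ℝ) * ∑ d, max (ε d n (f n)) 0
      ≤ ((c.eval n : ℕ) : ℝ) * ∑ _d : D, x * x := by gcongr with d; exact hterm d
    _ = Fintype.card D * ((c.eval n : ℕ) : ℝ) * x * x := by
        rw [Finset.sum_const, Finset.card_univ, nsmul_eq_mul]; ring
    _ ≤ x := mul_le_of_le_one_left hx hc

end

theorem exists_negligible_bound {D : Type} [Finite D] {ε : D → ℕ → ℕ → ℝ} {Neg : (ℕ → ℕ → ℝ) → Prop}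
    (hNeg : Neg = Negligible ∨ Neg = ExpNegligible) (hε : ∀ d, Neg (ε d)) (c R : Polynomial ℕ) :
    ∃ δ : ℕ → ℕ → ℝ, Neg δ ∧ ∀ (n k : ℕ) (ι : Type) [Fintype ι] (l : ι → D) (m : ι → ℕ),
      Fintype.card ι ≤ c.eval n → (∀ i, m i ≤ k + R.eval n) → ∑ i, ε (l i) n (m i) ≤ δ n k := by
  have := Fintype.ofFinite D
  -- a negligible function need not be monotone in `k`, hence the worst argument up to `k`
  choose a ha hmax using fun d n k => (Finset.Iic k).exists_max_image (ε d n) Finset.nonempty_Iic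
  simp only [Finset.mem_Iic] at ha hmax
  refine ⟨fun n k => ((c.eval n : ℕ) : ℝ) * ∑ d, max (ε d n (a d n (k + R.eval n))) 0, ?_, ?_⟩
  · rcases hNeg with rfl | rfl
    · exact Negligible.eval_mul_sum (fun d => (hε d).comp_of_le_add fun n _ => ha d n _) c
    · exact ExpNegligible.eval_mul_sum (fun d => (hε d).comp_of_le_add fun n _ => ha d n _) c
  intro n k ι _ l m hcard hm
  have hnonneg : ∀ d, 0 ≤ max (ε d n (a d n (k + R.eval n))) 0 := fun d => le_max_right _ _
  calc ∑ i, ε (l i) n (m i) ≤ ∑ _i : ι, ∑ d, max (ε d n (a d n (k + R.eval n))) 0 :=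
        Finset.sum_le_sum fun i _ => (hmax (l i) n _ (m i) (hm i)).trans
          ((le_max_left _ 0).trans
            (Finset.single_le_sum (fun d _ => hnonneg d) (Finset.mem_univ (l i))))
    _ = Fintype.card ι * ∑ d, max (ε d n (a d n (k + R.eval n))) 0 := by
        rw [Finset.sum_const, Finset.card_univ, nsmul_eq_mul]
    _ ≤ ((c.eval n : ℕ) : ℝ) * ∑ d, max (ε d n (a d n (k + R.eval n))) 0 :=
        mul_le_mul_of_nonneg_right (by exact_mod_cast hcard)
          (Finset.sum_nonneg fun d _ => hnonneg d)

/-! ### The computational scenario -/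

theorem exists_polynomial_sum_le {ι : ℕ → Type} [∀ n, Fintype (ι n)] {D : Type} [Finite D]
    (label : ∀ n, ι n → D) {c : Polynomial ℕ} (hcard : ∀ n, Fintype.card (ι n) ≤ c.eval n)
    (f : ∀ n, ι n → ℕ) (hf : ∀ d, ∃ p : Polynomial ℕ, ∀ n i, label n i = d → f n i ≤ p.eval n) :
    ∃ p : Polynomial ℕ, ∀ n, ∑ i, f n i ≤ p.eval n := by
  have := Fintype.ofFinite D
  choose p hp using hf
  refine ⟨c * ∑ d, p d, fun n => ?_⟩
  rw [Polynomial.eval_mul, Polynomial.eval_finsetSum]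
  calc ∑ i, f n i ≤ ∑ _i : ι n, ∑ d, (p d).eval n :=
        Finset.sum_le_sum fun i _ => (hp _ n i rfl).trans
          (Finset.single_le_sum (f := fun d => (p d).eval n) (fun _ _ => Nat.zero_le _)
            (Finset.mem_univ (label n i)))
    _ = Fintype.card (ι n) * ∑ d, (p d).eval n := by
        rw [Finset.sum_const, Finset.card_univ, smul_eq_mul]
    _ ≤ c.eval n * ∑ d, (p d).eval n := Nat.mul_le_mul_right _ (hcard n)

namespace ProtocolTree

variable {T : ℕ → ProtocolTree} {D : Type} {label : ∀ n, (T n).Node → D}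
  {Neg : (ℕ → ℕ → ℝ) → Prop}

theorem exists_polynomial_totalSize_le [Finite D] {c : Polynomial ℕ}
    (hcard : ∀ n, Fintype.card (T n).Node ≤ c.eval n)
    (h : ∀ d, ComputationallyRealizes Neg (κ := fun n => {q : (T n).Node // label n q = d})
      (fun n q => (T n).tilde q.1) (fun n q => (T n).ideal q.1)) :
    ∃ p : Polynomial ℕ, ∀ n, (T n).totalSize ≤ p.eval n := by
  refine exists_polynomial_sum_le label hcard _ fun d => ?_
  obtain ⟨⟨p, hp⟩, ⟨p', hp'⟩, -⟩ := h d
  refine ⟨p + p', fun n q hq => ?_⟩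
  rw [Polynomial.eval_add]
  exact Nat.add_le_add (hp n ⟨q, hq⟩) (hp' n ⟨q, hq⟩)

theorem computationallyRealizes_protocol (hT : ∀ n, (T n).WellFormed)
    (hNeg : Neg = Negligible ∨ Neg = ExpNegligible) [Finite D] {c : Polynomial ℕ}
    (hcard : ∀ n, Fintype.card (T n).Node ≤ c.eval n)
    (h : ∀ d, ComputationallyRealizes Neg (κ := fun n => {q : (T n).Node // label n q = d})
      (fun n q => (T n).tilde q.1) (fun n q => (T n).ideal q.1)) :
    ComputationallyRealizes Neg (κ := fun _ => Unit)
      (fun n _ => (T n).protocol) (fun n _ => (T n).ideal (T n).root) := by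
  obtain ⟨p, hp⟩ := exists_polynomial_totalSize_le hcard h
  choose ε hε s hs using fun d => (h d).2.2
  obtain ⟨s', hs'⟩ := exists_polynomial_sum_le label hcard (fun n q => (s (label n q)).eval n)
    fun d => ⟨s d, fun n q hq => (congrArg (fun d => (s d).eval n) hq).le⟩
  obtain ⟨δ, hδ, hbound⟩ := exists_negligible_bound hNeg hε c (p + s')
  refine ⟨⟨p, fun n _ => protocol_size_le_totalSize.trans (hp n)⟩,
    ⟨p, fun n _ => (ideal_size_le_totalSize _).trans (hp n)⟩, δ, hδ, s', fun n _ E hE hEI => ?_⟩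
  have hlocal : (T n).LocallySimulable (fun q => ((s (label n q)).eval n : ℕ))
      fun q => ε (label n q) n := fun q E hE hEI =>
    have ⟨S, hS, hsize, hclose⟩ := hs (label n q) n ⟨q, rfl⟩ E hE hEI
    ⟨S, _, hS, ⟨Nat.cast_le.2 hsize, rfl⟩, hclose⟩
  obtain ⟨S, _, hS, ⟨hsize, m, hm, rfl⟩, hclose⟩ := (hT n).simulates hlocal hE hEI
  rw [← Nat.cast_sum, Nat.cast_le] at hsize
  have hm' : ∀ q, m q ≤ E.size + (p + s').eval n := fun q => by
    have hq := hm q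
    rw [envSizeBound, ← Nat.cast_sum, ← Nat.cast_add, ← Nat.cast_add, Nat.cast_le] at hq
    rw [Polynomial.eval_add]
    linarith [hp n, hs' n]
  exact ⟨S, hS, hsize.trans (hs' n),
    fun t u => (hclose t u).trans (hbound n E.size (T n).Node (label n) m (hcard n) hm')⟩

end ProtocolTree

end

theorem theorem1 (T : ℕ → ProtocolTree) (hT : ∀ n, (T n).WellFormed) :
    -- unconditional scenario
    (∀ (n : ℕ) (ε : (T n).Node → ℝ),
      (∀ q, SecurelyRealizes ((T n).tilde q) ((T n).ideal q) (fun _ => ε q)) →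
        SecurelyRealizes (T n).protocol ((T n).ideal (T n).root) (fun _ => ∑ q, ε q)) ∧
    -- computational scenario, for polynomially many copies of finitely many definitions
    (∀ (Neg : (ℕ → ℕ → ℝ) → Prop), Neg = Negligible ∨ Neg = ExpNegligible →
      ∀ (D : Type) (_ : Finite D) (label : (n : ℕ) → (T n).Node → D),
        (∃ p : Polynomial ℕ, ∀ n, Fintype.card (T n).Node ≤ p.eval n) →
        (∀ d : D, ComputationallyRealizes Neg (κ := fun n => {q : (T n).Node // label n q = d})
          (fun n q => (T n).tilde q.1) (fun n q => (T n).ideal q.1)) →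
        ComputationallyRealizes Neg (κ := fun _ => Unit)
          (fun n _ => (T n).protocol) (fun n _ => (T n).ideal (T n).root)) := by
  refine ⟨fun n ε h => (hT n).securelyRealizes h, fun Neg hNeg D _ label hcard h => ?_⟩
  obtain ⟨c, hc⟩ := hcard
  exact ProtocolTree.computationallyRealizes_protocol hT hNeg hc h
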